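/- Let $d\ge 2$ and let $P_0$ be the self-adjoint realization of $-\Delta$ on $L^2(\mathbb{R}^d)$. Let $\Theta\in C^2([0,\infty);(0,\infty))$ be a decreasing (i.e. non-increasing) function with $\Theta(r)=O_k((r+1)^{-k})$ for every integer $k\ge 0$, such that for some constants $\widetilde C,C_1,C_2>0$ $$|\partial_r^j\Theta(r)|\le \widetilde C\,\Theta(r)\quad (r\ge 0,\ j=1,2),\qquad \Theta(r_1)\Theta(r_2)\le C_1\Theta(C_2(r_1+r_2))\quad (r_1,r_2>0).$$ Put $\widetilde m_k=\sup_{r\ge 0}(r+1)^k\sqrt{\Theta(r)}$, and let $\{m_k\}_{k\ge 0}$ be an increasing (i.e. non-decreasing) real sequence with $m_0=1$ such that for some constants $C_3,C_4>0$ and all integers $k\ge 0$ $$k!+\widetilde m_k+m_{k+2}+\sqrt{m_{2k}}\le C_3^{k+1}m_k,\qquad \frac{m_\nu m_{k-\nu}}{\nu!(k-\nu)!}\le C_4\frac{m_k}{k!}\quad(0\le\nu\le k).$$ Let $c>0$ and $\mu(x)=\sqrt{\Theta(c\langle x\rangle)}$, $\langle x\rangle=(1+|x|^2)^{1/2}$,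 and let $\alpha,\beta$ be multi-indices with $|\alpha|+|\beta|\le 2$. Then for every $\lambda\in\mathbb{C}$ with $\operatorname{Im}\lambda<0$ the operator $\mu\,\partial_x^\alpha(P_0-\lambda^2)^{-1}\partial_x^\beta\mu$ is densely defined in $L^2(\mathbb{R}^d)$ (on its natural domain) and extends to a bounded operator $T(\lambda)$ on $L^2(\mathbb{R}^d)$. The function $T$ extends continuously, in operator norm, to $\{\operatorname{Im}\lambda\le 0,\ \lambda\ne 0\}$, and its restriction to $\mathbb{R}\setminus\{0\}$, which defines $\mu\,\partial_x^\alpha(P_0-\lambda^2)^{-1}\partial_x^\beta\mu$ for real $\lambda\neq0$, is $C^\infty$ in operator norm. Given any $\delta>0$ there is a constant $C=C_\delta>0$ such that $$\left\|\frac{d^k}{d\lambda^k}\,\mu\,\partial_x^\alpha(P_0-\lambda^2)^{-1}\partial_x^\beta\mu\right\|_{L^2\to L^2}\le C^{k+1}m_k(|\lambda|+1)^{|\alpha|+|\beta|-1}$$ for all integers $k\ge 0$ and all $\lambda\in\mathbb{R}$ with $|\lambda|\ge\delta$. If $d$ is odd, then $T$ extends continuously to $\{\operatorname{Im}\lambda\le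 0\}$, its restriction to $\mathbb{R}$ is $C^\infty$, and the estimate holds, with one constant $C>0$, for all integers $k\ge0$ and all $\lambda\in\mathbb{R}$. -/

import Mathlib

open MeasureTheory
open scoped SchwartzMap LineDeriv Laplacian Nat

noncomputable section

namespace FreeResolvent

/-- The Hilbert space `L²(ℝ^d; ℂ)`. -/
abbrev L2 (d : ℕ) : Type := Lp ℂ 2 (volume : Measure (EuclideanSpace ℝ (Fin d)))

/-- The tempered distributions on `ℝ^d`. -/
abbrev Distr (d : ℕ) : Type := 𝓢'(EuclideanSpace ℝ (Fin d), ℂ)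

/-- The inclusion of `L²(ℝ^d)` into the tempered distributions. -/
def incl (d : ℕ) : L2 d →ₗ[ℂ] Distr d :=
  (Lp.toTemperedDistributionCLM ℂ (volume : Measure (EuclideanSpace ℝ (Fin d))) 2).toLinearMap

theorem incl_apply {d : ℕ} (u : L2 d) : incl d u = Lp.toTemperedDistribution u := rfl

theorem incl_injective (d : ℕ) : Function.Injective (incl d) :=
  LinearMap.ker_eq_bot.mp Lp.ker_toTemperedDistributionCLM_eq_bot

/-- The realization on `L²(ℝ^d)`, with maximal domain, of a linear operator `A` on tempered
distributions: its domain is `{u ∈ L² : A u ∈ L²}`, and on it the operator is `u ↦ A u`. -/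
def l2Realization {d : ℕ} (A : Distr d →ₗ[ℂ] Distr d) : L2 d →ₗ.[ℂ] L2 d where
  domain := (LinearMap.range (incl d)).comap (A ∘ₗ incl d)
  toFun := (LinearEquiv.ofInjective (incl d) (incl_injective d)).symm.toLinearMap ∘ₗ
    (A ∘ₗ incl d).restrict (fun _ hu => hu)

theorem mem_l2Realization_domain {d : ℕ} (A : Distr d →ₗ[ℂ] Distr d) (u : L2 d) :
    u ∈ (l2Realization A).domain ↔ ∃ f : L2 d, incl d f = A (incl d u) := Iff.rfl

theorem incl_l2Realization {d : ℕ} (A : Distr d →ₗ[ℂ] Distr d) (u : (l2Realization A).domain) :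
    incl d (l2Realization A u) = A (incl d (u : L2 d)) :=
  congrArg Subtype.val ((LinearEquiv.ofInjective (incl d) (incl_injective d)).apply_symm_apply
    ⟨A (incl d (u : L2 d)), u.2⟩)

/-- The partial derivative `∂_x^α` of tempered distributions, for a multi-index `α`. -/
def distrDeriv {d : ℕ} (α : Fin d → ℕ) : Distr d →ₗ[ℂ] Distr d :=
  ((List.finRange d).map fun i =>
    ((LineDeriv.lineDerivOpCLM ℂ (Distr d) (EuclideanSpace.single i (1 : ℝ))).toLinearMap :
      Module.End ℂ (Distr d)) ^ α i).prod

/-- The operator `∂_x^α` in `L²(ℝ^d)` with domain `{u ∈ L² : ∂_x^α u ∈ L²}`. -/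
def partialDeriv {d : ℕ} (α : Fin d → ℕ) : L2 d →ₗ.[ℂ] L2 d :=
  l2Realization (distrDeriv α)

/-- The operator `P₀`, the self-adjoint realization of `-Δ` on `L²(ℝ^d)`; its domain is
`{u ∈ L² : Δ u ∈ L²}`, that is, the Sobolev space `H²(ℝ^d)`. -/
def freeLaplacian (d : ℕ) : L2 d →ₗ.[ℂ] L2 d :=
  l2Realization
    (-(LineDeriv.laplacianCLM ℂ (EuclideanSpace ℝ (Fin d)) (Distr d)).toLinearMap)

/-- The resolvent `(P₀ - ζ)⁻¹`, the inverse of the operator `P₀ - ζ`. -/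
def resolvent (d : ℕ) (ζ : ℂ) : L2 d →ₗ.[ℂ] L2 d :=
  (freeLaplacian d - (ζ • (LinearMap.id : L2 d →ₗ[ℂ] L2 d)).toPMap ⊤).inverse

/-- The domain `{f ∈ L² : w f ∈ L²}` of the operator of multiplication by `w`. -/
def mulDomain {d : ℕ} (w : EuclideanSpace ℝ (Fin d) → ℝ) : Submodule ℂ (L2 d) where
  carrier := {f | MemLp (fun x => (w x : ℂ) * f x) 2 volume}
  zero_mem' := by
    refine (memLp_congr_ae (g := fun _ => (0 : ℂ)) ?_).mpr MemLp.zero'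
    filter_upwards [Lp.coeFn_zero ℂ 2 (volume : Measure (EuclideanSpace ℝ (Fin d)))] with x hx
    rw [hx, Pi.zero_apply, mul_zero]
  add_mem' := fun {f g} hf hg => by
    refine (memLp_congr_ae ?_).mpr (MemLp.add hf hg)
    filter_upwards [Lp.coeFn_add f g] with x hx
    rw [hx, Pi.add_apply, Pi.add_apply, mul_add]
  smul_mem' := fun a f hf => by
    refine (memLp_congr_ae ?_).mpr (MemLp.const_smul hf a)
    filter_upwards [Lp.coeFn_smul a f] with x hx
    rw [hx, Pi.smul_apply, Pi.smul_apply, smul_eq_mul, smul_eq_mul, mul_left_comm]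

/-- The operator of multiplication by a real function `w` in `L²(ℝ^d)`, with its natural domain
`{f ∈ L² : w f ∈ L²}` (all of `L²` when `w` is bounded and measurable). -/
def mulOp {d : ℕ} (w : EuclideanSpace ℝ (Fin d) → ℝ) : L2 d →ₗ.[ℂ] L2 d where
  domain := mulDomain w
  toFun :=
    { toFun := fun f => MemLp.toLp (fun x => (w x : ℂ) * (f : L2 d) x) f.2
      map_add' := fun f g => by
        refine Lp.ext ?_
        filter_upwards [Lp.coeFn_add (f : L2 d) (g : L2 d), MemLp.coeFn_toLp (f + g).2,
          MemLp.coeFn_toLp f.2, MemLp.coeFn_toLp g.2,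
          Lp.coeFn_add (MemLp.toLp _ f.2) (MemLp.toLp _ g.2)] with x h h₁ h₂ h₃ h₄
        rw [h₁, h₄, Pi.add_apply, h₂, h₃, Submodule.coe_add, h, Pi.add_apply, mul_add]
      map_smul' := fun a f => by
        refine Lp.ext ?_
        filter_upwards [Lp.coeFn_smul a (f : L2 d), MemLp.coeFn_toLp (a • f).2,
          MemLp.coeFn_toLp f.2, Lp.coeFn_smul a (MemLp.toLp _ f.2)] with x h h₁ h₂ h₃
        rw [RingHom.id_apply, h₁, h₃, Pi.smul_apply, h₂, Submodule.coe_smul, h, Pi.smul_apply,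
          smul_eq_mul, smul_eq_mul, mul_left_comm] }

/-- The natural domain `{u ∈ D(A) : A u ∈ D(B)}` of the composition `B A`. -/
def compDomain {d : ℕ} (B A : L2 d →ₗ.[ℂ] L2 d) : Submodule ℂ (L2 d) :=
  (B.domain.comap A.toFun).map A.domain.subtype

theorem mem_compDomain {d : ℕ} {B A : L2 d →ₗ.[ℂ] L2 d} {u : L2 d} :
    u ∈ compDomain B A ↔ ∃ h : u ∈ A.domain, A ⟨u, h⟩ ∈ B.domain :=
  ⟨fun ⟨v, hv, e⟩ => by subst e; exact ⟨v.2, hv⟩, fun ⟨h, hB⟩ => ⟨⟨u, h⟩, hB, rfl⟩⟩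

/-- The composition `B A` of partially defined operators, with its natural domain. -/
def comp {d : ℕ} (B A : L2 d →ₗ.[ℂ] L2 d) : L2 d →ₗ.[ℂ] L2 d :=
  B.comp (A.domRestrict (compDomain B A)) (fun u => (mem_compDomain.mp u.2.1).2)

theorem mem_comp_domain {d : ℕ} (B A : L2 d →ₗ.[ℂ] L2 d) (u : L2 d) :
    u ∈ (comp B A).domain ↔ ∃ h : u ∈ A.domain, A ⟨u, h⟩ ∈ B.domain :=
  ⟨fun h => mem_compDomain.mp h.1, fun h => ⟨mem_compDomain.mpr h, h.1⟩⟩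

theorem comp_apply {d : ℕ} (B A : L2 d →ₗ.[ℂ] L2 d) (u : (comp B A).domain) :
    comp B A u = B ⟨A ⟨u, u.2.2⟩, (mem_compDomain.mp u.2.1).2⟩ := rfl

/-- The operator `w ∂_x^α (P₀ - z²)⁻¹ ∂_x^β w` in `L²(ℝ^d)` with its natural domain. -/
def weightedResolvent {d : ℕ} (w : EuclideanSpace ℝ (Fin d) → ℝ) (α β : Fin d → ℕ) (z : ℂ) :
    L2 d →ₗ.[ℂ] L2 d :=
  comp (mulOp w) (comp (partialDeriv α) (comp (resolvent d (z ^ 2))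
    (comp (partialDeriv β) (mulOp w))))

/-- The partially defined operator `A` is densely defined and the bounded operator `T` extends it
to all of `L²(ℝ^d)`; such a `T` is unique. -/
def IsBoundedExtension {d : ℕ} (A : L2 d →ₗ.[ℂ] L2 d) (T : L2 d →L[ℂ] L2 d) : Prop :=
  Dense (A.domain : Set (L2 d)) ∧ ∀ u : A.domain, T u = A u

/-- The standing assumptions on the weight profile `Θ : [0, ∞) → (0, ∞)` (its values at negative
arguments play no role). -/
structure IsWeightProfile (Θ : ℝ → ℝ) : Prop where
  contDiffOn : ContDiffOn ℝ 2 Θ (Set.Ici 0)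
  pos : ∀ r, 0 ≤ r → 0 < Θ r
  antitoneOn : AntitoneOn Θ (Set.Ici 0)
  rapid_decay : ∀ k : ℕ, ∃ C : ℝ, ∀ r, 0 ≤ r → (r + 1) ^ k * Θ r ≤ C
  deriv_bound : ∃ C : ℝ, 0 < C ∧ ∀ r, 0 ≤ r → ∀ j : ℕ, 1 ≤ j → j ≤ 2 →
    |iteratedDerivWithin j Θ (Set.Ici 0) r| ≤ C * Θ r
  mul_bound : ∃ C₁ C₂ : ℝ, 0 < C₁ ∧ 0 < C₂ ∧ ∀ r₁ r₂, 0 < r₁ → 0 < r₂ →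
    Θ r₁ * Θ r₂ ≤ C₁ * Θ (C₂ * (r₁ + r₂))

/-- The quantity `sup_{r ≥ 0} (r + 1)^k √Θ(r)` (finite for a weight profile). -/
def tildeM (Θ : ℝ → ℝ) (k : ℕ) : ℝ :=
  ⨆ r : Set.Ici (0 : ℝ), ((r : ℝ) + 1) ^ k * √(Θ r)

/-- The standing assumptions on the sequence `m` attached to the weight profile `Θ`. -/
structure IsWeightSequence (Θ : ℝ → ℝ) (m : ℕ → ℝ) : Prop where
  zero : m 0 = 1
  monotone : Monotone m
  growth : ∃ C₃ : ℝ, 0 < C₃ ∧ ∀ k : ℕ,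
    (k ! : ℝ) + tildeM Θ k + m (k + 2) + √(m (2 * k)) ≤ C₃ ^ (k + 1) * m k
  convolution : ∃ C₄ : ℝ, 0 < C₄ ∧ ∀ k ν : ℕ, ν ≤ k →
    m ν * m (k - ν) / ((ν ! : ℝ) * ((k - ν)! : ℝ)) ≤ C₄ * (m k / (k ! : ℝ))

/-- The weight `μ(x) = √Θ(c⟨x⟩)`, where `⟨x⟩ = (1 + |x|²)^{1/2}`. -/
def weight (d : ℕ) (Θ : ℝ → ℝ) (c : ℝ) (x : EuclideanSpace ℝ (Fin d)) : ℝ :=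
  √(Θ (c * √(1 + ‖x‖ ^ 2)))

end FreeResolvent

end

/-! Put γ = α + β. On the Fourier side the operator becomes the sesquilinear form ∫ ξ^γ (|ξ|² -
z²)⁻¹ F(μu)(ξ) conj(F(μv)(ξ)) dξ, up to a constant and the rescaling z = λ/2π forced by the
normalization of the Fourier transform. For Im z ≠ 0 the symbol is bounded, because |γ| ≤ 2, and it
is holomorphic in z with values in L^∞. What remains is to bound every z-derivative uniformly as Im
z → 0.

In polar coordinates ξ = sθ the singular part of the k-th derivative is k! ∫ q(s) (s - z)^(-k-1) ds
on each ray, with q(s) = s^(d-2+|γ|) θ^γ F(μu)(sθ) conj(F(μv)(sθ)) / 2. Integrating by parts k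
times, and subtracting the value of the density at Re z in the last integral, bounds it by a sum of
(k-j)! sup |q^(j)| over j ≤ k + 1, with (k-j)! read as 1 for j = k + 1
(`norm_factorial_mul_integral_le`). The ray derivatives of F(μu) are Fourier transforms of ⟨y,θ⟩^j
μu, hence are governed by the moments of μ, that is by m_j. The hypotheses on m (products m_i
m_{k-i}, factorials, shifts of the index) absorb all Leibniz sums and factorials into C^(k+1) m_k.

Away from zero energy, partial fractions leave a Cauchy kernel on the annulus | |ξ| - Re z | ≤ δ/2,
and the rest is estimated pointwise. The supremum over s is dominated by integrals over s of a
majorant and of its successor (`norm_le_integral_add_integral`). After integration over the sphere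
these become integrals over ℝ^d, where Cauchy–Schwarz and Plancherel apply with constants
independent of the energy. Comparing s^(d-2+|γ|) with the Jacobian s^(d-1) produces the factor
|λ|^(|γ|-1) (`exists_norm_setIntegral_singularSymbol_le`).

Near zero energy in odd dimension, the two partial fractions have poles at s = z and s = -z. The
substitution ξ ↦ -ξ and the sign (-1)^(d-2) = -1 glue them into one Cauchy integral over (-1, 1),
whose density is smooth across s = 0 (`setIntegral_symbol_eq_cauchy`). The same argument by parts
then works with z near the interior point 0.

Finally, bounds on all derivatives in the lower half-plane make each derivative locally Lipschitz
there, so all of them extend to the real axis and the extensions are successive derivatives of each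
other (`IsBoundedTower`). The extended operator is identified with the natural one by following
Fourier symbols through the composition. Density of its domain comes from the functions g/μ with g
smooth of compact support. -/

namespace FreeResolvent

/-! ### Leibniz sums for towers of derivatives -/

open Finset in
/-- The sequence of derivatives of a product, in terms of those of its factors. -/
def leibnizSeq {R : Type*} [Semiring R] (a b : ℕ → R) (k : ℕ) : R :=
  ∑ i ∈ range (k + 1), (k.choose i : R) * (a i * b (k - i))

/-- Pascal's rule. Derivatives are carried throughout as sequences of functions, each
differentiating to the next, so that explicit bounds can be attached to every order. -/
theorem hasDerivAt_leibnizSeq {𝕜 A : Type*} [NontriviallyNormedField 𝕜] [NormedCommRing A]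
    [NormedAlgebra 𝕜 A] {a b : ℕ → 𝕜 → A} {x : 𝕜}
    (ha : ∀ k, HasDerivAt (a k) (a (k + 1) x) x) (hb : ∀ k, HasDerivAt (b k) (b (k + 1) x) x)
    (k : ℕ) :
    HasDerivAt (fun y => leibnizSeq (fun i => a i y) (fun i => b i y) k)
      (leibnizSeq (fun i => a i x) (fun i => b i x) (k + 1)) x := by
  unfold leibnizSeq
  rw [Finset.sum_choose_succ_mul (fun i j => a i x * b j x) k, ← Finset.sum_add_distrib]
  refine HasDerivAt.fun_sum fun i hi => ?_
  have hik : k + 1 - i = k - i + 1 := by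
    have := Finset.mem_range.mp hi
    omega
  rw [hik]
  have h := ((ha i).mul (hb (k - i))).const_mul (k.choose i : A)
  refine h.congr_deriv ?_
  ring

theorem leibnizSeq_zero {R : Type*} [Semiring R] (a b : ℕ → R) :
    leibnizSeq a b 0 = a 0 * b 0 := by simp [leibnizSeq]

theorem norm_leibnizSeq_le {A : Type*} [NormedCommRing A] [NormOneClass A] {a b : ℕ → A}
    {a' b' : ℕ → ℝ} (ha : ∀ k, ‖a k‖ ≤ a' k) (hb : ∀ k, ‖b k‖ ≤ b' k) (k : ℕ) :
    ‖leibnizSeq a b k‖ ≤ leibnizSeq a' b' k := by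
  refine (norm_sum_le _ _).trans (Finset.sum_le_sum fun i _ => ?_)
  refine (norm_mul_le _ _).trans ?_
  refine mul_le_mul ?_ ?_ (norm_nonneg _) (Nat.cast_nonneg _)
  · have h := Nat.norm_cast_le (α := A) (k.choose i)
    rwa [norm_one, mul_one] at h
  · exact (norm_mul_le _ _).trans
      (mul_le_mul (ha i) (hb _) (norm_nonneg _) ((norm_nonneg _).trans (ha i)))

theorem leibnizSeq_nonneg {a b : ℕ → ℝ} (ha : ∀ k, 0 ≤ a k) (hb : ∀ k, 0 ≤ b k) (k : ℕ) :
    0 ≤ leibnizSeq a b k :=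
  Finset.sum_nonneg fun i _ => mul_nonneg (Nat.cast_nonneg _) (mul_nonneg (ha i) (hb _))

/-! ### Truncated Cauchy integrals, uniformly up to the real axis -/

section CauchyTransform

variable {x y : ℝ}

theorem ofReal_sub_ne_zero {z : ℂ} (hz : z.im ≠ 0) (s : ℝ) : (s : ℂ) - z ≠ 0 := by
  intro h
  apply hz
  have := congrArg Complex.im h
  simpa using this

theorem ofReal_add_ne_zero {z : ℂ} (hz : z.im ≠ 0) (s : ℝ) : (s : ℂ) + z ≠ 0 := by
  have := ofReal_sub_ne_zero (z := -z) (by simpa using hz) s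
  rwa [sub_neg_eq_add] at this

theorem norm_log_le_add_inv_add_pi {z : ℂ} (hz : z ≠ 0) :
    ‖Complex.log z‖ ≤ ‖z‖ + ‖z‖⁻¹ + Real.pi := by
  have h0 : 0 < ‖z‖ := norm_pos_iff.mpr hz
  have h1 : |Real.log ‖z‖| ≤ ‖z‖ + ‖z‖⁻¹ := by
    rw [abs_le]
    have h2 := Real.log_le_sub_one_of_pos h0
    have h3 := Real.log_le_sub_one_of_pos (inv_pos.mpr h0)
    rw [Real.log_inv] at h3
    have := inv_pos.mpr h0
    constructor <;> linarith
  calc ‖Complex.log z‖ ≤ |(Complex.log z).re| + |(Complex.log z).im| :=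
        Complex.norm_le_abs_re_add_abs_im _
    _ ≤ _ := by
        rw [Complex.log_re, Complex.log_im]
        exact add_le_add h1 (Complex.abs_arg_le_pi z)

theorem hasDerivAt_inv_ofReal_sub_pow {z : ℂ} (hz : z.im ≠ 0) (k : ℕ) (s : ℝ) :
    HasDerivAt (fun t : ℝ => ((t : ℂ) - z)⁻¹ ^ (k + 1))
      (-((k + 1 : ℕ) : ℂ) * ((s : ℂ) - z)⁻¹ ^ (k + 2)) s := by
  have h0 := ofReal_sub_ne_zero hz s
  have h1 : HasDerivAt (fun t : ℝ => (t : ℂ) - z) 1 s :=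
    (Complex.ofRealCLM.hasDerivAt).sub_const z
  have h2 := (h1.inv h0).pow (k + 1)
  refine h2.congr_deriv ?_
  simp only [Nat.add_sub_cancel, Pi.inv_apply]
  rw [neg_div, one_div, ← inv_pow]
  ring

theorem continuous_inv_ofReal_sub_pow {z : ℂ} (hz : z.im ≠ 0) (k : ℕ) :
    Continuous fun t : ℝ => ((t : ℂ) - z)⁻¹ ^ k := by
  refine Continuous.pow (Continuous.inv₀ (by fun_prop) fun s => ofReal_sub_ne_zero hz s) k

/-- Since s - z stays in an open half-plane, the principal logarithm is a primitive. It is taken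
only at the endpoints, at distance at least `w` from the pole, so the bound does not see Im z. -/
theorem norm_integral_inv_ofReal_sub_le {a b w : ℝ} {z : ℂ} (hz : z.im ≠ 0) (hz1 : |z.im| ≤ 1)
    (hw : 0 < w) (ha : a + w ≤ z.re) (hb : z.re + w ≤ b) :
    ‖∫ s in a..b, ((s : ℂ) - z)⁻¹‖ ≤ 2 * (b - a + 1 + w⁻¹ + Real.pi) := by
  have hd : ∀ s ∈ Set.uIcc a b,
      HasDerivAt (fun t : ℝ => Complex.log ((t : ℂ) - z)) ((s : ℂ) - z)⁻¹ s := by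
    intro s _
    have h1 : HasDerivAt (fun t : ℝ => (t : ℂ) - z) 1 s :=
      (Complex.ofRealCLM.hasDerivAt).sub_const z
    have h2 := h1.clog_real (Complex.mem_slitPlane_iff.mpr (Or.inr (by simpa using hz)))
    simpa using h2
  have hc : Continuous fun t : ℝ => ((t : ℂ) - z)⁻¹ := by
    simpa using continuous_inv_ofReal_sub_pow hz 1
  rw [intervalIntegral.integral_eq_sub_of_hasDerivAt hd (hc.intervalIntegrable _ _)]
  have key : ∀ s : ℝ, w ≤ |s - z.re| → |s - z.re| ≤ b - a →
      ‖Complex.log ((s : ℂ) - z)‖ ≤ b - a + 1 + w⁻¹ + Real.pi := by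
    intro s h1 h2
    have hre : ((s : ℂ) - z).re = s - z.re := by simp
    have him : |((s : ℂ) - z).im| = |z.im| := by simp
    have h3 := Complex.norm_le_abs_re_add_abs_im ((s : ℂ) - z)
    have h4 := Complex.abs_re_le_norm ((s : ℂ) - z)
    rw [hre] at h3 h4
    rw [him] at h3
    have h5 : ‖(s : ℂ) - z‖⁻¹ ≤ w⁻¹ := inv_anti₀ hw (h1.trans h4)
    have h6 := norm_log_le_add_inv_add_pi (ofReal_sub_ne_zero hz s)
    linarith
  have hB := key b (by rw [abs_of_nonneg] <;> linarith) (by rw [abs_of_nonneg] <;> linarith)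
  have hA := key a (by rw [abs_of_nonpos] <;> linarith) (by rw [abs_of_nonpos] <;> linarith)
  refine (norm_sub_le _ _).trans ?_
  linarith

/-- The constant in the bound for derivatives of truncated Cauchy transforms. -/
noncomputable def cauchyConst (ℓ w : ℝ) : ℝ := 2 * (ℓ + 1 + w⁻¹ + Real.pi)

theorem one_le_cauchyConst {ℓ w : ℝ} (hℓ : 0 ≤ ℓ) (hw : 0 < w) : 1 ≤ cauchyConst ℓ w := by
  unfold cauchyConst
  have := Real.pi_pos
  have := inv_pos.mpr hw
  linarith

/-- Subtracting the constant `q z.re` cancels the singularity: the difference quotient is bounded by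
N', and the constant multiplies the logarithmic integral. -/
theorem norm_integral_mul_inv_ofReal_sub_le {a b w : ℝ} {z : ℂ} (hz : z.im ≠ 0)
    (hz1 : |z.im| ≤ 1) (hw : 0 < w) (ha : a + w ≤ z.re) (hb : z.re + w ≤ b)
    {q q' : ℝ → ℂ} (hq : ∀ s, HasDerivAt q (q' s) s) {N N' : ℝ}
    (hN : ∀ s ∈ Set.Icc a b, ‖q s‖ ≤ N) (hN' : ∀ s ∈ Set.Icc a b, ‖q' s‖ ≤ N') :
    ‖∫ s in a..b, q s * ((s : ℂ) - z)⁻¹‖ ≤ cauchyConst (b - a) w * (N + N') := by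
  have hab : a ≤ b := by linarith
  have hxm : z.re ∈ Set.Icc a b := ⟨by linarith, by linarith⟩
  have hc : Continuous fun t : ℝ => ((t : ℂ) - z)⁻¹ := by
    simpa using continuous_inv_ofReal_sub_pow hz 1
  have hqc : Continuous q := continuous_iff_continuousAt.mpr fun s => (hq s).continuousAt
  have hsplit : ∫ s in a..b, q s * ((s : ℂ) - z)⁻¹ =
      (∫ s in a..b, (q s - q z.re) * ((s : ℂ) - z)⁻¹) +
        q z.re * ∫ s in a..b, ((s : ℂ) - z)⁻¹ := by
    rw [← intervalIntegral.integral_const_mul, ← intervalIntegral.integral_add]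
    · congr 1
      ext s
      ring
    · exact Continuous.intervalIntegrable (by fun_prop) _ _
    · exact Continuous.intervalIntegrable (by fun_prop) _ _
  have hN0 : 0 ≤ N := (norm_nonneg _).trans (hN _ hxm)
  have hN0' : 0 ≤ N' := (norm_nonneg _).trans (hN' _ hxm)
  have h1 : ‖∫ s in a..b, (q s - q z.re) * ((s : ℂ) - z)⁻¹‖ ≤ N' * |b - a| := by
    refine intervalIntegral.norm_integral_le_of_norm_le_const fun s hs => ?_
    rw [Set.uIoc_of_le hab] at hs
    have h2 : ‖q s - q z.re‖ ≤ N' * ‖s - z.re‖ :=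
      (convex_Icc a b).norm_image_sub_le_of_norm_hasDerivWithin_le
        (fun t _ => (hq t).hasDerivWithinAt) hN' hxm ⟨hs.1.le, hs.2⟩
    have h3 : ‖s - z.re‖ ≤ ‖(s : ℂ) - z‖ := by
      have := Complex.abs_re_le_norm ((s : ℂ) - z)
      simpa using this
    rw [norm_mul, norm_inv, ← div_eq_mul_inv,
      div_le_iff₀ (norm_pos_iff.mpr (ofReal_sub_ne_zero hz s))]
    exact h2.trans (mul_le_mul_of_nonneg_left h3 hN0')
  rw [hsplit]
  have h4 := norm_integral_inv_ofReal_sub_le hz hz1 hw ha hb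
  have h5 : ‖q z.re * ∫ s in a..b, ((s : ℂ) - z)⁻¹‖ ≤ N * cauchyConst (b - a) w := by
    rw [norm_mul]
    exact mul_le_mul (hN _ hxm) h4 (norm_nonneg _) hN0
  rw [abs_of_nonneg (by linarith)] at h1
  have h6 : N' * (b - a) ≤ N' * cauchyConst (b - a) w := by
    refine mul_le_mul_of_nonneg_left ?_ hN0'
    unfold cauchyConst
    have := Real.pi_pos
    have := inv_pos.mpr hw
    linarith
  refine (norm_add_le _ _).trans ?_
  linarith

/-- Bound, uniform up to the real axis, for the derivatives of a truncated Cauchy transform. -/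
theorem norm_factorial_mul_integral_le {a b w : ℝ} {z : ℂ} (hz : z.im ≠ 0)
    (hz1 : |z.im| ≤ 1) (hw : 0 < w) (ha : a + w ≤ z.re) (hb : z.re + w ≤ b)
    (k : ℕ) : ∀ (q : ℕ → ℝ → ℂ) (_ : ∀ j s, HasDerivAt (q j) (q (j + 1) s) s) (N : ℕ → ℝ)
    (_ : ∀ j, ∀ s ∈ Set.Icc a b, ‖q j s‖ ≤ N j),
    ‖(k ! : ℂ) * ∫ s in a..b, q 0 s * ((s : ℂ) - z)⁻¹ ^ (k + 1)‖ ≤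
      cauchyConst (b - a) w ^ (k + 1) * ∑ j ∈ Finset.range (k + 2), ((k - j)! : ℝ) * N j := by
  have hab : a ≤ b := by linarith
  have hC1 := one_le_cauchyConst (sub_nonneg.mpr hab) hw
  set C := cauchyConst (b - a) w with hC
  have hCw : 2 * w⁻¹ ≤ C := by
    rw [hC, cauchyConst]
    have := Real.pi_pos
    linarith
  induction k with
  | zero =>
    intro q hq N hN
    have := norm_integral_mul_inv_ofReal_sub_le hz hz1 hw ha hb (hq 0) (hN 0) (hN 1)
    simpa [Finset.sum_range_succ] using this
  | succ k ih =>
    intro q hq N hN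
    have hN0 : ∀ j, 0 ≤ N j := fun j => (norm_nonneg _).trans (hN j a ⟨le_rfl, hab⟩)
    have hqc : ∀ j, Continuous (q j) := fun j =>
      continuous_iff_continuousAt.mpr fun s => (hq j s).continuousAt
    -- One integration by parts lowers the order of the pole and replaces `q 0` by `q 1`. The
    -- boundary terms sit at distance at least `w` from Re z.
    have hparts := intervalIntegral.integral_mul_deriv_eq_deriv_mul (a := a) (b := b)
      (fun s _ => hq 0 s) (fun s _ => hasDerivAt_inv_ofReal_sub_pow hz k s)
      ((hqc 1).intervalIntegrable _ _)
      (((continuous_inv_ofReal_sub_pow hz (k + 2)).const_mul _).intervalIntegrable _ _)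
    have hrw : (((k + 1)! : ℕ) : ℂ) * ∫ s in a..b, q 0 s * ((s : ℂ) - z)⁻¹ ^ (k + 1 + 1) =
        (k ! : ℂ) * (∫ s in a..b, q 1 s * ((s : ℂ) - z)⁻¹ ^ (k + 1)) +
        (k ! : ℂ) * (q 0 a * ((a : ℂ) - z)⁻¹ ^ (k + 1)) -
        (k ! : ℂ) * (q 0 b * ((b : ℂ) - z)⁻¹ ^ (k + 1)) := by
      have e : ∫ s in a..b, q 0 s * (-((k + 1 : ℕ) : ℂ) * ((s : ℂ) - z)⁻¹ ^ (k + 2)) =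
          -((k + 1 : ℕ) : ℂ) * ∫ s in a..b, q 0 s * ((s : ℂ) - z)⁻¹ ^ (k + 1 + 1) := by
        rw [← intervalIntegral.integral_const_mul]
        congr 1
        ext s
        ring
      rw [e] at hparts
      rw [Nat.factorial_succ]
      push_cast at hparts ⊢
      linear_combination (-(k ! : ℂ)) * hparts
    have hbd : ∀ s : ℝ, s ∈ Set.Icc a b → w ≤ |s - z.re| →
        ‖(k ! : ℂ) * (q 0 s * ((s : ℂ) - z)⁻¹ ^ (k + 1))‖ ≤ k ! * N 0 * w⁻¹ ^ (k + 1) := by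
      intro s hs hsw
      have h4 : |s - z.re| ≤ ‖(s : ℂ) - z‖ := by
        have := Complex.abs_re_le_norm ((s : ℂ) - z)
        simpa using this
      have h5 : ‖(s : ℂ) - z‖⁻¹ ≤ w⁻¹ := inv_anti₀ hw (hsw.trans h4)
      rw [norm_mul, norm_mul, norm_pow, norm_inv, Complex.norm_natCast, ← mul_assoc]
      gcongr
      · exact mul_nonneg (Nat.cast_nonneg _) (hN0 0)
      · exact hN 0 s hs
    have hA := hbd a ⟨le_rfl, hab⟩ (by rw [abs_of_nonpos] <;> linarith)
    have hB := hbd b ⟨hab, le_rfl⟩ (by rw [abs_of_nonneg] <;> linarith)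
    have hI := ih (fun j => q (j + 1)) (fun j => hq (j + 1)) (fun j => N (j + 1))
      (fun j => hN (j + 1))
    simp only [zero_add] at hI
    rw [hrw]
    have htri : ∀ u v t : ℂ, ‖u + v - t‖ ≤ ‖u‖ + ‖v‖ + ‖t‖ := fun u v t =>
      (norm_sub_le _ _).trans (add_le_add_left (norm_add_le _ _) _)
    refine (htri _ _ _).trans ?_
    rw [Finset.sum_range_succ']
    simp only [Nat.add_sub_add_right, Nat.sub_zero]
    set S := ∑ j ∈ Finset.range (k + 2), ((k - j)! : ℝ) * N (j + 1)
    have hS : 0 ≤ S := Finset.sum_nonneg fun j _ => mul_nonneg (Nat.cast_nonneg _) (hN0 _)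
    have hP : C ^ (k + 1) ≤ C ^ (k + 2) := pow_le_pow_right₀ hC1 (by omega)
    have hw0 : 0 < w⁻¹ := inv_pos.mpr hw
    -- The two boundary terms together; the summand `2 * w⁻¹` in `cauchyConst` is there to absorb
    -- them.
    have h2w : 2 * w⁻¹ ^ (k + 1) ≤ C ^ (k + 2) := by
      refine le_trans ?_ hP
      calc 2 * w⁻¹ ^ (k + 1) ≤ 2 ^ (k + 1) * w⁻¹ ^ (k + 1) := by
            gcongr
            exact le_self_pow₀ (by norm_num) (by omega)
        _ = (2 * w⁻¹) ^ (k + 1) := by rw [mul_pow]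
        _ ≤ C ^ (k + 1) := by gcongr
    have hfac : (k ! : ℝ) ≤ ((k + 1)! : ℝ) := by exact_mod_cast Nat.factorial_le (by omega)
    have hk0 : (0 : ℝ) ≤ k ! := Nat.cast_nonneg _
    have t1 : C ^ (k + 1) * S ≤ C ^ (k + 2) * S := mul_le_mul_of_nonneg_right hP hS
    have t2 : 2 * w⁻¹ ^ (k + 1) * ((k ! : ℝ) * N 0) ≤ C ^ (k + 2) * (((k + 1)! : ℝ) * N 0) := by
      have := hN0 0
      gcongr
    have hkk : k + 1 + 1 = k + 2 := rfl
    rw [hkk]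
    nlinarith [t1, t2, hI, hA, hB]

end CauchyTransform

end FreeResolvent

namespace FreeResolvent

/-! ### Weight sequences absorb Leibniz sums and factorials -/

section Sequences

/-- The properties of a weight sequence which are stable under the operations performed below,
with a single constant `A`. -/
structure IsAdmissible (m : ℕ → ℝ) (A : ℝ) : Prop where
  one_le_const : 1 ≤ A
  one_le : ∀ k, 1 ≤ m k
  factorial_le : ∀ k, (k ! : ℝ) ≤ A ^ (k + 1) * m k
  succ_le : ∀ k, m (k + 1) ≤ A ^ (k + 1) * m k
  choose_mul_le : ∀ k i, i ≤ k → (k.choose i : ℝ) * (m i * m (k - i)) ≤ A * m k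

theorem tildeM_nonneg (Θ : ℝ → ℝ) (k : ℕ) : 0 ≤ tildeM Θ k :=
  Real.iSup_nonneg fun r => mul_nonneg (pow_nonneg (by have := r.2.out; linarith) _)
    (Real.sqrt_nonneg _)

/-- All terms on the left of the growth condition are nonnegative, so each is bounded separately.
The convolution condition multiplied by k! is the binomial bound. -/
theorem IsWeightSequence.exists_isAdmissible {Θ : ℝ → ℝ} {m : ℕ → ℝ}
    (hm : IsWeightSequence Θ m) :
    ∃ A, IsAdmissible m A ∧ ∀ k, tildeM Θ k ≤ A ^ (k + 1) * m k := by
  obtain ⟨C₃, h3, hg⟩ := hm.growth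
  obtain ⟨C₄, h4, hc⟩ := hm.convolution
  have one_le : ∀ k, 1 ≤ m k := fun k => hm.zero ▸ hm.monotone (Nat.zero_le k)
  set A := 1 + C₃ + C₄
  have hpow : ∀ k, C₃ ^ (k + 1) * m k ≤ A ^ (k + 1) * m k := fun k =>
    mul_le_mul_of_nonneg_right (pow_le_pow_left₀ h3.le (by simp only [A]; linarith) _)
      (zero_le_one.trans (one_le k))
  have hk0 : ∀ k : ℕ, (0 : ℝ) ≤ k ! := fun k => Nat.cast_nonneg _
  refine ⟨A, ⟨by simp only [A]; linarith, one_le, fun k => ?_, fun k => ?_, fun k i hi => ?_⟩,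
    fun k => ?_⟩
  · linarith [hg k, hpow k, tildeM_nonneg Θ k, one_le (k + 2), Real.sqrt_nonneg (m (2 * k))]
  · linarith [hg k, hpow k, tildeM_nonneg Θ k, hm.monotone (show k + 1 ≤ k + 2 by omega), hk0 k,
      Real.sqrt_nonneg (m (2 * k))]
  · have hf : (0 : ℝ) < k ! := by positivity
    have h := mul_le_mul_of_nonneg_left (hc k i hi) hf.le
    rw [Nat.cast_choose ℝ hi]
    have e : (k ! : ℝ) * (C₄ * (m k / k !)) = C₄ * m k := by field_simp
    rw [e] at h
    have h5 : C₄ * m k ≤ A * m k := mul_le_mul_of_nonneg_right (by simp only [A]; linarith)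
      (zero_le_one.trans (one_le k))
    refine le_trans (le_of_eq ?_) (h.trans h5)
    ring
  · linarith [hg k, hpow k, one_le (k + 2), hk0 k, Real.sqrt_nonneg (m (2 * k))]

variable {m : ℕ → ℝ} {A B : ℝ}

theorem IsAdmissible.nonneg (hm : IsAdmissible m A) (k : ℕ) : 0 ≤ m k :=
  zero_le_one.trans (hm.one_le k)

theorem natCast_succ_le_two_pow (k : ℕ) : ((k + 1 : ℕ) : ℝ) ≤ 2 ^ (k + 1) := by
  exact_mod_cast (Nat.lt_two_pow_self (n := k + 1)).le

/-- Each term of a Leibniz sum costs one factor `A`. The number k + 1 of terms and the extra power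
of `B` are hidden in a larger geometric constant, so the form `B ^ (k + 1) * m k` reproduces itself.
-/
theorem IsAdmissible.sum_choose_le (hm : IsAdmissible m A) (hB : 1 ≤ B) {N : ℝ} (hN : 0 ≤ N)
    {X : ℕ → ℕ → ℝ} (hX : ∀ i j, X i j ≤ N * (B ^ (i + 1) * m i * (B ^ (j + 1) * m j))) (k : ℕ) :
    ∑ i ∈ Finset.range (k + 1), (k.choose i : ℝ) * X i (k - i) ≤
      N * ((2 * A * B ^ 2) ^ (k + 1) * m k) := by
  have hA := hm.one_le_const
  have hmk := hm.nonneg k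
  have h1 : ∀ i ∈ Finset.range (k + 1), (k.choose i : ℝ) * X i (k - i) ≤
      N * (B ^ (k + 2) * (A * m k)) := by
    intro i hi
    have hik : i ≤ k := Nat.lt_succ_iff.mp (Finset.mem_range.mp hi)
    calc (k.choose i : ℝ) * X i (k - i) ≤ (k.choose i : ℝ) *
          (N * (B ^ (i + 1) * m i * (B ^ (k - i + 1) * m (k - i)))) :=
          mul_le_mul_of_nonneg_left (hX _ _) (Nat.cast_nonneg _)
      _ = N * (B ^ ((i + 1) + (k - i + 1)) * ((k.choose i : ℝ) * (m i * m (k - i)))) := by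
          rw [pow_add]; ring
      _ ≤ N * (B ^ (k + 2) * (A * m k)) := by
          rw [show (i + 1) + (k - i + 1) = k + 2 by omega]
          have := hm.choose_mul_le k i hik
          gcongr
  refine (Finset.sum_le_card_nsmul _ _ _ h1).trans ?_
  rw [Finset.card_range, nsmul_eq_mul]
  have h2 : B ^ (k + 2) ≤ (B ^ 2) ^ (k + 1) := by
    rw [← pow_mul]
    exact pow_le_pow_right₀ hB (by omega)
  have h3 : A ≤ A ^ (k + 1) := le_self_pow₀ hA (by omega)
  calc ((k + 1 : ℕ) : ℝ) * (N * (B ^ (k + 2) * (A * m k)))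
      ≤ 2 ^ (k + 1) * (N * ((B ^ 2) ^ (k + 1) * (A ^ (k + 1) * m k))) := by
        have := natCast_succ_le_two_pow k
        gcongr
    _ = _ := by rw [mul_pow, mul_pow]; ring

theorem IsAdmissible.leibnizSeq_le (hm : IsAdmissible m A) (hB : 1 ≤ B) {a b : ℕ → ℝ} {N N' : ℝ}
    (ha : ∀ k, 0 ≤ a k) (hb : ∀ k, 0 ≤ b k)
    (ha' : ∀ k, a k ≤ N * (B ^ (k + 1) * m k)) (hb' : ∀ k, b k ≤ N' * (B ^ (k + 1) * m k))
    (hN : 0 ≤ N) (hN' : 0 ≤ N') (k : ℕ) :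
    leibnizSeq a b k ≤ N * N' * ((2 * A * B ^ 2) ^ (k + 1) * m k) := by
  refine hm.sum_choose_le hB (X := fun i j => a i * b j) (mul_nonneg hN hN') (fun i j => ?_) k
  refine (mul_le_mul (ha' i) (hb' j) (hb j) ((ha i).trans (ha' i))).trans (le_of_eq ?_)
  ring

/-- This is the sum left by repeated integration by parts: (k - j)! is traded for m (k - j), and
then m j · m (k - j) for m k. -/
theorem IsAdmissible.sum_factorial_le (hm : IsAdmissible m A) (hB : 1 ≤ B) {M : ℕ → ℝ} {N : ℝ}
    (hN : 0 ≤ N) (hM : ∀ j, M j ≤ N * (B ^ (j + 1) * m j)) (k : ℕ) :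
    ∑ j ∈ Finset.range (k + 2), ((k - j)! : ℝ) * M j ≤
      N * ((4 * A ^ 2 * B ^ 2) ^ (k + 1) * m k) := by
  have hA := hm.one_le_const
  have hmk := hm.nonneg k
  have h1 : ∀ j ∈ Finset.range (k + 2), ((k - j)! : ℝ) * M j ≤
      N * (B ^ (k + 2) * (A ^ (k + 2) * m k)) := by
    intro j hj
    -- The index j = k + 1 comes from the difference quotient in the last integral. There `k - j`
    -- truncates to 0, and the shift bound on `m` replaces the binomial one.
    rcases Nat.lt_or_ge k j with hkj | hjk
    · have hj' : j = k + 1 := by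
        have := Finset.mem_range.mp hj
        omega
      subst hj'
      have h2 := hm.succ_le k
      have h3 : A ^ (k + 1) ≤ A ^ (k + 2) := pow_le_pow_right₀ hA (by omega)
      rw [Nat.sub_eq_zero_of_le (by omega), Nat.factorial_zero, Nat.cast_one, one_mul]
      calc M (k + 1) ≤ N * (B ^ (k + 2) * m (k + 1)) := hM (k + 1)
        _ ≤ N * (B ^ (k + 2) * (A ^ (k + 1) * m k)) := by gcongr
        _ ≤ _ := by gcongr
    · have h2 := hm.factorial_le (k - j)
      have h3 := hm.choose_mul_le k j hjk
      have h4 : m j * m (k - j) ≤ A * m k := by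
        refine le_trans (le_mul_of_one_le_left
          (mul_nonneg (hm.nonneg _) (hm.nonneg _)) ?_) h3
        exact_mod_cast Nat.choose_pos hjk
      have h5 : B ^ (j + 1) ≤ B ^ (k + 2) := pow_le_pow_right₀ hB (by omega)
      have h6 : A ^ (k - j + 1) ≤ A ^ (k + 1) := pow_le_pow_right₀ hA (by omega)
      have hm0 := hm.nonneg
      calc ((k - j)! : ℝ) * M j ≤ (A ^ (k - j + 1) * m (k - j)) * (N * (B ^ (j + 1) * m j)) := by
            have hR : 0 ≤ N * (B ^ (j + 1) * m j) := by
              have := hm0 j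
              positivity
            exact (mul_le_mul_of_nonneg_left (hM j) (Nat.cast_nonneg _)).trans
              (mul_le_mul_of_nonneg_right h2 hR)
        _ = N * (B ^ (j + 1) * (A ^ (k - j + 1) * (m j * m (k - j)))) := by ring
        _ ≤ N * (B ^ (k + 2) * (A ^ (k + 1) * (A * m k))) := by
            have := hm0 j
            have := hm0 (k - j)
            gcongr
        _ = _ := by ring
  refine (Finset.sum_le_card_nsmul _ _ _ h1).trans ?_
  rw [Finset.card_range, nsmul_eq_mul]
  have h2 : B ^ (k + 2) ≤ (B ^ 2) ^ (k + 1) := by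
    rw [← pow_mul]
    exact pow_le_pow_right₀ hB (by omega)
  have h3 : A ^ (k + 2) ≤ (A ^ 2) ^ (k + 1) := by
    rw [← pow_mul]
    exact pow_le_pow_right₀ hA (by omega)
  have h4 : ((k + 2 : ℕ) : ℝ) ≤ 4 ^ (k + 1) := by
    have := natCast_succ_le_two_pow (k + 1)
    refine this.trans ?_
    rw [show (4 : ℝ) = 2 ^ 2 by norm_num, ← pow_mul]
    exact pow_le_pow_right₀ (by norm_num) (by omega)
  calc ((k + 2 : ℕ) : ℝ) * (N * (B ^ (k + 2) * (A ^ (k + 2) * m k)))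
      ≤ 4 ^ (k + 1) * (N * ((B ^ 2) ^ (k + 1) * ((A ^ 2) ^ (k + 1) * m k))) := by gcongr
    _ = _ := by rw [mul_pow, mul_pow]; ring

end Sequences

/-! ### The kernel (s² - z²)⁻¹ and its derivatives in z -/

section ResolventKernel

/-- The `k`-th derivative in `z` of `(s² - z²)⁻¹`. -/
noncomputable def resKer (k : ℕ) (s : ℝ) (z : ℂ) : ℂ :=
  leibnizSeq (fun i => (i ! : ℂ) * ((s : ℂ) - z)⁻¹ ^ (i + 1))
    (fun i => (-1) ^ i * (i ! : ℂ) * ((s : ℂ) + z)⁻¹ ^ (i + 1)) k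

theorem resKer_zero (s : ℝ) (z : ℂ) : resKer 0 s z = ((s : ℂ) ^ 2 - z ^ 2)⁻¹ := by
  simp only [resKer, leibnizSeq_zero, Nat.factorial_zero, Nat.cast_one, zero_add, pow_one, pow_zero,
    one_mul]
  rw [← mul_inv]
  congr 1
  ring

theorem hasDerivAt_resKer (k : ℕ) (s : ℝ) {z : ℂ} (hz : z.im ≠ 0) :
    HasDerivAt (resKer k s) (resKer (k + 1) s z) z := by
  refine hasDerivAt_leibnizSeq (a := fun i z => (i ! : ℂ) * ((s : ℂ) - z)⁻¹ ^ (i + 1))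
    (b := fun i z => (-1) ^ i * (i ! : ℂ) * ((s : ℂ) + z)⁻¹ ^ (i + 1)) (fun i => ?_) (fun i => ?_) k
  · have h1 : HasDerivAt (fun t : ℂ => (s : ℂ) - t) (-1) z := by
      simpa using (hasDerivAt_id z).const_sub (s : ℂ)
    have h2 := ((h1.inv (ofReal_sub_ne_zero hz s)).pow (i + 1)).const_mul (i ! : ℂ)
    refine h2.congr_deriv ?_
    simp only [Nat.add_sub_cancel, Pi.inv_apply]
    rw [neg_neg, one_div, ← inv_pow, Nat.factorial_succ]
    push_cast
    ring
  · have h1 : HasDerivAt (fun t : ℂ => (s : ℂ) + t) 1 z := by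
      simpa using (hasDerivAt_id z).const_add (s : ℂ)
    have h2 := ((h1.inv (ofReal_add_ne_zero hz s)).pow (i + 1)).const_mul ((-1) ^ i * (i ! : ℂ))
    refine h2.congr_deriv ?_
    simp only [Nat.add_sub_cancel, Pi.inv_apply]
    rw [neg_div, one_div, ← inv_pow, Nat.factorial_succ]
    push_cast
    ring

theorem resKer_eq_sum (k : ℕ) (s : ℝ) (z : ℂ) :
    resKer k s z = (k ! : ℂ) * ∑ i ∈ Finset.range (k + 1),
      (((s : ℂ) - z)⁻¹ ^ (i + 1) * ((-1) ^ (k - i) * ((s : ℂ) + z)⁻¹ ^ (k - i + 1))) := by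
  rw [resKer, leibnizSeq, Finset.mul_sum]
  refine Finset.sum_congr rfl fun i hi => ?_
  have hik : i ≤ k := Nat.lt_succ_iff.mp (Finset.mem_range.mp hi)
  have h : (k.choose i : ℂ) * (i ! : ℂ) * ((k - i)! : ℂ) = (k ! : ℂ) := by
    exact_mod_cast Nat.choose_mul_factorial_mul_factorial hik
  rw [← h]
  ring

/-- Partial fractions, differentiated k times; algebraically it is the factorization of a^(k+1) -
b^(k+1). The second term is the Cauchy kernel at the reflected point -s, which is what the
odd-dimensional argument exploits. -/
theorem two_mul_resKer (k : ℕ) (s : ℝ) {z : ℂ} (hz : z.im ≠ 0) :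
    2 * (s : ℂ) * resKer k s z =
      (k ! : ℂ) * ((s : ℂ) - z)⁻¹ ^ (k + 1) - (k ! : ℂ) * (-(s : ℂ) - z)⁻¹ ^ (k + 1) := by
  set a := ((s : ℂ) - z)⁻¹ with ha
  set b := (-(s : ℂ) - z)⁻¹ with hb
  have hs : ((s : ℂ) + z)⁻¹ = -b := by
    rw [hb, ← inv_neg]
    congr 1
    ring
  have h1 := ofReal_sub_ne_zero hz s
  have h2 : -(s : ℂ) - z ≠ 0 := by
    have := ofReal_sub_ne_zero hz (-s)
    simpa using this
  have hab : a - b = -2 * s * (a * b) := by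
    rw [ha, hb]
    field_simp
    ring
  have hg := geom_sum₂_mul a b (k + 1)
  rw [hab] at hg
  have hsum : resKer k s z = (k ! : ℂ) * (-(a * b) *
      ∑ i ∈ Finset.range (k + 1), a ^ i * b ^ (k + 1 - 1 - i)) := by
    rw [resKer_eq_sum, Finset.mul_sum _ _ (-(a * b))]
    congr 1
    refine Finset.sum_congr rfl fun i _ => ?_
    have h1 : ((-1 : ℂ) ^ (k - i)) * (-1) ^ (k - i) = 1 := by
      rw [← mul_pow]; simp
    rw [hs, Nat.add_sub_cancel, neg_pow b (k - i + 1), pow_succ (-1 : ℂ), ← ha, pow_succ b,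
      pow_succ a]
    linear_combination (-(a ^ i * a * b ^ (k - i) * b)) * h1
  rw [hsum]
  linear_combination (k ! : ℂ) * hg

theorem resKer_neg (k : ℕ) (s : ℝ) (z : ℂ) : resKer k s (-z) = (-1) ^ k * resKer k s z := by
  rw [resKer_eq_sum, resKer_eq_sum, mul_left_comm ((-1) ^ k),
    Finset.mul_sum _ _ ((-1) ^ k)]
  congr 1
  refine (Finset.sum_range_reflect _ _).symm.trans (Finset.sum_congr rfl fun i hi => ?_)
  have hik : i ≤ k := Nat.lt_succ_iff.mp (Finset.mem_range.mp hi)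
  rw [show k + 1 - 1 - i = k - i by omega, show k - (k - i) = i by omega, sub_neg_eq_add,
    ← sub_eq_add_neg]
  have h1 : (-1 : ℂ) ^ k = (-1) ^ (k - i) * (-1) ^ i := by
    rw [← pow_add, Nat.sub_add_cancel hik]
  have h2 : ((-1 : ℂ) ^ (k - i)) * (-1) ^ (k - i) = 1 := by
    rw [← mul_pow]; simp
  rw [h1]
  linear_combination (-(-1) ^ i * ((s : ℂ) - z)⁻¹ ^ (i + 1) * ((s : ℂ) + z)⁻¹ ^ (k - i + 1)) * h2

/-- One factor from each pole is kept apart from `W ^ k`. Their product retains the decay s⁻² needed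
against numerators of degree at most two. -/
theorem norm_resKer_le (k : ℕ) (s : ℝ) (z : ℂ) {W : ℝ} (h1 : ‖((s : ℂ) - z)⁻¹‖ ≤ W)
    (h2 : ‖((s : ℂ) + z)⁻¹‖ ≤ W) :
    ‖resKer k s z‖ ≤ k ! * (k + 1) * W ^ k * (‖((s : ℂ) - z)⁻¹‖ * ‖((s : ℂ) + z)⁻¹‖) := by
  have hW : 0 ≤ W := (norm_nonneg _).trans h1
  rw [resKer_eq_sum, norm_mul, Complex.norm_natCast]
  have h3 : ∀ i ∈ Finset.range (k + 1), ‖((s : ℂ) - z)⁻¹ ^ (i + 1) *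
      ((-1) ^ (k - i) * ((s : ℂ) + z)⁻¹ ^ (k - i + 1))‖ ≤
      W ^ k * (‖((s : ℂ) - z)⁻¹‖ * ‖((s : ℂ) + z)⁻¹‖) := by
    intro i hi
    have hik : i ≤ k := Nat.lt_succ_iff.mp (Finset.mem_range.mp hi)
    rw [norm_mul, norm_mul, norm_pow, norm_pow, norm_pow, norm_neg, norm_one, one_pow, one_mul,
      pow_succ, pow_succ]
    have h4 : ‖((s : ℂ) - z)⁻¹‖ ^ i * ‖((s : ℂ) + z)⁻¹‖ ^ (k - i) ≤ W ^ i * W ^ (k - i) := by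
      gcongr
    rw [← pow_add, Nat.add_sub_cancel' hik] at h4
    calc _ = ‖((s : ℂ) - z)⁻¹‖ ^ i * ‖((s : ℂ) + z)⁻¹‖ ^ (k - i) *
          (‖((s : ℂ) - z)⁻¹‖ * ‖((s : ℂ) + z)⁻¹‖) := by ring
      _ ≤ _ := by gcongr
  have h5 := (norm_sum_le _ _).trans (Finset.sum_le_card_nsmul _ _ _ h3)
  rw [Finset.card_range, nsmul_eq_mul] at h5
  calc _ ≤ (k ! : ℝ) * (((k + 1 : ℕ) : ℝ) * (W ^ k * (‖((s : ℂ) - z)⁻¹‖ * ‖((s : ℂ) + z)⁻¹‖))) := by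
        gcongr
    _ = _ := by push_cast; ring

end ResolventKernel

end FreeResolvent

namespace FreeResolvent

/-! ### Pointwise bounds for the kernel -/

section KernelBounds

theorem abs_sub_re_le_norm (s : ℝ) (z : ℂ) : |s - z.re| ≤ ‖(s : ℂ) - z‖ := by
  simpa using Complex.abs_re_le_norm ((s : ℂ) - z)

theorem abs_add_re_le_norm (s : ℝ) (z : ℂ) : |s + z.re| ≤ ‖(s : ℂ) + z‖ := by
  simpa using Complex.abs_re_le_norm ((s : ℂ) + z)

theorem norm_inv_ofReal_sub_le {s w : ℝ} {z : ℂ} (hw : 0 < w) (h : w ≤ |s - z.re|) :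
    ‖((s : ℂ) - z)⁻¹‖ ≤ w⁻¹ := by
  rw [norm_inv]
  exact inv_anti₀ hw (h.trans (abs_sub_re_le_norm s z))

theorem norm_inv_ofReal_add_le {s w : ℝ} {z : ℂ} (hw : 0 < w) (h : w ≤ |s + z.re|) :
    ‖((s : ℂ) + z)⁻¹‖ ≤ w⁻¹ := by
  rw [norm_inv]
  exact inv_anti₀ hw (h.trans (abs_add_re_le_norm s z))

theorem abs_im_le_norm_sub (s : ℝ) (z : ℂ) : |z.im| ≤ ‖(s : ℂ) - z‖ := by
  simpa using Complex.abs_im_le_norm ((s : ℂ) - z)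

theorem abs_im_le_norm_add (s : ℝ) (z : ℂ) : |z.im| ≤ ‖(s : ℂ) + z‖ := by
  simpa using Complex.abs_im_le_norm ((s : ℂ) + z)

/-- Bound for the resolvent kernel away from the real axis. -/
theorem pow_mul_norm_resKer_le {n : ℕ} (hn : n ≤ 2) (k : ℕ) {s : ℝ} (hs : 0 ≤ s) {z : ℂ} {η R : ℝ}
    (hη : 0 < η) (hz : η ≤ |z.im|) (hR : ‖z‖ ≤ R) :
    s ^ n * ‖resKer k s z‖ ≤ k ! * (k + 1) * η⁻¹ ^ k * (1 + (1 + R) * η⁻¹) ^ 2 := by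
  have h1 : ‖((s : ℂ) - z)⁻¹‖ ≤ η⁻¹ := by
    rw [norm_inv]
    exact inv_anti₀ hη (hz.trans (abs_im_le_norm_sub s z))
  have h2 : ‖((s : ℂ) + z)⁻¹‖ ≤ η⁻¹ := by
    rw [norm_inv]
    exact inv_anti₀ hη (hz.trans (abs_im_le_norm_add s z))
  have key : ∀ u : ℂ, ‖u⁻¹‖ ≤ η⁻¹ → u ≠ 0 → s ≤ ‖u‖ + ‖z‖ →
      (1 + s) * ‖u⁻¹‖ ≤ 1 + (1 + R) * η⁻¹ := by
    intro u hu hu0 hsu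
    have h3 : ‖u‖ * ‖u⁻¹‖ = 1 := by rw [← norm_mul, mul_inv_cancel₀ hu0, norm_one]
    calc (1 + s) * ‖u⁻¹‖ ≤ (‖u‖ + (1 + R)) * ‖u⁻¹‖ :=
          mul_le_mul_of_nonneg_right (by linarith) (norm_nonneg _)
      _ = 1 + (1 + R) * ‖u⁻¹‖ := by rw [add_mul, h3]
      _ ≤ _ := by
        have : 0 ≤ 1 + R := by linarith [norm_nonneg z]
        gcongr
  have hz0 : z.im ≠ 0 := abs_pos.mp (hη.trans_le hz)
  have hsn : ‖(s : ℂ)‖ = s := by rw [Complex.norm_real, Real.norm_of_nonneg hs]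
  have k1 := key _ h1 (ofReal_sub_ne_zero hz0 s) (by
    have := norm_add_le ((s : ℂ) - z) z
    rwa [sub_add_cancel, hsn] at this)
  have k2 := key _ h2 (ofReal_add_ne_zero hz0 s) (by
    have := norm_sub_le ((s : ℂ) + z) z
    rwa [add_sub_cancel_right, hsn] at this)
  have hsn : s ^ n ≤ (1 + s) * (1 + s) := by
    have : s ^ n ≤ (1 + s) ^ n := pow_le_pow_left₀ hs (by linarith) n
    have h' : (1 + s) ^ n ≤ (1 + s) ^ 2 := pow_le_pow_right₀ (by linarith) hn
    linarith [sq (1 + s)]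
  have hR0 : 0 ≤ 1 + (1 + R) * η⁻¹ := le_trans (by positivity) k1
  calc s ^ n * ‖resKer k s z‖ ≤ ((1 + s) * (1 + s)) *
        (k ! * (k + 1) * η⁻¹ ^ k * (‖((s : ℂ) - z)⁻¹‖ * ‖((s : ℂ) + z)⁻¹‖)) :=
        mul_le_mul hsn (norm_resKer_le k s z h1 h2) (norm_nonneg _) (by positivity)
    _ = k ! * (k + 1) * η⁻¹ ^ k *
        (((1 + s) * ‖((s : ℂ) - z)⁻¹‖) * ((1 + s) * ‖((s : ℂ) + z)⁻¹‖)) := by ring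
    _ ≤ k ! * (k + 1) * η⁻¹ ^ k * ((1 + (1 + R) * η⁻¹) * (1 + (1 + R) * η⁻¹)) := by
        gcongr
    _ = _ := by ring

theorem factorial_mul_le {k : ℕ} {W E : ℝ} (hW : 1 ≤ W) (hE : 1 ≤ E) :
    (k ! : ℝ) * (k + 1) * W ^ k * E ≤ (2 * W * E) ^ (k + 1) * k ! := by
  have h1 := natCast_succ_le_two_pow k
  push_cast at h1
  have h2 : W ^ k ≤ W ^ (k + 1) := pow_le_pow_right₀ hW (by omega)
  have h3 : E ≤ E ^ (k + 1) := le_self_pow₀ hE (by omega)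
  calc (k ! : ℝ) * (k + 1) * W ^ k * E ≤ k ! * 2 ^ (k + 1) * W ^ (k + 1) * E ^ (k + 1) := by gcongr
    _ = _ := by rw [mul_pow, mul_pow]; ring

/-- Bound for the resolvent kernel near zero energy, outside the unit ball of frequencies. -/
theorem pow_mul_norm_resKer_le_of_one_lt {n : ℕ} (hn : n ≤ 2) (k : ℕ) {s : ℝ} (hs : 1 < s) {z : ℂ}
    (hx : |z.re| ≤ 1 / 2) : s ^ n * ‖resKer k s z‖ ≤ 16 ^ (k + 1) * k ! := by
  obtain ⟨hx1, hx2⟩ := abs_le.mp hx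
  have hs2 : 0 < s / 2 := by linarith
  have h1 : ‖((s : ℂ) - z)⁻¹‖ ≤ (s / 2)⁻¹ :=
    norm_inv_ofReal_sub_le hs2 (by rw [abs_of_nonneg] <;> linarith)
  have h2 : ‖((s : ℂ) + z)⁻¹‖ ≤ (s / 2)⁻¹ :=
    norm_inv_ofReal_add_le hs2 (by rw [abs_of_nonneg] <;> linarith)
  have h3 : (s / 2)⁻¹ ≤ 2 := by
    rw [inv_le_comm₀ hs2 (by norm_num)]
    linarith
  have hsn : s ^ n ≤ s ^ 2 := pow_le_pow_right₀ hs.le hn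
  calc s ^ n * ‖resKer k s z‖ ≤ s ^ 2 *
        (k ! * (k + 1) * 2 ^ k * (‖((s : ℂ) - z)⁻¹‖ * ‖((s : ℂ) + z)⁻¹‖)) :=
        mul_le_mul hsn (norm_resKer_le k s z (h1.trans h3) (h2.trans h3)) (norm_nonneg _)
          (by positivity)
    _ ≤ s ^ 2 * (k ! * (k + 1) * 2 ^ k * ((s / 2)⁻¹ * (s / 2)⁻¹)) := by gcongr
    _ = k ! * (k + 1) * 2 ^ k * 4 := by field_simp; ring
    _ ≤ (2 * 2 * 4) ^ (k + 1) * k ! := factorial_mul_le (by norm_num) (by norm_num)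
    _ = _ := by norm_num

/-- Bound for the resolvent kernel at positive energy, away from the energy shell. -/
theorem exists_pow_mul_norm_resKer_le_far {δ : ℝ} (hδ : 0 < δ) :
    ∃ C, 1 ≤ C ∧ ∀ (n : ℕ) (_ : n ≤ 2) (k : ℕ) (s : ℝ) (z : ℂ), 0 ≤ s → δ ≤ z.re → |z.im| ≤ 1 →
      z.im ≠ 0 → δ / 2 ≤ |s - z.re| →
      s ^ n * ‖resKer k s z‖ ≤ C ^ (k + 1) * k ! * (z.re + 1) ^ ((n : ℤ) - 1) := by
  set W := 1 + (δ / 2)⁻¹ with hWdef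
  have hW0 : 0 < (δ / 2)⁻¹ := by positivity
  have hW : 1 ≤ W := by linarith
  set E := (2 + 2 * W) * (1 + (1 + δ) / δ) with hE
  have hE1 : 1 ≤ E := by
    have : 0 < (1 + δ) / δ := by positivity
    nlinarith
  refine ⟨2 * W * E, by nlinarith, fun n hn k s z hs hx hy hy0 hsx => ?_⟩
  have hδ2 : 0 < δ / 2 := by linarith
  have h1 : ‖((s : ℂ) - z)⁻¹‖ ≤ W := (norm_inv_ofReal_sub_le hδ2 hsx).trans (by linarith)
  have h2 : ‖((s : ℂ) + z)⁻¹‖ ≤ W := (norm_inv_ofReal_add_le hδ2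
    (by rw [abs_of_nonneg] <;> linarith)).trans (by linarith)
  have hx1 : 0 < z.re + 1 := by linarith
  have h3 : ‖((s : ℂ) + z)⁻¹‖ ≤ (1 + δ) / δ * (z.re + 1)⁻¹ := by
    refine (norm_inv_ofReal_add_le (w := z.re) (by linarith)
      (by rw [abs_of_nonneg] <;> linarith)).trans ?_
    rw [← div_eq_mul_inv, div_div, inv_eq_one_div, div_le_div_iff₀ (by linarith) (by positivity)]
    nlinarith
  have h4 : s * ‖((s : ℂ) + z)⁻¹‖ ≤ 1 := by
    rw [norm_inv, ← div_eq_mul_inv]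
    refine div_le_one_of_le₀ ?_ (norm_nonneg _)
    refine le_trans ?_ (abs_add_re_le_norm s z)
    rw [abs_of_nonneg] <;> linarith
  have h5 : s * ‖((s : ℂ) - z)⁻¹‖ ≤ (2 + 2 * W) * (z.re + 1) := by
    have h0 := ofReal_sub_ne_zero hy0 s
    have h6 : ‖(s : ℂ) - z‖ * ‖((s : ℂ) - z)⁻¹‖ = 1 := by
      rw [← norm_mul, mul_inv_cancel₀ h0, norm_one]
    have h7 : s ≤ ‖(s : ℂ) - z‖ + (z.re + 1) := by
      have a1 := norm_add_le ((s : ℂ) - z) z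
      rw [sub_add_cancel, Complex.norm_real, Real.norm_of_nonneg hs] at a1
      have a2 := Complex.norm_le_abs_re_add_abs_im z
      rw [abs_of_nonneg (by linarith : 0 ≤ z.re)] at a2
      linarith
    calc s * ‖((s : ℂ) - z)⁻¹‖ ≤ (‖(s : ℂ) - z‖ + (z.re + 1)) * ‖((s : ℂ) - z)⁻¹‖ := by gcongr
      _ = 1 + (z.re + 1) * ‖((s : ℂ) - z)⁻¹‖ := by rw [add_mul, h6]
      _ ≤ 1 + (z.re + 1) * W := by gcongr
      _ ≤ _ := by nlinarith
  have key : s ^ n * (‖((s : ℂ) - z)⁻¹‖ * ‖((s : ℂ) + z)⁻¹‖) ≤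
      E * (z.re + 1) ^ ((n : ℤ) - 1) := by
    have p1 : 0 < (1 + δ) / δ := by positivity
    have p2 := norm_nonneg ((s : ℂ) - z)⁻¹
    have p3 := norm_nonneg ((s : ℂ) + z)⁻¹
    interval_cases n
    · have : ((z.re + 1) ^ (((0 : ℕ) : ℤ) - 1)) = (z.re + 1)⁻¹ := by simp
      rw [this, pow_zero, one_mul]
      calc _ ≤ W * ((1 + δ) / δ * (z.re + 1)⁻¹) := by gcongr
        _ = (W * ((1 + δ) / δ)) * (z.re + 1)⁻¹ := by ring
        _ ≤ E * (z.re + 1)⁻¹ := by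
          gcongr
          rw [hE]
          nlinarith
    · have : ((z.re + 1) ^ (((1 : ℕ) : ℤ) - 1)) = 1 := by simp
      rw [this, pow_one, mul_one]
      calc _ = ‖((s : ℂ) - z)⁻¹‖ * (s * ‖((s : ℂ) + z)⁻¹‖) := by ring
        _ ≤ W * 1 := by gcongr
        _ ≤ E := by
          rw [hE]
          nlinarith
    · have : ((z.re + 1) ^ (((2 : ℕ) : ℤ) - 1)) = z.re + 1 := by
        rw [show (((2 : ℕ) : ℤ) - 1) = 1 by norm_num, zpow_one]
      rw [this]
      calc _ = (s * ‖((s : ℂ) - z)⁻¹‖) * (s * ‖((s : ℂ) + z)⁻¹‖) := by ring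
        _ ≤ ((2 + 2 * W) * (z.re + 1)) * 1 := by gcongr
        _ ≤ _ := by
          rw [hE, mul_one]
          gcongr
          nlinarith
  have hzp : 0 ≤ (z.re + 1) ^ ((n : ℤ) - 1) := zpow_nonneg hx1.le _
  calc s ^ n * ‖resKer k s z‖ ≤ s ^ n *
        (k ! * (k + 1) * W ^ k * (‖((s : ℂ) - z)⁻¹‖ * ‖((s : ℂ) + z)⁻¹‖)) := by
        gcongr
        exact norm_resKer_le k s z h1 h2
    _ = k ! * (k + 1) * W ^ k * (s ^ n * (‖((s : ℂ) - z)⁻¹‖ * ‖((s : ℂ) + z)⁻¹‖)) := by ring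
    _ ≤ k ! * (k + 1) * W ^ k * (E * (z.re + 1) ^ ((n : ℤ) - 1)) := by gcongr
    _ = (k ! * (k + 1) * W ^ k * E) * (z.re + 1) ^ ((n : ℤ) - 1) := by ring
    _ ≤ _ := mul_le_mul_of_nonneg_right (factorial_mul_le hW hE1) hzp

/-- Near the energy shell, the resolvent kernel is a Cauchy kernel up to a bounded remainder. -/
theorem exists_pow_mul_norm_resKer_sub_le_near {δ : ℝ} (hδ : 0 < δ) :
    ∃ C, 1 ≤ C ∧ ∀ (n : ℕ) (_ : n ≤ 2) (k : ℕ) (s : ℝ) (z : ℂ), δ ≤ z.re →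
      z.im ≠ 0 → |s - z.re| ≤ δ / 2 →
      s ^ n * ‖resKer k s z - (2 * (s : ℂ))⁻¹ * ((k ! : ℂ) * ((s : ℂ) - z)⁻¹ ^ (k + 1))‖ ≤
        C ^ (k + 1) * k ! * (z.re + 1) ^ ((n : ℤ) - 1) := by
  set W := 1 + δ⁻¹ with hWdef
  have hW0 : 0 < δ⁻¹ := by positivity
  have hW : 1 ≤ W := by linarith
  set E := 1 + (1 + δ) / δ with hE
  have hE0 : 0 < (1 + δ) / δ := by positivity
  have hE1 : 1 ≤ E := by linarith
  refine ⟨2 * W * E, by nlinarith, fun n hn k s z hx hy0 hsx => ?_⟩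
  obtain ⟨hs1, hs2⟩ := abs_le.mp hsx
  have hs : 0 < s := by linarith
  have hsc : (s : ℂ) ≠ 0 := by exact_mod_cast hs.ne'
  have hx1 : 0 < z.re + 1 := by linarith
  -- What remains is the partial fraction with pole at -z, far from s > 0 because Re z ≥ δ.
  have e : resKer k s z - (2 * (s : ℂ))⁻¹ * ((k ! : ℂ) * ((s : ℂ) - z)⁻¹ ^ (k + 1)) =
      -((2 * (s : ℂ))⁻¹ * ((k ! : ℂ) * (-(s : ℂ) - z)⁻¹ ^ (k + 1))) := by
    have h := two_mul_resKer k s hy0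
    field_simp at h ⊢
    linear_combination h
  have hab : ‖(-(s : ℂ) - z)⁻¹‖ = ‖((s : ℂ) + z)⁻¹‖ := by
    rw [norm_inv, norm_inv, ← norm_neg]
    congr 2
    ring
  have h2 : ‖((s : ℂ) + z)⁻¹‖ ≤ W := (norm_inv_ofReal_add_le hδ
    (by rw [abs_of_nonneg] <;> linarith)).trans (by linarith)
  have h4 : s * ‖((s : ℂ) + z)⁻¹‖ ≤ 1 := by
    rw [norm_inv, ← div_eq_mul_inv]
    refine div_le_one_of_le₀ ?_ (norm_nonneg _)
    refine le_trans ?_ (abs_add_re_le_norm s z)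
    rw [abs_of_nonneg] <;> linarith
  rw [e, norm_neg, norm_mul, norm_mul, norm_pow, hab, Complex.norm_natCast, norm_inv, norm_mul,
    Complex.norm_real, Real.norm_of_nonneg hs.le, Complex.norm_two]
  have p3 := norm_nonneg ((s : ℂ) + z)⁻¹
  have h6 : ‖((s : ℂ) + z)⁻¹‖ ^ k ≤ W ^ k := by gcongr
  have key : s ^ n * ((2 * s)⁻¹ * ‖((s : ℂ) + z)⁻¹‖) ≤ W * E * (z.re + 1) ^ ((n : ℤ) - 1) := by
    interval_cases n
    · have : ((z.re + 1) ^ (((0 : ℕ) : ℤ) - 1)) = (z.re + 1)⁻¹ := by simp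
      rw [this, pow_zero, one_mul]
      have h7 : (2 * s)⁻¹ ≤ E * (z.re + 1)⁻¹ := by
        have h8 : (2 * s)⁻¹ ≤ (z.re)⁻¹ := inv_anti₀ (by linarith) (by linarith)
        refine h8.trans ?_
        have h9 : (z.re)⁻¹ ≤ (1 + δ) / δ * (z.re + 1)⁻¹ := by
          rw [← div_eq_mul_inv, div_div, inv_eq_one_div,
            div_le_div_iff₀ (by linarith) (by positivity)]
          nlinarith
        refine h9.trans ?_
        gcongr
        linarith
      calc _ ≤ (E * (z.re + 1)⁻¹) * W := by gcongr
        _ = _ := by ring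
    · have : ((z.re + 1) ^ (((1 : ℕ) : ℤ) - 1)) = 1 := by simp
      rw [this, pow_one, mul_one]
      have : s * ((2 * s)⁻¹ * ‖((s : ℂ) + z)⁻¹‖) = ‖((s : ℂ) + z)⁻¹‖ / 2 := by
        field_simp
      rw [this]
      nlinarith
    · have : ((z.re + 1) ^ (((2 : ℕ) : ℤ) - 1)) = z.re + 1 := by
        rw [show (((2 : ℕ) : ℤ) - 1) = 1 by norm_num, zpow_one]
      rw [this]
      have : s ^ 2 * ((2 * s)⁻¹ * ‖((s : ℂ) + z)⁻¹‖) = s * ‖((s : ℂ) + z)⁻¹‖ / 2 := by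
        field_simp
      rw [this]
      have h1 : 1 ≤ W * E := by nlinarith
      nlinarith
  have hzp : 0 ≤ (z.re + 1) ^ ((n : ℤ) - 1) := zpow_nonneg hx1.le _
  have h2k : (1 : ℝ) ≤ 2 ^ (k + 1) := one_le_pow₀ (by norm_num)
  have h3 : E ≤ E ^ (k + 1) := le_self_pow₀ hE1 (by omega)
  calc s ^ n * ((2 * s)⁻¹ * (k ! * ‖((s : ℂ) + z)⁻¹‖ ^ (k + 1)))
      = k ! * ‖((s : ℂ) + z)⁻¹‖ ^ k * (s ^ n * ((2 * s)⁻¹ * ‖((s : ℂ) + z)⁻¹‖)) := by ring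
    _ ≤ k ! * W ^ k * (W * E * (z.re + 1) ^ ((n : ℤ) - 1)) := by gcongr
    _ = 1 * (k ! * W ^ (k + 1) * E) * (z.re + 1) ^ ((n : ℤ) - 1) := by ring
    _ ≤ 2 ^ (k + 1) * (k ! * W ^ (k + 1) * E ^ (k + 1)) * (z.re + 1) ^ ((n : ℤ) - 1) := by
        gcongr
    _ = _ := by rw [mul_pow, mul_pow]; ring

end KernelBounds

end FreeResolvent

namespace FreeResolvent

open scoped FourierTransform ContDiff RealInnerProductSpace

/-- Euclidean space. -/
abbrev Space (d : ℕ) : Type := EuclideanSpace ℝ (Fin d)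

/-! ### The Fourier integral and the Fourier transform on L² -/

section FourierL2

variable {d : ℕ}

theorem continuous_fourier {g : Space d → ℂ} (h : Integrable g) : Continuous (𝓕 g) :=
  VectorFourier.fourierIntegral_continuous Real.continuous_fourierChar
    (innerSL ℝ).continuous₂ h

theorem norm_fourier_le (g : Space d → ℂ) (ξ : Space d) : ‖𝓕 g ξ‖ ≤ ∫ y, ‖g y‖ := by
  rw [Real.fourier_eq]
  refine (norm_integral_le_integral_norm _).trans (le_of_eq ?_)
  simp_rw [Circle.norm_smul]

/-- The `L²` Fourier transform of an integrable function is given by the Fourier integral. -/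
theorem fourier_toLp_ae_eq {g : Space d → ℂ} (h1 : Integrable g) (h2 : MemLp g 2) :
    (𝓕 (h2.toLp g) : L2 d) =ᵐ[volume] 𝓕 g := by
  refine ae_eq_of_integral_contDiff_smul_eq ((Lp.memLp _).locallyIntegrable one_le_two)
    (continuous_fourier h1).locallyIntegrable fun v hv hc => ?_
  have hg₁ : HasCompactSupport (Complex.ofRealCLM ∘ v) := hc.comp_left rfl
  have hg₂ : ContDiff ℝ ∞ (Complex.ofRealCLM ∘ v) := by fun_prop
  set ψ : 𝓢(Space d, ℂ) := hg₁.toSchwartzMap hg₂ with hψ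
  have hψv : ∀ x, ψ x = (v x : ℂ) := fun x => rfl
  -- Both transforms are symmetric for the bilinear pairing, one by definition on tempered
  -- distributions, the other by Fubini. They therefore agree against test functions.
  calc ∫ x, v x • (𝓕 (h2.toLp g) : L2 d) x
      = Lp.toTemperedDistribution (𝓕 (h2.toLp g) : L2 d) ψ := by
        rw [Lp.toTemperedDistribution_apply]
        refine integral_congr_ae (Filter.Eventually.of_forall fun x => ?_)
        simp [hψv]
    _ = Lp.toTemperedDistribution (h2.toLp g) (𝓕 ψ) := by
        rw [← Lp.fourier_toTemperedDistribution_eq, TemperedDistribution.fourier_apply]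
    _ = ∫ x, (𝓕 (ψ : Space d → ℂ)) x • g x := by
        rw [Lp.toTemperedDistribution_apply]
        refine integral_congr_ae ?_
        filter_upwards [h2.coeFn_toLp] with x hx
        rw [hx, SchwartzMap.fourier_coe]
    _ = ∫ x, ψ x • 𝓕 g x := by
        have h := VectorFourier.integral_fourierIntegral_smul_eq_flip (μ := volume) (ν := volume)
          (L := innerₗ (Space d)) Real.continuous_fourierChar (innerSL ℝ).continuous₂
          ψ.integrable h1
        rw [flip_innerₗ] at h
        exact h
    _ = _ := by
        refine integral_congr_ae (Filter.Eventually.of_forall fun x => ?_)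
        simp [hψv]

theorem memLp_fourier {g : Space d → ℂ} (h1 : Integrable g) (h2 : MemLp g 2) :
    MemLp (𝓕 g) 2 :=
  (memLp_congr_ae (fourier_toLp_ae_eq h1 h2)).mp (Lp.memLp _)

theorem lpNorm_coe_L2 (f : L2 d) : lpNorm (f : Space d → ℂ) 2 volume = ‖f‖ := by
  rw [Lp.norm_def, toReal_eLpNorm (Lp.aestronglyMeasurable f)]

theorem lpNorm_congr_ae {E : Type*} [NormedAddCommGroup E] {f g : Space d → E}
    (hf : AEStronglyMeasurable f) (h : f =ᵐ[volume] g) :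
    lpNorm f 2 volume = lpNorm g 2 volume := by
  rw [← toReal_eLpNorm hf, ← toReal_eLpNorm (hf.congr h), eLpNorm_congr_ae h]

theorem lpNorm_fourier {g : Space d → ℂ} (h1 : Integrable g) (h2 : MemLp g 2) :
    lpNorm (𝓕 g) 2 volume = lpNorm g 2 volume := by
  rw [← lpNorm_congr_ae (Lp.aestronglyMeasurable _) (fourier_toLp_ae_eq h1 h2), lpNorm_coe_L2,
    Lp.norm_fourier_eq, ← lpNorm_coe_L2, lpNorm_congr_ae (Lp.aestronglyMeasurable _) h2.coeFn_toLp]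

theorem integrable_norm_mul_norm {E F : Type*} [NormedAddCommGroup E] [NormedAddCommGroup F]
    {f : Space d → E} {g : Space d → F} (hf : MemLp f 2) (hg : MemLp g 2) :
    Integrable fun x => ‖f x‖ * ‖g x‖ :=
  hf.norm.integrable_mul hg.norm

theorem integral_norm_mul_norm_le {E F : Type*} [NormedAddCommGroup E] [NormedAddCommGroup F]
    {f : Space d → E} {g : Space d → F} (hf : MemLp f 2) (hg : MemLp g 2) :
    ∫ x, ‖f x‖ * ‖g x‖ ≤ lpNorm f 2 volume * lpNorm g 2 volume := by
  have h2 : (ENNReal.ofReal 2) = 2 := by norm_num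
  have h := integral_mul_le_Lp_mul_Lq_of_nonneg (μ := (volume : Measure (Space d)))
    (f := fun x => ‖f x‖) (g := fun x => ‖g x‖) Real.HolderConjugate.two_two
    (Filter.Eventually.of_forall fun x => norm_nonneg _)
    (Filter.Eventually.of_forall fun x => norm_nonneg _)
    (by rw [h2]; exact hf.norm) (by rw [h2]; exact hg.norm)
  refine h.trans (le_of_eq ?_)
  rw [lpNorm_eq_integral_norm_rpow_toReal (by norm_num) (by norm_num) hf.1,
    lpNorm_eq_integral_norm_rpow_toReal (by norm_num) (by norm_num) hg.1]
  simp

end FourierL2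

/-! ### Moments of the weight -/

section RapidWeight

variable {d : ℕ} {w : Space d → ℝ} {m : ℕ → ℝ} {B : ℝ}

/-- A continuous weight all of whose moments are controlled by the sequence `m`. -/
structure IsRapid (w : Space d → ℝ) (m : ℕ → ℝ) (B : ℝ) : Prop where
  continuous : Continuous w
  nonneg : ∀ y, 0 ≤ w y
  one_le_const : 1 ≤ B
  bound : ∀ j y, (1 + ‖y‖) ^ (d + 1) * (‖y‖ ^ j * w y) ≤ B ^ (j + 1) * m j

/-- The exponent d + 1 reserved in `IsRapid` is chosen so that 2(d + 1) > d. The reserve turns L²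
functions into L¹ functions by Cauchy–Schwarz. -/
theorem memLp_inv_one_add_norm_pow (d : ℕ) :
    MemLp (fun y : Space d => ((1 + ‖y‖) ^ (d + 1))⁻¹) 2 := by
  have hc : Continuous fun y : Space d => ((1 + ‖y‖) ^ (d + 1))⁻¹ :=
    Continuous.inv₀ (by fun_prop) fun y => by positivity
  rw [memLp_two_iff_integrable_sq hc.aestronglyMeasurable]
  have hr : (Module.finrank ℝ (Space d) : ℝ) < ((2 * (d + 1) : ℕ) : ℝ) := by
    rw [finrank_euclideanSpace_fin]
    exact_mod_cast (by omega : d < 2 * (d + 1))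
  refine (integrable_one_add_norm (μ := volume) hr).congr
    (Filter.Eventually.of_forall fun y => ?_)
  simp only
  rw [Real.rpow_neg (by positivity), Real.rpow_natCast, inv_pow, ← pow_mul, mul_comm]

theorem IsRapid.le (hw : IsRapid w m B) (j : ℕ) (y : Space d) :
    ‖y‖ ^ j * w y ≤ B ^ (j + 1) * m j := by
  refine le_trans (le_mul_of_one_le_left ?_ ?_) (hw.bound j y)
  · exact mul_nonneg (by positivity) (hw.nonneg y)
  · exact one_le_pow₀ (by linarith [norm_nonneg y])

theorem IsRapid.coeff_nonneg (hw : IsRapid w m B) (j : ℕ) : 0 ≤ B ^ (j + 1) * m j :=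
  (mul_nonneg (by positivity) (hw.nonneg 0)).trans (hw.le j 0)

/-- The product of a weight with an `L²` function. -/
noncomputable def weighted (w : Space d → ℝ) (v : L2 d) (y : Space d) : ℂ := (w y : ℂ) * v y

theorem IsRapid.aestronglyMeasurable_weighted (hw : IsRapid w m B) (v : L2 d) :
    AEStronglyMeasurable (weighted w v) :=
  (Complex.continuous_ofReal.comp hw.continuous).aestronglyMeasurable.mul
    (Lp.aestronglyMeasurable v)

theorem IsRapid.norm_weighted (hw : IsRapid w m B) (v : L2 d) (y : Space d) :
    ‖weighted w v y‖ = w y * ‖v y‖ := by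
  rw [weighted, norm_mul, Complex.norm_real, Real.norm_of_nonneg (hw.nonneg y)]

variable {h : Space d → ℂ} {v : L2 d} {j : ℕ}

theorem IsRapid.memLp (hw : IsRapid w m B) (hm : AEStronglyMeasurable h)
    (hh : ∀ y, ‖h y‖ ≤ ‖y‖ ^ j * ‖weighted w v y‖) : MemLp h 2 := by
  refine MemLp.of_le_mul (c := B ^ (j + 1) * m j) (Lp.memLp v) hm
    (Filter.Eventually.of_forall fun y => (hh y).trans ?_)
  rw [hw.norm_weighted, ← mul_assoc]
  exact mul_le_mul_of_nonneg_right (hw.le j y) (norm_nonneg _)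

theorem IsRapid.lpNorm_le (hw : IsRapid w m B)
    (hh : ∀ y, ‖h y‖ ≤ ‖y‖ ^ j * ‖weighted w v y‖) :
    lpNorm h 2 volume ≤ B ^ (j + 1) * m j * ‖v‖ := by
  have hc := hw.coeff_nonneg j
  refine (lpNorm_mono_real (g := (B ^ (j + 1) * m j) • fun y => ‖v y‖)
    ((Lp.memLp v).norm.const_smul _) fun y => (hh y).trans ?_).trans (le_of_eq ?_)
  · rw [hw.norm_weighted, ← mul_assoc, Pi.smul_apply, smul_eq_mul]
    exact mul_le_mul_of_nonneg_right (hw.le j y) (norm_nonneg _)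
  · rw [lpNorm_const_smul, lpNorm_norm (Lp.aestronglyMeasurable v), lpNorm_coe_L2]
    rw [coe_nnnorm, Real.norm_of_nonneg hc]

theorem IsRapid.norm_le_mul (hw : IsRapid w m B)
    (hh : ∀ y, ‖h y‖ ≤ ‖y‖ ^ j * ‖weighted w v y‖) (y : Space d) :
    ‖h y‖ ≤ (B ^ (j + 1) * m j) * (‖((1 + ‖y‖) ^ (d + 1))⁻¹‖ * ‖v y‖) := by
  have h0 : 0 < (1 + ‖y‖) ^ (d + 1) := by positivity
  refine (hh y).trans ?_
  rw [hw.norm_weighted, Real.norm_of_nonneg (by positivity), ← mul_assoc, ← mul_assoc]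
  refine mul_le_mul_of_nonneg_right ?_ (norm_nonneg _)
  rw [← div_eq_mul_inv, le_div_iff₀ h0]
  linarith [hw.bound j y]

theorem IsRapid.integrable (hw : IsRapid w m B) (hm : AEStronglyMeasurable h)
    (hh : ∀ y, ‖h y‖ ≤ ‖y‖ ^ j * ‖weighted w v y‖) : Integrable h :=
  Integrable.mono' ((integrable_norm_mul_norm (memLp_inv_one_add_norm_pow d)
    (Lp.memLp v)).const_mul _) hm (Filter.Eventually.of_forall (hw.norm_le_mul hh))

/-- The norm in `L²` of the auxiliary weight `(1 + |y|)^(-(d + 1))`. -/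
noncomputable def momentConst (d : ℕ) : ℝ :=
  lpNorm (fun y : Space d => ((1 + ‖y‖) ^ (d + 1))⁻¹) 2 volume

theorem momentConst_nonneg (d : ℕ) : 0 ≤ momentConst d := lpNorm_nonneg

theorem IsRapid.integral_norm_le (hw : IsRapid w m B)
    (hh : ∀ y, ‖h y‖ ≤ ‖y‖ ^ j * ‖weighted w v y‖) :
    ∫ y, ‖h y‖ ≤ momentConst d * (B ^ (j + 1) * m j) * ‖v‖ := by
  have h1 := integral_norm_mul_norm_le (memLp_inv_one_add_norm_pow d) (Lp.memLp v)
  rw [lpNorm_coe_L2] at h1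
  calc ∫ y, ‖h y‖ ≤ ∫ y, (B ^ (j + 1) * m j) * (‖((1 + ‖y‖) ^ (d + 1))⁻¹‖ * ‖v y‖) :=
        integral_mono_of_nonneg (Filter.Eventually.of_forall fun y => norm_nonneg _)
          ((integrable_norm_mul_norm (memLp_inv_one_add_norm_pow d) (Lp.memLp v)).const_mul _)
          (Filter.Eventually.of_forall (hw.norm_le_mul hh))
    _ = (B ^ (j + 1) * m j) * ∫ y, ‖((1 + ‖y‖) ^ (d + 1))⁻¹‖ * ‖v y‖ := integral_const_mul _ _
    _ ≤ (B ^ (j + 1) * m j) * (momentConst d * ‖v‖) :=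
        mul_le_mul_of_nonneg_left h1 (hw.coeff_nonneg j)
    _ = _ := by ring

end RapidWeight

/-! ### Fourier transforms along rays -/

section RayTransform

variable {d : ℕ} {w : Space d → ℝ} {m : ℕ → ℝ} {B : ℝ}

/-- The `j`-th derivative at `s` of the Fourier transform of `f` along the ray spanned by `θ`. -/
noncomputable def rayFourier (f : Space d → ℂ) (θ : Space d) (j : ℕ) (s : ℝ) : ℂ :=
  𝓕 (fun y => (-(2 * Real.pi * Complex.I) * (⟪y, θ⟫ : ℝ)) ^ j * f y) (s • θ)

theorem rayFourier_zero (f : Space d → ℂ) (θ : Space d) (s : ℝ) :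
    rayFourier f θ 0 s = 𝓕 f (s • θ) := by
  simp [rayFourier]

theorem norm_two_pi_I : ‖-(2 * (Real.pi : ℂ) * Complex.I)‖ = 2 * Real.pi := by
  rw [norm_neg, norm_mul, norm_mul, Complex.norm_I, Complex.norm_real,
    Real.norm_of_nonneg Real.pi_pos.le, Complex.norm_two, mul_one]

theorem norm_inner_pow_mul_le (f : Space d → ℂ) {θ : Space d} (hθ : ‖θ‖ ≤ 1) (j : ℕ)
    (y : Space d) :
    ‖(((⟪y, θ⟫ : ℝ) : ℂ)) ^ j * f y‖ ≤ ‖y‖ ^ j * ‖f y‖ := by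
  rw [norm_mul, norm_pow, Complex.norm_real]
  have h1 : ‖(⟪y, θ⟫ : ℝ)‖ ≤ ‖y‖ :=
    (norm_inner_le_norm y θ).trans (mul_le_of_le_one_right (norm_nonneg _) hθ)
  gcongr

theorem rayFourier_eq (f : Space d → ℂ) (θ : Space d) (j : ℕ) (s : ℝ) :
    rayFourier f θ j s = (-(2 * Real.pi * Complex.I)) ^ j *
      𝓕 (fun y => ((⟪y, θ⟫ : ℝ) : ℂ) ^ j * f y) (s • θ) := by
  rw [rayFourier, Real.fourier_eq, Real.fourier_eq, ← integral_const_mul]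
  congr 1
  ext y
  simp only [Circle.smul_def, smul_eq_mul]
  ring

variable {v : L2 d}

theorem IsRapid.aestronglyMeasurable_inner_pow_mul (hw : IsRapid w m B) (v : L2 d)
    (θ : Space d) (j : ℕ) :
    AEStronglyMeasurable fun y => ((⟪y, θ⟫ : ℝ) : ℂ) ^ j * weighted w v y := by
  refine AEStronglyMeasurable.mul (Continuous.aestronglyMeasurable ?_)
    (hw.aestronglyMeasurable_weighted v)
  fun_prop

/-- An L¹ bound, uniform in s and θ. It serves near zero energy, where s ranges over a fixed
interval and no gain from the Jacobian is needed. -/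
theorem IsRapid.norm_rayFourier_le (hw : IsRapid w m B) (v : L2 d) {θ : Space d}
    (hθ : ‖θ‖ ≤ 1) (j : ℕ) (s : ℝ) :
    ‖rayFourier (weighted w v) θ j s‖ ≤
      (momentConst d * ‖v‖) * ((2 * Real.pi * B) ^ (j + 1) * m j) := by
  have h1 := hw.integral_norm_le
    (norm_inner_pow_mul_le (weighted w v) hθ j)
  have h2 : (1 : ℝ) ≤ 2 * Real.pi := by linarith [Real.pi_gt_three]
  have h3 : (2 * Real.pi) ^ j ≤ (2 * Real.pi) ^ (j + 1) := pow_le_pow_right₀ h2 (by omega)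
  have h4 := hw.coeff_nonneg j
  have h5 := momentConst_nonneg d
  rw [rayFourier_eq, norm_mul, norm_pow, norm_two_pi_I]
  calc _ ≤ (2 * Real.pi) ^ (j + 1) * (momentConst d * (B ^ (j + 1) * m j) * ‖v‖) := by
        gcongr
        exact (norm_fourier_le _ _).trans h1
    _ = _ := by rw [mul_pow]; ring

theorem hasDerivAt_fourier_line {g : Space d → ℂ} (h0 : Integrable g)
    (h1 : Integrable fun y => ‖y‖ * ‖g y‖) (θ : Space d) (s : ℝ) :
    HasDerivAt (fun t : ℝ => 𝓕 g (t • θ))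
      (𝓕 (fun y => (-(2 * Real.pi * Complex.I) * (⟪y, θ⟫ : ℝ)) * g y) (s • θ)) s := by
  have hF := Real.hasFDerivAt_fourier h0 h1 (s • θ)
  have hl : HasDerivAt (fun t : ℝ => t • θ) θ s := by
    simpa using (hasDerivAt_id s).smul_const θ
  have h := hF.comp_hasDerivAt s hl
  refine h.congr_deriv ?_
  rw [Real.fourier_continuousLinearMap_apply]
  · refine congrArg (fun f : Space d → ℂ => 𝓕 f (s • θ)) (funext fun y => ?_)
    rw [VectorFourier.fourierSMulRight_apply, innerSL_apply_apply, Complex.real_smul, smul_eq_mul]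
    ring
  · refine Integrable.mono' (h1.const_mul (2 * Real.pi * ‖innerSL ℝ (E := Space d)‖))
      h0.1.fourierSMulRight (Filter.Eventually.of_forall fun y => ?_)
    refine (VectorFourier.norm_fourierSMulRight_le (innerSL ℝ) g y).trans (le_of_eq ?_)
    ring

/-- Differentiation under the Fourier integral; the moment of order j + 1 supplies the
integrability. -/
theorem IsRapid.hasDerivAt_rayFourier (hw : IsRapid w m B) (v : L2 d) {θ : Space d}
    (hθ : ‖θ‖ ≤ 1) (j : ℕ) (s : ℝ) :
    HasDerivAt (rayFourier (weighted w v) θ j) (rayFourier (weighted w v) θ (j + 1) s) s := by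
  set g : Space d → ℂ := fun y => ((⟪y, θ⟫ : ℝ) : ℂ) ^ j * weighted w v y with hg
  have hb := norm_inner_pow_mul_le (weighted w v) hθ j
  have hmeas := hw.aestronglyMeasurable_inner_pow_mul v θ j
  have h0 : Integrable g := hw.integrable hmeas hb
  have h1 : Integrable fun y => ‖y‖ * ‖g y‖ := by
    have h2 : Integrable fun y => (((‖y‖ * ‖g y‖ : ℝ)) : ℂ) := by
      refine hw.integrable (v := v) (j := j + 1) ?_ fun y => ?_
      · exact Complex.continuous_ofReal.comp_aestronglyMeasurable
          (continuous_norm.aestronglyMeasurable.mul hmeas.norm)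
      · rw [Complex.norm_real, norm_mul, norm_norm, norm_norm, pow_succ', mul_assoc]
        exact mul_le_mul_of_nonneg_left (hb y) (norm_nonneg _)
    exact h2.re
  have h := (hasDerivAt_fourier_line h0 h1 θ s).const_mul ((-(2 * Real.pi * Complex.I)) ^ j)
  have e : rayFourier (weighted w v) θ j = fun t : ℝ =>
      (-(2 * Real.pi * Complex.I)) ^ j * 𝓕 g (t • θ) := by
    ext t
    rw [rayFourier_eq]
  rw [e]
  refine h.congr_deriv ?_
  rw [rayFourier_eq, Real.fourier_eq, Real.fourier_eq, ← integral_const_mul, ← integral_const_mul]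
  congr 1
  ext y
  simp only [Circle.smul_def, smul_eq_mul, hg]
  ring

/-- A majorant, square integrable on the whole space, of the radial derivatives of the Fourier
transform of `f`. -/
noncomputable def radialMajorant (f : Space d → ℂ) (j : ℕ) (ξ : Space d) : ℝ :=
  (2 * Real.pi) ^ j * ∑ a : Fin j → Fin d, ‖𝓕 (fun y => (∏ i, (y (a i) : ℂ)) * f y) ξ‖

theorem radialMajorant_nonneg (f : Space d → ℂ) (j : ℕ) (ξ : Space d) :
    0 ≤ radialMajorant f j ξ := by
  unfold radialMajorant
  have := Real.pi_pos
  positivity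

theorem norm_prod_mul_le (f : Space d → ℂ) {j : ℕ} (a : Fin j → Fin d) (y : Space d) :
    ‖(∏ i, (y (a i) : ℂ)) * f y‖ ≤ ‖y‖ ^ j * ‖f y‖ := by
  rw [norm_mul, norm_prod]
  refine mul_le_mul_of_nonneg_right ?_ (norm_nonneg _)
  refine (Finset.prod_le_prod (fun i _ => norm_nonneg _) (g := fun _ => ‖y‖) fun i _ => ?_).trans
    (by simp)
  rw [Complex.norm_real]
  exact PiLp.norm_apply_le y (a i)

theorem IsRapid.aestronglyMeasurable_prod_mul (hw : IsRapid w m B) (v : L2 d)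
    {j : ℕ} (a : Fin j → Fin d) :
    AEStronglyMeasurable fun y : Space d => (∏ i, (y (a i) : ℂ)) * weighted w v y := by
  refine AEStronglyMeasurable.mul (Continuous.aestronglyMeasurable ?_)
    (hw.aestronglyMeasurable_weighted v)
  fun_prop

/-- Along a ray the direction θ enters the integrand through ⟨y,θ⟩^j. Expanding this power into
monomials in y, with coefficients of modulus at most 1, gives a bound by a function of the point sθ
alone, to which Plancherel applies. -/
theorem IsRapid.norm_rayFourier_le_radialMajorant (hw : IsRapid w m B) (v : L2 d) {θ : Space d}
    (hθ : ‖θ‖ ≤ 1) (j : ℕ) (s : ℝ) :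
    ‖rayFourier (weighted w v) θ j s‖ ≤ radialMajorant (weighted w v) j (s • θ) := by
  have hint : ∀ a : Fin j → Fin d,
      Integrable fun y : Space d => (∏ i, (y (a i) : ℂ)) * weighted w v y := fun a =>
    hw.integrable (hw.aestronglyMeasurable_prod_mul v a) (norm_prod_mul_le _ a)
  have e : 𝓕 (fun y => ((⟪y, θ⟫ : ℝ) : ℂ) ^ j * weighted w v y) (s • θ) =
      ∑ a : Fin j → Fin d, (∏ i, (θ (a i) : ℂ)) *
        𝓕 (fun y => (∏ i, (y (a i) : ℂ)) * weighted w v y) (s • θ) := by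
    simp_rw [Real.fourier_eq, ← integral_const_mul]
    rw [← integral_finsetSum]
    · congr 1
      ext y
      have : ((⟪y, θ⟫ : ℝ) : ℂ) = ∑ i, (θ i : ℂ) * (y i : ℂ) := by
        rw [PiLp.inner_apply]
        simp
      rw [this, Fintype.sum_pow, Finset.sum_mul, Finset.smul_sum]
      refine Finset.sum_congr rfl fun a _ => ?_
      rw [Finset.prod_mul_distrib]
      simp only [Circle.smul_def, smul_eq_mul]
      ring
    · intro a _
      refine Integrable.const_mul ?_ _
      exact (Real.fourierIntegral_convergent_iff (s • θ)).mpr (hint a)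
  rw [rayFourier_eq, norm_mul, norm_pow, norm_two_pi_I, radialMajorant, e]
  have hp := Real.pi_pos
  gcongr
  refine (norm_sum_le _ _).trans (Finset.sum_le_sum fun a _ => ?_)
  rw [norm_mul]
  refine mul_le_of_le_one_left (norm_nonneg _) ?_
  rw [norm_prod]
  refine Finset.prod_le_one (fun i _ => norm_nonneg _) fun i _ => ?_
  rw [Complex.norm_real]
  exact (PiLp.norm_apply_le θ (a i)).trans hθ

theorem IsRapid.continuous_radialMajorant (hw : IsRapid w m B) (v : L2 d) (j : ℕ) :
    Continuous (radialMajorant (weighted w v) j) := by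
  unfold radialMajorant
  refine Continuous.mul continuous_const (continuous_finsetSum _ fun a _ => ?_)
  exact (continuous_fourier (hw.integrable (hw.aestronglyMeasurable_prod_mul v a)
    (norm_prod_mul_le _ a))).norm

theorem IsRapid.memLp_radialMajorant (hw : IsRapid w m B) (v : L2 d) (j : ℕ) :
    MemLp (radialMajorant (weighted w v) j) 2 := by
  have hF : ∀ a : Fin j → Fin d,
      MemLp (fun ξ => ‖𝓕 (fun y => (∏ i, (y (a i) : ℂ)) * weighted w v y) ξ‖) 2 := fun a => by
    have hm := hw.aestronglyMeasurable_prod_mul v a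
    exact (memLp_fourier (hw.integrable hm (norm_prod_mul_le _ a))
      (hw.memLp hm (norm_prod_mul_le _ a))).norm
  exact (memLp_finsetSum Finset.univ fun a _ => hF a).const_mul _

/-- Plancherel for each of the d^j monomials; their number only enlarges the geometric constant. -/
theorem IsRapid.lpNorm_radialMajorant_le (hw : IsRapid w m B) (v : L2 d) (j : ℕ) :
    lpNorm (radialMajorant (weighted w v) j) 2 volume ≤
      ‖v‖ * ((2 * Real.pi * (d + 1) * B) ^ (j + 1) * m j) := by
  have hF : ∀ a : Fin j → Fin d,
      MemLp (fun ξ => ‖𝓕 (fun y => (∏ i, (y (a i) : ℂ)) * weighted w v y) ξ‖) 2 := fun a => by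
    have hm := hw.aestronglyMeasurable_prod_mul v a
    exact (memLp_fourier (hw.integrable hm (norm_prod_mul_le _ a))
      (hw.memLp hm (norm_prod_mul_le _ a))).norm
  have hN : ∀ a : Fin j → Fin d,
      lpNorm (fun ξ => ‖𝓕 (fun y => (∏ i, (y (a i) : ℂ)) * weighted w v y) ξ‖) 2 volume ≤
        B ^ (j + 1) * m j * ‖v‖ := fun a => by
    have hm := hw.aestronglyMeasurable_prod_mul v a
    have h1 := hw.integrable hm (norm_prod_mul_le _ a)
    have h2 := hw.memLp hm (norm_prod_mul_le _ a)
    rw [lpNorm_norm (memLp_fourier h1 h2).1, lpNorm_fourier h1 h2]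
    exact hw.lpNorm_le (norm_prod_mul_le _ a)
  have e : radialMajorant (weighted w v) j = ((2 * Real.pi) ^ j) • ∑ a : Fin j → Fin d,
      fun ξ => ‖𝓕 (fun y => (∏ i, (y (a i) : ℂ)) * weighted w v y) ξ‖ := by
    ext ξ
    simp [radialMajorant]
  have hp := Real.pi_pos
  have h2 : (1 : ℝ) ≤ 2 * Real.pi := by linarith [Real.pi_gt_three]
  have h3 : (2 * Real.pi) ^ j ≤ (2 * Real.pi) ^ (j + 1) := pow_le_pow_right₀ h2 (by omega)
  have h4 : (d : ℝ) ^ j ≤ (d + 1 : ℝ) ^ (j + 1) := by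
    calc (d : ℝ) ^ j ≤ (d + 1 : ℝ) ^ j := by gcongr; linarith
      _ ≤ _ := pow_le_pow_right₀ (by linarith [Nat.cast_nonneg (α := ℝ) d]) (by omega)
  have hc := mul_nonneg (hw.coeff_nonneg j) (norm_nonneg v)
  rw [e, lpNorm_const_smul]
  have hs : lpNorm (∑ a : Fin j → Fin d,
      fun ξ => ‖𝓕 (fun y => (∏ i, (y (a i) : ℂ)) * weighted w v y) ξ‖) 2 volume ≤
      (d : ℝ) ^ j * (B ^ (j + 1) * m j * ‖v‖) := by
    refine (lpNorm_sum_le (fun a _ => hF a) (by norm_num)).trans ?_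
    refine (Finset.sum_le_card_nsmul _ _ _ fun a _ => hN a).trans (le_of_eq ?_)
    simp
  have hn : ‖(2 * Real.pi) ^ j‖ = (2 * Real.pi) ^ j := Real.norm_of_nonneg (by positivity)
  calc _ ≤ (2 * Real.pi) ^ (j + 1) * ((d + 1 : ℝ) ^ (j + 1) * (B ^ (j + 1) * m j * ‖v‖)) := by
        refine mul_le_mul ?_ (hs.trans ?_) lpNorm_nonneg (by positivity)
        · simpa [abs_of_pos hp] using h3
        · exact mul_le_mul_of_nonneg_right h4 hc
    _ = _ := by simp only [mul_pow]; ring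

end RayTransform

end FreeResolvent

namespace FreeResolvent

open scoped FourierTransform RealInnerProductSpace

/-! ### Polar coordinates -/

section Polar

open Set Metric

variable {E F : Type*} [NormedAddCommGroup E] [NormedSpace ℝ E]
  [FiniteDimensional ℝ E] [MeasurableSpace E] [BorelSpace E] (μ : Measure E) [μ.IsAddHaarMeasure]
  [NormedAddCommGroup F]

theorem integrable_polar {h : E → F} (hh : Integrable h μ) :
    Integrable (fun p : sphere (0 : E) 1 × Ioi (0 : ℝ) => h ((p.2 : ℝ) • (p.1 : E)))
      (μ.toSphere.prod (.volumeIoiPow (Module.finrank ℝ E - 1))) := by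
  rw [← μ.measurePreserving_homeomorphUnitSphereProd.integrable_comp_emb
    (Homeomorph.measurableEmbedding _)]
  have h1 : (fun p : sphere (0 : E) 1 × Ioi (0 : ℝ) => h ((p.2 : ℝ) • (p.1 : E))) ∘
      homeomorphUnitSphereProd E = h ∘ (↑) := by
    ext x
    simp only [Function.comp_apply]
    congr 1
    exact congrArg Subtype.val ((homeomorphUnitSphereProd E).symm_apply_apply x)
  rw [h1, ← integrableOn_iff_comap_subtypeVal (measurableSet_singleton _).compl]
  exact hh.integrableOn

variable [Nontrivial E] [NormedSpace ℝ F]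

theorem integral_volumeIoiPow (n : ℕ) (g : ℝ → F) :
    ∫ s : Ioi (0 : ℝ), g s ∂(Measure.volumeIoiPow n) = ∫ s in Ioi (0 : ℝ), s ^ n • g s := by
  simp only [Measure.volumeIoiPow, ENNReal.ofReal]
  rw [integral_withDensity_eq_integral_smul,
    integral_subtype_comap measurableSet_Ioi fun a ↦ Real.toNNReal (a ^ n) • g a,
    setIntegral_congr_fun measurableSet_Ioi fun x hx ↦ ?_]
  · rw [NNReal.smul_def, Real.coe_toNNReal _ (pow_nonneg hx.out.le _)]
  · exact (measurable_subtype_coe.pow_const _).real_toNNReal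

theorem integral_eq_integral_prod_polar (h : E → F) :
    ∫ x, h x ∂μ = ∫ p : sphere (0 : E) 1 × Ioi (0 : ℝ), h ((p.2 : ℝ) • (p.1 : E))
      ∂(μ.toSphere.prod (.volumeIoiPow (Module.finrank ℝ E - 1))) := by
  have h0 : ∫ x, h x ∂μ = ∫ x : ({0}ᶜ : Set E), h x ∂(μ.comap (↑)) := by
    rw [integral_subtype_comap (measurableSet_singleton _).compl h,
      restrict_compl_singleton]
  rw [h0, ← μ.measurePreserving_homeomorphUnitSphereProd.integral_comp
    (Homeomorph.measurableEmbedding _)]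
  exact integral_congr_ae (Filter.Eventually.of_forall fun x => congrArg h
    (congrArg Subtype.val ((homeomorphUnitSphereProd E).symm_apply_apply x)).symm)

/-- Integration in polar coordinates over an annulus. -/
theorem setIntegral_annulus {h : E → F} {a b : ℝ} (ha : 0 ≤ a) (hab : a ≤ b)
    (hh : IntegrableOn h {x | ‖x‖ ∈ Ioc a b} μ) :
    Integrable (fun θ : sphere (0 : E) 1 => ∫ s in a..b,
      s ^ (Module.finrank ℝ E - 1) • h (s • (θ : E))) μ.toSphere ∧
    ∫ x in {x | ‖x‖ ∈ Ioc a b}, h x ∂μ = ∫ θ : sphere (0 : E) 1, (∫ s in a..b,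
      s ^ (Module.finrank ℝ E - 1) • h (s • (θ : E))) ∂μ.toSphere := by
  have hS : MeasurableSet {x : E | ‖x‖ ∈ Ioc a b} := measurable_norm measurableSet_Ioc
  have hi := integrable_polar μ ((integrable_indicator_iff hS).mpr hh)
  have e : ∀ θ : sphere (0 : E) 1, ∫ s : Ioi (0 : ℝ),
      indicator {x | ‖x‖ ∈ Ioc a b} h ((s : ℝ) • (θ : E))
        ∂(Measure.volumeIoiPow (Module.finrank ℝ E - 1)) =
      ∫ s in a..b, s ^ (Module.finrank ℝ E - 1) • h (s • (θ : E)) := by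
    intro θ
    rw [integral_volumeIoiPow (Module.finrank ℝ E - 1)
      (fun s => indicator {x | ‖x‖ ∈ Ioc a b} h (s • (θ : E))), intervalIntegral.integral_of_le hab]
    have h1 : ∀ s ∈ Ioi (0 : ℝ), s ^ (Module.finrank ℝ E - 1) •
        indicator {x | ‖x‖ ∈ Ioc a b} h (s • (θ : E)) =
        indicator (Ioc a b) (fun s => s ^ (Module.finrank ℝ E - 1) • h (s • (θ : E))) s := by
      intro s hs
      have hn : ‖s • (θ : E)‖ = s := by
        rw [norm_smul, norm_eq_of_mem_sphere, mul_one, Real.norm_of_nonneg hs.out.le]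
      by_cases hsa : s ∈ Ioc a b
      · rw [indicator_of_mem hsa, indicator_of_mem]
        simpa [hn] using hsa
      · rw [indicator_of_notMem hsa, indicator_of_notMem, smul_zero]
        simpa [hn] using hsa
    rw [setIntegral_congr_fun measurableSet_Ioi h1, setIntegral_indicator measurableSet_Ioc]
    congr 2
    exact inter_eq_right.mpr fun s hs => ha.trans_lt hs.1
  have hL := hi.integral_prod_left
  simp only [e] at hL
  refine ⟨hL, ?_⟩
  rw [← integral_indicator hS, integral_eq_integral_prod_polar, integral_prod _ hi]
  simp only [e]

end Polar

/-! ### Sup bounds on an interval and densities along rays -/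

section Auxiliary

open Set

/-- One-dimensional Sobolev inequality: q(s) - q(t) is an integral of q', and the resulting bound is
averaged over t in the interval. It trades a supremum over s for integrals over s, which polar
coordinates can convert back. -/
theorem norm_le_integral_add_integral {a b : ℝ} (hab : a < b) {q q' : ℝ → ℂ} {Q Q' : ℝ → ℝ}
    (hq : ∀ s, HasDerivAt q (q' s) s) (hq' : Continuous q') (hQc : Continuous Q)
    (hQc' : Continuous Q')
    (hQ : ∀ s ∈ Icc a b, ‖q s‖ ≤ Q s) (hQ' : ∀ s ∈ Icc a b, ‖q' s‖ ≤ Q' s) {s : ℝ}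
    (hs : s ∈ Icc a b) :
    ‖q s‖ ≤ (b - a)⁻¹ * (∫ t in a..b, Q t) + ∫ t in a..b, Q' t := by
  have hba : 0 < b - a := by linarith
  have h1 : ∀ t ∈ Icc a b, ‖q s‖ ≤ Q t + ∫ t in a..b, Q' t := by
    intro t ht
    have h2 : ∫ r in t..s, q' r = q s - q t :=
      intervalIntegral.integral_eq_sub_of_hasDerivAt (fun r _ => hq r)
        (hq'.intervalIntegrable _ _)
    have h3 : ‖∫ r in t..s, q' r‖ ≤ ∫ r in a..b, Q' r := by
      refine (intervalIntegral.norm_integral_le_integral_norm_uIoc).trans ?_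
      have hsub : Set.uIoc t s ⊆ Set.Ioc a b := by
        intro r hr
        rcases Set.mem_uIoc.mp hr with h | h
        · exact ⟨ht.1.trans_lt h.1, h.2.trans hs.2⟩
        · exact ⟨hs.1.trans_lt h.1, h.2.trans ht.2⟩
      rw [intervalIntegral.integral_of_le hab.le]
      have hi1 : IntegrableOn (fun r => ‖q' r‖) (Ioc a b) :=
        (hq'.norm.integrableOn_Icc).mono_set Ioc_subset_Icc_self
      refine (setIntegral_mono_set hi1 (Filter.Eventually.of_forall fun r => norm_nonneg _)
        hsub.eventuallyLE).trans ?_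
      exact setIntegral_mono_on hi1 ((hQc'.integrableOn_Icc).mono_set Ioc_subset_Icc_self)
        measurableSet_Ioc fun r hr => hQ' r ⟨hr.1.le, hr.2⟩
    have h4 : q s = q t + ∫ r in t..s, q' r := by rw [h2]; ring
    calc ‖q s‖ ≤ ‖q t‖ + ‖∫ r in t..s, q' r‖ := by rw [h4]; exact norm_add_le _ _
      _ ≤ _ := add_le_add (hQ t ht) h3
  have h5 := intervalIntegral.integral_mono_on hab.le
    (intervalIntegrable_const (μ := volume) (c := ‖q s‖))
    ((hQc.add continuous_const).intervalIntegrable a b) h1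
  simp only [Pi.add_apply] at h5
  rw [intervalIntegral.integral_const, intervalIntegral.integral_add
    (hQc.intervalIntegrable _ _) intervalIntegrable_const, intervalIntegral.integral_const,
    smul_eq_mul, smul_eq_mul] at h5
  rw [← mul_le_mul_iff_right₀ hba, mul_add, ← mul_assoc, mul_inv_cancel₀ hba.ne', one_mul]
  exact h5

/-- The derivatives of `s ↦ s ^ e`. -/
noncomputable def powSeq (e i : ℕ) (s : ℝ) : ℝ := (e.descFactorial i : ℝ) * s ^ (e - i)

theorem hasDerivAt_powSeq (e i : ℕ) (s : ℝ) : HasDerivAt (powSeq e i) (powSeq e (i + 1) s) s := by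
  unfold powSeq
  refine ((hasDerivAt_pow (e - i) s).const_mul (e.descFactorial i : ℝ)).congr_deriv ?_
  rw [Nat.descFactorial_succ, Nat.sub_sub]
  push_cast
  ring

theorem abs_powSeq_le_of_abs_le_one (e i : ℕ) {s : ℝ} (hs : |s| ≤ 1) :
    |powSeq e i s| ≤ (e : ℝ) ^ i := by
  rw [powSeq, abs_mul, abs_pow, Nat.abs_cast]
  have h1 : (e.descFactorial i : ℝ) ≤ (e : ℝ) ^ i := by
    exact_mod_cast Nat.descFactorial_le_pow e i
  have h2 : |s| ^ (e - i) ≤ 1 := pow_le_one₀ (abs_nonneg _) hs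
  calc _ ≤ (e : ℝ) ^ i * 1 := by gcongr
    _ = _ := mul_one _

/-- Away from s = 0 each derivative of s^e costs a constant factor, so s^e can be pulled out of a
Leibniz sum. -/
theorem abs_powSeq_le_of_le (e i : ℕ) {s w : ℝ} (hw : 0 < w) (hs : w ≤ s) :
    |powSeq e i s| ≤ (e / w) ^ i * s ^ e := by
  have hs0 : 0 < s := hw.trans_le hs
  rw [powSeq, abs_mul, abs_pow, Nat.abs_cast, abs_of_pos hs0]
  rcases Nat.lt_or_ge e i with hei | hie
  · rw [Nat.descFactorial_of_lt hei]
    simp only [Nat.cast_zero, zero_mul]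
    positivity
  · have h1 : (e.descFactorial i : ℝ) ≤ (e : ℝ) ^ i := by
      exact_mod_cast Nat.descFactorial_le_pow e i
    have h2 : w ^ i ≤ s ^ i := by gcongr
    have h3 : s ^ e = s ^ i * s ^ (e - i) := by rw [← pow_add, Nat.add_sub_cancel' hie]
    rw [div_pow, h3, div_mul_eq_mul_div, le_div_iff₀ (by positivity)]
    calc _ = (e.descFactorial i : ℝ) * (w ^ i * s ^ (e - i)) := by ring
      _ ≤ _ := by gcongr

variable {d : ℕ}

/-- The monomial `ξ^γ`. -/
noncomputable def xiPow (γ : Fin d → ℕ) (ξ : Space d) : ℂ := ∏ i, (ξ i : ℂ) ^ γ i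

theorem continuous_xiPow (γ : Fin d → ℕ) : Continuous (xiPow γ) := by
  unfold xiPow
  fun_prop

theorem xiPow_smul (γ : Fin d → ℕ) (s : ℝ) (ξ : Space d) :
    xiPow γ (s • ξ) = (s : ℂ) ^ (∑ i, γ i) * xiPow γ ξ := by
  unfold xiPow
  rw [← Finset.prod_pow_eq_pow_sum, ← Finset.prod_mul_distrib]
  refine Finset.prod_congr rfl fun i _ => ?_
  rw [PiLp.smul_apply, smul_eq_mul, Complex.ofReal_mul, mul_pow]

theorem xiPow_neg (γ : Fin d → ℕ) (ξ : Space d) :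
    xiPow γ (-ξ) = (-1) ^ (∑ i, γ i) * xiPow γ ξ := by
  have := xiPow_smul γ (-1) ξ
  simpa using this

theorem norm_xiPow_le (γ : Fin d → ℕ) (ξ : Space d) : ‖xiPow γ ξ‖ ≤ ‖ξ‖ ^ (∑ i, γ i) := by
  unfold xiPow
  rw [norm_prod, ← Finset.prod_pow_eq_pow_sum]
  refine Finset.prod_le_prod (fun i _ => norm_nonneg _) fun i _ => ?_
  rw [norm_pow, Complex.norm_real]
  exact pow_le_pow_left₀ (norm_nonneg _) (PiLp.norm_apply_le ξ i) _

/-- The derivatives along the ray spanned by `θ` of the density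
`s^e θ^γ û(sθ) conj (v̂(sθ)) / 2`. -/
noncomputable def rayDensity (e : ℕ) (γ : Fin d → ℕ) (f g : Space d → ℂ) (θ : Space d) (j : ℕ)
    (s : ℝ) : ℂ :=
  leibnizSeq (fun i => xiPow γ θ * 2⁻¹ * (powSeq e i s : ℂ))
    (leibnizSeq (fun i => rayFourier f θ i s)
      (fun i => starRingEnd ℂ (rayFourier g θ i s))) j

theorem rayDensity_zero (e : ℕ) (γ : Fin d → ℕ) (f g : Space d → ℂ) (θ : Space d) (s : ℝ) :
    rayDensity e γ f g θ 0 s =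
      xiPow γ θ * 2⁻¹ * (s : ℂ) ^ e * (𝓕 f (s • θ) * starRingEnd ℂ (𝓕 g (s • θ))) := by
  simp [rayDensity, leibnizSeq_zero, rayFourier_zero, powSeq]

variable {w : Space d → ℝ} {m : ℕ → ℝ} {B : ℝ}

theorem IsRapid.hasDerivAt_rayDensity (hw : IsRapid w m B) (e : ℕ) (γ : Fin d → ℕ) (u v : L2 d)
    {θ : Space d} (hθ : ‖θ‖ ≤ 1) (j : ℕ) (s : ℝ) :
    HasDerivAt (rayDensity e γ (weighted w u) (weighted w v) θ j)
      (rayDensity e γ (weighted w u) (weighted w v) θ (j + 1) s) s := by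
  refine hasDerivAt_leibnizSeq (a := fun i s => xiPow γ θ * 2⁻¹ * (powSeq e i s : ℂ))
    (b := fun j s => leibnizSeq (fun i => rayFourier (weighted w u) θ i s)
      (fun i => starRingEnd ℂ (rayFourier (weighted w v) θ i s)) j) (fun i => ?_) (fun i => ?_) j
  · exact ((hasDerivAt_powSeq e i s).ofReal_comp).const_mul _
  · refine hasDerivAt_leibnizSeq (a := fun i s => rayFourier (weighted w u) θ i s)
      (b := fun i s => starRingEnd ℂ (rayFourier (weighted w v) θ i s))
      (fun i => hw.hasDerivAt_rayFourier u hθ i s) (fun i => ?_) i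
    exact (hw.hasDerivAt_rayFourier v hθ i s).star

theorem norm_rayDensity_le {e : ℕ} {γ : Fin d → ℕ} {f g : Space d → ℂ} {θ : Space d}
    (hθ : ‖θ‖ ≤ 1) {s : ℝ} {R U V : ℕ → ℝ} (hR : ∀ i, |powSeq e i s| ≤ R i)
    (hU : ∀ i, ‖rayFourier f θ i s‖ ≤ U i) (hV : ∀ i, ‖rayFourier g θ i s‖ ≤ V i) (j : ℕ) :
    ‖rayDensity e γ f g θ j s‖ ≤ leibnizSeq R (leibnizSeq U V) j := by
  refine norm_leibnizSeq_le (fun i => ?_) (fun i => ?_) j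
  · have h1 : ‖xiPow γ θ‖ ≤ 1 := (norm_xiPow_le γ θ).trans (pow_le_one₀ (norm_nonneg _) hθ)
    rw [norm_mul, norm_mul, norm_inv, Complex.norm_two, Complex.norm_real, Real.norm_eq_abs]
    have h2 := abs_nonneg (powSeq e i s)
    have h3 := norm_nonneg (xiPow γ θ)
    calc _ ≤ 1 * 1 * |powSeq e i s| := by gcongr; norm_num
      _ ≤ R i := by rw [one_mul, one_mul]; exact hR i
  · refine norm_leibnizSeq_le hU (fun i => ?_) i
    rw [RCLike.norm_conj]
    exact hV i

end Auxiliary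

end FreeResolvent

namespace FreeResolvent

open scoped FourierTransform RealInnerProductSpace
open Set Metric

/-! ### Geometric constants -/

section Numerics

theorem mul_pow_succ_le {a c : ℝ} (ha : 0 ≤ a) (hc : 0 ≤ c) (k : ℕ) :
    a * c ^ (k + 1) ≤ ((1 + a) * c) ^ (k + 1) := by
  rw [mul_pow]
  refine mul_le_mul_of_nonneg_right ?_ (pow_nonneg hc _)
  exact (by linarith : a ≤ 1 + a).trans (le_self_pow₀ (by linarith) (by omega))

theorem pow_succ_add_pow_succ_le {a c : ℝ} (ha : 0 ≤ a) (hc : 0 ≤ c) (k : ℕ) :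
    a ^ (k + 1) + c ^ (k + 1) ≤ (a + c) ^ (k + 1) := by
  have h1 : a ^ k ≤ (a + c) ^ k := pow_le_pow_left₀ ha (by linarith) k
  have h2 : c ^ k ≤ (a + c) ^ k := pow_le_pow_left₀ hc (by linarith) k
  calc a ^ (k + 1) + c ^ (k + 1) = a ^ k * a + c ^ k * c := by ring
    _ ≤ (a + c) ^ k * a + (a + c) ^ k * c := by gcongr
    _ = _ := by ring

end Numerics

variable {d : ℕ}

/-! ### The Fourier symbol and bounded multipliers -/

section Symbol

theorem continuous_resKer (k : ℕ) {z : ℂ} (hz : z.im ≠ 0) : Continuous fun s => resKer k s z := by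
  have h1 : Continuous fun s : ℝ => ((s : ℂ) - z)⁻¹ :=
    Continuous.inv₀ (by fun_prop) fun s => ofReal_sub_ne_zero hz s
  have h2 : Continuous fun s : ℝ => ((s : ℂ) + z)⁻¹ :=
    Continuous.inv₀ (by fun_prop) fun s => ofReal_add_ne_zero hz s
  unfold resKer leibnizSeq
  fun_prop

/-- The `k`-th derivative in `z` of the symbol `ξ^γ / (|ξ|² - z²)`. -/
noncomputable def symbol (γ : Fin d → ℕ) (k : ℕ) (z : ℂ) (ξ : Space d) : ℂ :=
  xiPow γ ξ * resKer k ‖ξ‖ z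

theorem continuous_symbol (γ : Fin d → ℕ) (k : ℕ) {z : ℂ} (hz : z.im ≠ 0) :
    Continuous (symbol γ k z) :=
  (continuous_xiPow γ).mul ((continuous_resKer k hz).comp continuous_norm)

theorem norm_symbol_le (γ : Fin d → ℕ) (k : ℕ) (z : ℂ) (ξ : Space d) :
    ‖symbol γ k z ξ‖ ≤ ‖ξ‖ ^ (∑ i, γ i) * ‖resKer k ‖ξ‖ z‖ := by
  rw [symbol, norm_mul]
  exact mul_le_mul_of_nonneg_right (norm_xiPow_le γ ξ) (norm_nonneg _)

theorem exists_norm_symbol_le {γ : Fin d → ℕ} (hγ : ∑ i, γ i ≤ 2) (k : ℕ) {η : ℝ} (hη : 0 < η)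
    (R : ℝ) : ∃ M, ∀ z : ℂ, η ≤ |z.im| → ‖z‖ ≤ R → ∀ ξ : Space d, ‖symbol γ k z ξ‖ ≤ M :=
  ⟨_, fun z hz hR ξ => (norm_symbol_le γ k z ξ).trans
    (pow_mul_norm_resKer_le hγ k (norm_nonneg ξ) hη hz hR)⟩

variable {F G K : Space d → ℂ}

theorem integrable_mul_conj (hF : MemLp F 2) (hG : MemLp G 2) :
    Integrable fun ξ => F ξ * starRingEnd ℂ (G ξ) := by
  have hG' : MemLp (fun ξ => starRingEnd ℂ (G ξ)) 2 := hG.star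
  exact hF.integrable_mul hG'

theorem integrableOn_mul_mul_conj (hF : MemLp F 2) (hG : MemLp G 2) {S : Set (Space d)} {M : ℝ}
    (hK : AEStronglyMeasurable K (volume.restrict S))
    (hM : ∀ᵐ ξ ∂(volume.restrict S), ‖K ξ‖ ≤ M) :
    IntegrableOn (fun ξ => K ξ * (F ξ * starRingEnd ℂ (G ξ))) S :=
  (integrable_mul_conj hF hG).integrableOn.bdd_mul hK hM

theorem norm_setIntegral_mul_mul_conj_le (hF : MemLp F 2) (hG : MemLp G 2) {S : Set (Space d)}
    {M : ℝ} (hM0 : 0 ≤ M) (hM : ∀ᵐ ξ ∂(volume.restrict S), ‖K ξ‖ ≤ M) :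
    ‖∫ ξ in S, K ξ * (F ξ * starRingEnd ℂ (G ξ))‖ ≤
      M * (lpNorm F 2 volume * lpNorm G 2 volume) := by
  have hi := integrable_norm_mul_norm hF hG
  have h1 : ‖∫ ξ in S, K ξ * (F ξ * starRingEnd ℂ (G ξ))‖ ≤
      ∫ ξ in S, M * (‖F ξ‖ * ‖G ξ‖) := by
    refine norm_integral_le_of_norm_le (hi.const_mul M).integrableOn ?_
    filter_upwards [hM] with ξ hξ
    rw [norm_mul, norm_mul, RCLike.norm_conj]
    exact mul_le_mul_of_nonneg_right hξ (by positivity)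
  refine h1.trans ?_
  rw [integral_const_mul]
  refine mul_le_mul_of_nonneg_left ?_ hM0
  refine (setIntegral_le_integral hi (Filter.Eventually.of_forall fun ξ => by positivity)).trans ?_
  exact integral_norm_mul_norm_le hF hG

end Symbol

/-! ### The weighted functions on rays -/

section Rays

variable {w : Space d → ℝ} {m : ℕ → ℝ} {A B : ℝ}

theorem IsRapid.integrable_weighted (hw : IsRapid w m B) (u : L2 d) :
    Integrable (weighted w u) :=
  hw.integrable (j := 0) (hw.aestronglyMeasurable_weighted u) fun y => by rw [pow_zero, one_mul]

theorem IsRapid.memLp_weighted (hw : IsRapid w m B) (u : L2 d) : MemLp (weighted w u) 2 :=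
  hw.memLp (j := 0) (hw.aestronglyMeasurable_weighted u) fun y => by rw [pow_zero, one_mul]

theorem IsRapid.memLp_fourier_weighted (hw : IsRapid w m B) (u : L2 d) :
    MemLp (𝓕 (weighted w u)) 2 :=
  memLp_fourier (hw.integrable_weighted u) (hw.memLp_weighted u)

theorem IsRapid.continuous_fourier_weighted (hw : IsRapid w m B) (u : L2 d) :
    Continuous (𝓕 (weighted w u)) :=
  continuous_fourier (hw.integrable_weighted u)

theorem IsRapid.lpNorm_fourier_weighted_le (hw : IsRapid w m B) (u : L2 d) :
    lpNorm (𝓕 (weighted w u)) 2 volume ≤ B * m 0 * ‖u‖ := by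
  rw [lpNorm_fourier (hw.integrable_weighted u) (hw.memLp_weighted u)]
  have := hw.lpNorm_le (h := weighted w u) (v := u) (j := 0) fun y => by rw [pow_zero, one_mul]
  simpa using this

/-- The integrand of the singular part of the resolvent in polar coordinates. -/
theorem polar_cauchy_integrand (hd : 2 ≤ d) (γ : Fin d → ℕ) (f g : Space d → ℂ) {θ : Space d}
    (hθ : ‖θ‖ = 1) {s : ℝ} (hs : 0 < s) (c : ℂ) :
    s ^ (d - 1) • (xiPow γ (s • θ) * (2 * (‖s • θ‖ : ℂ))⁻¹ * c *
      (𝓕 f (s • θ) * starRingEnd ℂ (𝓕 g (s • θ)))) =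
    c * rayDensity (d - 2 + ∑ i, γ i) γ f g θ 0 s := by
  have hn : ‖s • θ‖ = s := by rw [norm_smul, hθ, mul_one, Real.norm_of_nonneg hs.le]
  have hsc : (s : ℂ) ≠ 0 := by exact_mod_cast hs.ne'
  rw [hn, rayDensity_zero, xiPow_smul, Complex.real_smul, show d - 1 = d - 2 + 1 by omega, pow_add]
  push_cast
  rw [pow_succ]
  field_simp
  ring

/-- The density s^(d-2+|γ|) θ^γ is continued to negative s. There (-1)^(d-2) = -1 for odd d supplies
exactly the sign of the second partial fraction, while the sign (-1)^|γ| is already that of the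
monomial at -sθ. -/
theorem polar_cauchy_integrand_neg (hd : 2 ≤ d) (hodd : Odd d) (γ : Fin d → ℕ) (f g : Space d → ℂ)
    {θ : Space d} (hθ : ‖θ‖ = 1) {s : ℝ} (hs : 0 < s) (c : ℂ) :
    s ^ (d - 1) • (-(xiPow γ (-(s • θ)) * (2 * (‖s • θ‖ : ℂ))⁻¹ * c *
      (𝓕 f (-(s • θ)) * starRingEnd ℂ (𝓕 g (-(s • θ)))))) =
    c * rayDensity (d - 2 + ∑ i, γ i) γ f g θ 0 (-s) := by
  have hn : ‖s • θ‖ = s := by rw [norm_smul, hθ, mul_one, Real.norm_of_nonneg hs.le]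
  have hsc : (s : ℂ) ≠ 0 := by exact_mod_cast hs.ne'
  have hd2 : (-1 : ℂ) ^ (d - 2) = -1 := by
    have : Odd (d - 2) := by
      obtain ⟨l, hl⟩ := hodd
      exact ⟨l - 1, by omega⟩
    exact this.neg_one_pow
  rw [hn, rayDensity_zero, xiPow_neg, xiPow_smul, Complex.real_smul,
    show d - 1 = d - 2 + 1 by omega, neg_smul, Complex.ofReal_neg, neg_pow (s : ℂ), pow_add, pow_add,
    hd2]
  push_cast
  rw [pow_succ]
  field_simp
  ring

end Rays

/-! ### Integrable majorants of the ray densities -/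

section Majorant

variable {w : Space d → ℝ} {m : ℕ → ℝ} {A B : ℝ}

/-- A majorant, integrable on the whole space, of the derivatives of the density of
`û conj v̂` along rays. -/
noncomputable def densityMajorant (r : ℝ) (f g : Space d → ℂ) (j : ℕ) (ξ : Space d) : ℝ :=
  leibnizSeq (fun i => r ^ i)
    (leibnizSeq (fun i => radialMajorant f i ξ) (fun i => radialMajorant g i ξ)) j

theorem densityMajorant_nonneg {r : ℝ} (hr : 0 ≤ r) (f g : Space d → ℂ) (j : ℕ) (ξ : Space d) :
    0 ≤ densityMajorant r f g j ξ :=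
  leibnizSeq_nonneg (fun _ => pow_nonneg hr _) (leibnizSeq_nonneg
    (fun _ => radialMajorant_nonneg _ _ _) fun _ => radialMajorant_nonneg _ _ _) j

theorem IsRapid.continuous_densityMajorant (hw : IsRapid w m B) (r : ℝ) (u v : L2 d) (j : ℕ) :
    Continuous (densityMajorant r (weighted w u) (weighted w v) j) := by
  unfold densityMajorant leibnizSeq
  have h1 := hw.continuous_radialMajorant u
  have h2 := hw.continuous_radialMajorant v
  fun_prop

theorem integrable_leibnizSeq {U V : ℕ → Space d → ℝ}
    (h : ∀ i j, Integrable fun ξ => U i ξ * V j ξ) (k : ℕ) :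
    Integrable (fun ξ => leibnizSeq (fun i => U i ξ) (fun i => V i ξ) k) ∧
    ∫ ξ, leibnizSeq (fun i => U i ξ) (fun i => V i ξ) k =
      ∑ i ∈ Finset.range (k + 1), (k.choose i : ℝ) * ∫ ξ, U i ξ * V (k - i) ξ := by
  unfold leibnizSeq
  refine ⟨integrable_finsetSum _ fun i _ => (h _ _).const_mul _, ?_⟩
  rw [integral_finsetSum _ fun i _ => (h _ _).const_mul _]
  simp_rw [integral_const_mul]

/-- Cauchy–Schwarz handles each product of radial majorants. Two Leibniz sums follow, one for the
product of transforms and one for the power of s, so the constant is enlarged twice. -/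
theorem exists_integral_densityMajorant_le (hm : IsAdmissible m A) (hw : IsRapid w m B)
    {r : ℝ} (hr : 0 ≤ r) : ∃ D, 1 ≤ D ∧ ∀ (u v : L2 d) (j : ℕ),
      Integrable (densityMajorant r (weighted w u) (weighted w v) j) ∧
      ∫ ξ, densityMajorant r (weighted w u) (weighted w v) j ξ ≤
        ‖u‖ * ‖v‖ * (D ^ (j + 1) * m j) := by
  have hA := hm.one_le_const
  have hB := hw.one_le_const
  have hπ := Real.pi_gt_three
  set B₁ := 2 * Real.pi * (d + 1) * B with hB₁
  have hB1 : 1 ≤ B₁ := by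
    have h1 : (1 : ℝ) ≤ 2 * Real.pi := by linarith
    have h2 : (1 : ℝ) ≤ d + 1 := by linarith [Nat.cast_nonneg (α := ℝ) d]
    exact one_le_mul_of_one_le_of_one_le (one_le_mul_of_one_le_of_one_le h1 h2) hB
  set B₂ := 2 * A * B₁ ^ 2 + r with hB₂
  have hB2 : 1 ≤ B₂ := by nlinarith [one_le_pow₀ (n := 2) hB1]
  refine ⟨2 * A * B₂ ^ 2, by nlinarith [one_le_pow₀ (n := 2) hB2], fun u v j => ?_⟩
  have hN : 0 ≤ ‖u‖ * ‖v‖ := by positivity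
  have hint1 : ∀ i j, Integrable fun ξ =>
      radialMajorant (weighted w u) i ξ * radialMajorant (weighted w v) j ξ := fun i j =>
    (hw.memLp_radialMajorant u i).integrable_mul (hw.memLp_radialMajorant v j)
  have hle1 : ∀ i j, ∫ ξ, radialMajorant (weighted w u) i ξ * radialMajorant (weighted w v) j ξ ≤
      ‖u‖ * ‖v‖ * (B₁ ^ (i + 1) * m i * (B₁ ^ (j + 1) * m j)) := by
    intro i j
    have h1 := integral_norm_mul_norm_le (hw.memLp_radialMajorant u i)
      (hw.memLp_radialMajorant v j)
    simp_rw [Real.norm_of_nonneg (radialMajorant_nonneg _ _ _)] at h1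
    refine h1.trans ((mul_le_mul (hw.lpNorm_radialMajorant_le u i)
      (hw.lpNorm_radialMajorant_le v j) lpNorm_nonneg ?_).trans (le_of_eq ?_))
    · have := hm.nonneg i
      positivity
    · ring
  have hint2 := integrable_leibnizSeq hint1
  have hle2 : ∀ l, ∫ ξ, leibnizSeq (fun i => radialMajorant (weighted w u) i ξ)
      (fun i => radialMajorant (weighted w v) i ξ) l ≤
        ‖u‖ * ‖v‖ * ((2 * A * B₁ ^ 2) ^ (l + 1) * m l) := fun l => by
    rw [(hint2 l).2]
    exact hm.sum_choose_le hB1 hN hle1 l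
  have hint3 := integrable_leibnizSeq (d := d) (U := fun i _ => r ^ i)
    (V := fun l ξ => leibnizSeq (fun i => radialMajorant (weighted w u) i ξ)
      (fun i => radialMajorant (weighted w v) i ξ) l) fun i l => (hint2 l).1.const_mul _
  refine ⟨(hint3 j).1, ?_⟩
  unfold densityMajorant
  rw [(hint3 j).2]
  refine hm.sum_choose_le hB2 hN (X := fun i l => ∫ ξ, r ^ i *
    leibnizSeq (fun i => radialMajorant (weighted w u) i ξ)
      (fun i => radialMajorant (weighted w v) i ξ) l) (fun i l => ?_) j
  rw [integral_const_mul]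
  have hm0 := hm.nonneg l
  have hrB : r ≤ B₂ := by
    have : 0 ≤ 2 * A * B₁ ^ 2 := by positivity
    linarith
  have h3 : r ^ i ≤ B₂ ^ (i + 1) * m i := by
    calc r ^ i ≤ B₂ ^ i := pow_le_pow_left₀ hr hrB i
      _ ≤ B₂ ^ (i + 1) := pow_le_pow_right₀ hB2 (by omega)
      _ ≤ _ := le_mul_of_one_le_right (by positivity) (hm.one_le i)
  have h4 : (2 * A * B₁ ^ 2) ^ (l + 1) ≤ B₂ ^ (l + 1) :=
    pow_le_pow_left₀ (by positivity) (by linarith) _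
  have hmi := hm.nonneg i
  calc r ^ i * ∫ ξ, leibnizSeq (fun i => radialMajorant (weighted w u) i ξ)
        (fun i => radialMajorant (weighted w v) i ξ) l
      ≤ r ^ i * (‖u‖ * ‖v‖ * ((2 * A * B₁ ^ 2) ^ (l + 1) * m l)) :=
        mul_le_mul_of_nonneg_left (hle2 l) (pow_nonneg hr _)
    _ ≤ (B₂ ^ (i + 1) * m i) * (‖u‖ * ‖v‖ * (B₂ ^ (l + 1) * m l)) := by gcongr
    _ = _ := by ring

end Majorant

end FreeResolvent

/-! ### The sesquilinear form and its singular part -/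

namespace FreeResolvent

open scoped FourierTransform RealInnerProductSpace
open Set Metric

variable {d : ℕ} {w : Space d → ℝ} {m : ℕ → ℝ} {A B : ℝ}

/-- The sesquilinear form of the `k`-th derivative of the weighted resolvent. -/
noncomputable def resolventForm (w : Space d → ℝ) (γ : Fin d → ℕ) (k : ℕ) (z : ℂ) (u v : L2 d) :
    ℂ :=
  ∫ ξ, symbol γ k z ξ * (𝓕 (weighted w u) ξ * starRingEnd ℂ (𝓕 (weighted w v) ξ))

/-- The singular part of the symbol. -/
noncomputable def singularSymbol (γ : Fin d → ℕ) (k : ℕ) (z : ℂ) (ξ : Space d) : ℂ :=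
  xiPow γ ξ * (2 * (‖ξ‖ : ℂ))⁻¹ * ((k ! : ℂ) * ((‖ξ‖ : ℂ) - z)⁻¹ ^ (k + 1))

theorem measurable_singularSymbol (γ : Fin d → ℕ) (k : ℕ) (z : ℂ) :
    Measurable (singularSymbol γ k z) := by
  have h1 := (continuous_xiPow γ).measurable
  have h2 : Measurable fun ξ : Space d => (‖ξ‖ : ℂ) := Complex.measurable_ofReal.comp measurable_norm
  unfold singularSymbol
  fun_prop

theorem measurableSet_annulus (a b : ℝ) : MeasurableSet {ξ : Space d | ‖ξ‖ ∈ Ioc a b} :=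
  measurable_norm measurableSet_Ioc

theorem IsRapid.integrable_symbol (hw : IsRapid w m B) {γ : Fin d → ℕ} (hγ : ∑ i, γ i ≤ 2) (k : ℕ)
    {z : ℂ} (hz : z.im ≠ 0) (u v : L2 d) :
    Integrable fun ξ => symbol γ k z ξ *
      (𝓕 (weighted w u) ξ * starRingEnd ℂ (𝓕 (weighted w v) ξ)) := by
  obtain ⟨M, hM⟩ := exists_norm_symbol_le hγ k (abs_pos.mpr hz) ‖z‖
  rw [← integrableOn_univ]
  exact integrableOn_mul_mul_conj (hw.memLp_fourier_weighted u) (hw.memLp_fourier_weighted v)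
    (continuous_symbol γ k hz).aestronglyMeasurable
    (Filter.Eventually.of_forall fun ξ => hM z le_rfl le_rfl ξ)

/-! ### The energy shell -/

section High

/-- Near the shell s is comparable with x, so the power of s in the density exceeds the Jacobian
s^(d-1) by a factor of order (x + 1)^(n-1). This is the source of the energy factor in the theorem.
-/
theorem zpow_estimate {δ : ℝ} (hδ : 0 < δ) {n : ℕ} (hn : n ≤ 2) (hd : 2 ≤ d) {x s : ℝ}
    (hx : δ ≤ x) (hs : |s - x| ≤ δ / 2) :
    s ^ (d - 2 + n) ≤ (4 + 2 / δ) * (x + 1) ^ ((n : ℤ) - 1) * s ^ (d - 1) := by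
  obtain ⟨hs1, hs2⟩ := abs_le.mp hs
  have hs0 : 0 < s := by linarith
  have hx0 : 0 < x := by linarith
  have hδ' : 0 < 2 / δ := by positivity
  rw [show d - 1 = d - 2 + 1 by omega, pow_add, pow_succ s (d - 2)]
  have key : s ^ n ≤ (4 + 2 / δ) * (x + 1) ^ ((n : ℤ) - 1) * s := by
    interval_cases n
    · have : ((x + 1) ^ (((0 : ℕ) : ℤ) - 1)) = (x + 1)⁻¹ := by simp
      rw [this, pow_zero, ← div_eq_mul_inv, div_mul_eq_mul_div, le_div_iff₀ (by linarith), one_mul]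
      have h1 : 1 ≤ 2 / δ * s := by
        rw [div_mul_eq_mul_div, le_div_iff₀ hδ]
        linarith
      nlinarith
    · have : ((x + 1) ^ (((1 : ℕ) : ℤ) - 1)) = 1 := by simp
      rw [this, pow_one]
      nlinarith
    · have : ((x + 1) ^ (((2 : ℕ) : ℤ) - 1)) = x + 1 := by
        rw [show (((2 : ℕ) : ℤ) - 1) = 1 by norm_num, zpow_one]
      rw [this, pow_two]
      refine mul_le_mul_of_nonneg_right ?_ hs0.le
      nlinarith
  calc s ^ (d - 2) * s ^ n ≤ s ^ (d - 2) * ((4 + 2 / δ) * (x + 1) ^ ((n : ℤ) - 1) * s) := by gcongr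
    _ = _ := by ring

/-- On each ray the Cauchy bound needs suprema over s. They are replaced by integrals over s before
integrating over the sphere, so that only integrals over ℝ^d appear and the constants do not depend
on Re z. -/
theorem exists_norm_setIntegral_singularSymbol_le (hd : 2 ≤ d) (hm : IsAdmissible m A)
    (hw : IsRapid w m B) {γ : Fin d → ℕ} (hγ : ∑ i, γ i ≤ 2) {δ : ℝ} (hδ : 0 < δ) :
    ∃ C, 1 ≤ C ∧ ∀ (k : ℕ) (z : ℂ) (u v : L2 d), δ ≤ z.re → |z.im| ≤ 1 → z.im ≠ 0 →
      IntegrableOn (fun ξ => singularSymbol γ k z ξ *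
        (𝓕 (weighted w u) ξ * starRingEnd ℂ (𝓕 (weighted w v) ξ)))
        {ξ | ‖ξ‖ ∈ Ioc (z.re - δ / 2) (z.re + δ / 2)} →
      ‖∫ ξ in {ξ | ‖ξ‖ ∈ Ioc (z.re - δ / 2) (z.re + δ / 2)}, singularSymbol γ k z ξ *
        (𝓕 (weighted w u) ξ * starRingEnd ℂ (𝓕 (weighted w v) ξ))‖ ≤
      C ^ (k + 1) * m k * (z.re + 1) ^ (((∑ i, γ i : ℕ) : ℤ) - 1) * (‖u‖ * ‖v‖) := by
  have : Nontrivial (Space d) := by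
    have : Nonempty (Fin d) := ⟨⟨0, by omega⟩⟩
    infer_instance
  have hA := hm.one_le_const
  set n := ∑ i, γ i with hn
  set e := d - 2 + n with he
  have hδ2 : 0 < δ / 2 := by linarith
  obtain ⟨D, hD1, hD⟩ := exists_integral_densityMajorant_le hm hw
    (r := (e : ℝ) / (δ / 2)) (by positivity)
  set c₀ := 4 + 2 / δ with hc₀
  have hc0 : 0 < c₀ := by positivity
  -- The factor 1 + δ⁻¹ comes from the Sobolev inequality on an interval of length δ; `D ^ 2 * A`
  -- pays for its use of the index j + 1.
  set D' := (1 + δ⁻¹) * (D ^ 2 * A) with hD'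
  have hD2 : 1 ≤ D ^ 2 := one_le_pow₀ hD1
  have hδi : 0 < δ⁻¹ := by positivity
  have hDA : 1 ≤ D ^ 2 * A := one_le_mul_of_one_le_of_one_le hD2 hA
  have hD'1 : 1 ≤ D' := one_le_mul_of_one_le_of_one_le (by linarith) hDA
  set Q := cauchyConst δ (δ / 2) with hQ
  have hQ1 : 1 ≤ Q := one_le_cauchyConst hδ.le hδ2
  set P := Q * (4 * A ^ 2 * D' ^ 2) with hP
  have hP1 : 1 ≤ P := by
    refine one_le_mul_of_one_le_of_one_le hQ1 ?_
    nlinarith [one_le_pow₀ (n := 2) hA, one_le_pow₀ (n := 2) hD'1]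
  refine ⟨(1 + c₀) * P, one_le_mul_of_one_le_of_one_le (by linarith) hP1,
    fun k z u v hx hy hy0 hint => ?_⟩
  set a := z.re - δ / 2 with ha
  set b := z.re + δ / 2 with hb
  have hab : a < b := by linarith
  have hba : b - a = δ := by rw [ha, hb]; ring
  have ha0 : 0 < a := by linarith
  set cz := c₀ * (z.re + 1) ^ ((n : ℤ) - 1) with hcz
  have hzp : 0 < (z.re + 1) ^ ((n : ℤ) - 1) := zpow_pos (by linarith) _
  have hcz0 : 0 ≤ cz := by positivity
  set f := weighted w u with hf
  set g := weighted w v with hg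
  set H := densityMajorant ((e : ℝ) / (δ / 2)) f g with hH
  have hHc : ∀ j, Continuous (H j) := fun j => hw.continuous_densityMajorant _ u v j
  have hHint : ∀ j, IntegrableOn (H j) {ξ | ‖ξ‖ ∈ Ioc a b} := fun j => (hD u v j).1.integrableOn
  have hpolH := fun j => setIntegral_annulus (volume : Measure (Space d)) ha0.le hab.le (hHint j)
  rw [finrank_euclideanSpace_fin] at hpolH
  -- `Kj` is the majorant integrated over one ray segment with its Jacobian, and `Nj` below is the
  -- Sobolev bound for the supremum on that segment. Both are integrable in θ.
  set Kj : ℕ → sphere (0 : Space d) 1 → ℝ := fun j θ =>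
    ∫ s in a..b, s ^ (d - 1) • H j (s • (θ : Space d)) with hKj
  have hKint : ∀ j, Integrable (Kj j) (volume : Measure (Space d)).toSphere := fun j => (hpolH j).1
  have hKle : ∀ j, ∫ θ, Kj j θ ∂(volume : Measure (Space d)).toSphere ≤
      ‖u‖ * ‖v‖ * (D ^ (j + 1) * m j) := by
    intro j
    rw [← (hpolH j).2]
    refine le_trans ?_ (hD u v j).2
    exact setIntegral_le_integral (hD u v j).1 (Filter.Eventually.of_forall fun ξ =>
      densityMajorant_nonneg (by positivity) f g j ξ)
  set Nj : ℕ → sphere (0 : Space d) 1 → ℝ := fun j θ =>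
    cz * (δ⁻¹ * Kj j θ + Kj (j + 1) θ) with hNj
  have hNint : ∀ j, Integrable (Nj j) (volume : Measure (Space d)).toSphere := fun j =>
    (((hKint j).const_mul _).add (hKint (j + 1))).const_mul _
  have hNle : ∀ j, ∫ θ, Nj j θ ∂(volume : Measure (Space d)).toSphere ≤
      cz * (‖u‖ * ‖v‖) * (D' ^ (j + 1) * m j) := by
    intro j
    have e1 : ∫ θ, Nj j θ ∂(volume : Measure (Space d)).toSphere =
        cz * (δ⁻¹ * ∫ θ, Kj j θ ∂(volume : Measure (Space d)).toSphere +
          ∫ θ, Kj (j + 1) θ ∂(volume : Measure (Space d)).toSphere) := by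
      rw [hNj]
      simp only
      rw [integral_const_mul, integral_add ((hKint j).const_mul _) (hKint (j + 1)),
        integral_const_mul]
    have h1 := hKle j
    have h2 := hKle (j + 1)
    have hm0 := hm.nonneg j
    have hs := hm.succ_le j
    have huv : 0 ≤ ‖u‖ * ‖v‖ := by positivity
    have h3 : D ^ (j + 1) * m j ≤ (D ^ 2 * A) ^ (j + 1) * m j := by
      refine mul_le_mul_of_nonneg_right (pow_le_pow_left₀ (by linarith) ?_ _) hm0
      nlinarith
    have h4 : D ^ (j + 1 + 1) * m (j + 1) ≤ (D ^ 2 * A) ^ (j + 1) * m j := by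
      calc D ^ (j + 1 + 1) * m (j + 1) ≤ (D ^ 2) ^ (j + 1) * (A ^ (j + 1) * m j) := by
            rw [← pow_mul]
            refine mul_le_mul (pow_le_pow_right₀ hD1 (by omega)) hs (hm.nonneg _) (by positivity)
        _ = _ := by rw [mul_pow]; ring
    have h5 : (1 + δ⁻¹) ≤ (1 + δ⁻¹) ^ (j + 1) := le_self_pow₀ (by linarith) (by omega)
    rw [e1]
    calc _ ≤ cz * (δ⁻¹ * (‖u‖ * ‖v‖ * ((D ^ 2 * A) ^ (j + 1) * m j)) +
          ‖u‖ * ‖v‖ * ((D ^ 2 * A) ^ (j + 1) * m j)) := by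
          refine mul_le_mul_of_nonneg_left (add_le_add ?_ ?_) hcz0
          · exact mul_le_mul_of_nonneg_left (h1.trans (mul_le_mul_of_nonneg_left h3 huv)) hδi.le
          · exact h2.trans (mul_le_mul_of_nonneg_left h4 huv)
      _ = cz * (‖u‖ * ‖v‖) * ((1 + δ⁻¹) * ((D ^ 2 * A) ^ (j + 1) * m j)) := by ring
      _ ≤ cz * (‖u‖ * ‖v‖) * ((1 + δ⁻¹) ^ (j + 1) * ((D ^ 2 * A) ^ (j + 1) * m j)) := by
          gcongr
      _ = _ := by rw [hD', mul_pow (1 + δ⁻¹) (D ^ 2 * A) (j + 1)]; ring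
  have hpol := (setIntegral_annulus (volume : Measure (Space d)) ha0.le hab.le hint).2
  rw [finrank_euclideanSpace_fin] at hpol
  rw [hpol]
  have hray : ∀ θ : sphere (0 : Space d) 1, ∀ j, ∀ s ∈ Icc a b,
      ‖rayDensity e γ f g θ j s‖ ≤ cz * (s ^ (d - 1) * H j (s • (θ : Space d))) := by
    intro θ j s hs
    have hθ : ‖(θ : Space d)‖ = 1 := norm_eq_of_mem_sphere θ
    have hsx : |s - z.re| ≤ δ / 2 := by
      rw [abs_le]
      constructor <;> linarith [hs.1, hs.2]
    have hs0 : 0 < s := ha0.trans_le hs.1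
    have h1 := norm_rayDensity_le (γ := γ) (f := f) (g := g) hθ.le
      (fun i => abs_powSeq_le_of_le e i hδ2 (show δ / 2 ≤ s by linarith [hs.1]))
      (fun i => hw.norm_rayFourier_le_radialMajorant u hθ.le i s)
      (fun i => hw.norm_rayFourier_le_radialMajorant v hθ.le i s) j
    refine h1.trans ?_
    -- The common factor `s ^ e` leaves the Leibniz sum, to be compared with the Jacobian by
    -- `zpow_estimate`.
    have h2 : leibnizSeq (fun i => ((e : ℝ) / (δ / 2)) ^ i * s ^ e)
        (leibnizSeq (fun i => radialMajorant f i (s • (θ : Space d)))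
          (fun i => radialMajorant g i (s • (θ : Space d)))) j = s ^ e * H j (s • (θ : Space d)) := by
      rw [hH, densityMajorant, leibnizSeq, leibnizSeq, Finset.mul_sum]
      refine Finset.sum_congr rfl fun i _ => ?_
      ring
    have h3 := zpow_estimate (d := d) hδ hγ hd hx hsx
    have h4 : 0 ≤ H j (s • (θ : Space d)) := densityMajorant_nonneg (by positivity) f g j _
    calc _ = s ^ e * H j (s • (θ : Space d)) := h2
      _ ≤ (cz * s ^ (d - 1)) * H j (s • (θ : Space d)) := mul_le_mul_of_nonneg_right h3 h4
      _ = _ := by ring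
  have hcont : ∀ (θ : sphere (0 : Space d) 1) j,
      Continuous fun s : ℝ => cz * (s ^ (d - 1) * H j (s • (θ : Space d))) := fun θ j => by
    have := hHc j
    fun_prop
  have hderiv : ∀ (θ : sphere (0 : Space d) 1) j s,
      HasDerivAt (rayDensity e γ f g θ j) (rayDensity e γ f g θ (j + 1) s) s := fun θ j s =>
    hw.hasDerivAt_rayDensity e γ u v (norm_eq_of_mem_sphere θ).le j s
  have hsup : ∀ θ : sphere (0 : Space d) 1, ∀ j, ∀ s ∈ Icc a b,
      ‖rayDensity e γ f g θ j s‖ ≤ Nj j θ := by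
    intro θ j s hs
    have h1 := norm_le_integral_add_integral hab (hderiv θ j)
      (continuous_iff_continuousAt.mpr fun s => (hderiv θ (j + 1) s).continuousAt)
      (hcont θ j) (hcont θ (j + 1)) (hray θ j) (hray θ (j + 1)) hs
    refine h1.trans (le_of_eq ?_)
    rw [intervalIntegral.integral_const_mul, intervalIntegral.integral_const_mul, hba, hNj]
    simp only [hKj, smul_eq_mul]
    ring
  have hinner : ∀ θ : sphere (0 : Space d) 1,
      ‖∫ s in a..b, s ^ (d - 1) • (singularSymbol γ k z (s • (θ : Space d)) *
        (𝓕 f (s • (θ : Space d)) * starRingEnd ℂ (𝓕 g (s • (θ : Space d)))))‖ ≤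
      Q ^ (k + 1) * ∑ j ∈ Finset.range (k + 2), ((k - j)! : ℝ) * Nj j θ := by
    intro θ
    have e1 : ∫ s in a..b, s ^ (d - 1) • (singularSymbol γ k z (s • (θ : Space d)) *
        (𝓕 f (s • (θ : Space d)) * starRingEnd ℂ (𝓕 g (s • (θ : Space d))))) =
        (k ! : ℂ) * ∫ s in a..b, rayDensity e γ f g θ 0 s * ((s : ℂ) - z)⁻¹ ^ (k + 1) := by
      rw [← intervalIntegral.integral_const_mul]
      refine intervalIntegral.integral_congr fun s hs => ?_
      rw [uIcc_of_le hab.le] at hs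
      have hs0 : 0 < s := ha0.trans_le hs.1
      have hθ : ‖(θ : Space d)‖ = 1 := norm_eq_of_mem_sphere θ
      have hn : ‖s • (θ : Space d)‖ = s := by
        rw [norm_smul, hθ, mul_one, Real.norm_of_nonneg hs0.le]
      have h := polar_cauchy_integrand hd γ f g hθ hs0
        ((k ! : ℂ) * ((s : ℂ) - z)⁻¹ ^ (k + 1))
      simp only [singularSymbol]
      rw [hn] at h ⊢
      rw [h]
      ring
    rw [e1]
    -- The segment is centred at Re z, so both endpoints are exactly δ/2 away.
    have h := norm_factorial_mul_integral_le hy0 hy hδ2 (show a + δ / 2 ≤ z.re by linarith)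
      (show z.re + δ / 2 ≤ b by linarith) k (fun j => rayDensity e γ f g θ j) (hderiv θ)
      (fun j => Nj j θ) (hsup θ)
    rwa [hba] at h
  have hNsum : Integrable (fun θ => Q ^ (k + 1) * ∑ j ∈ Finset.range (k + 2),
      ((k - j)! : ℝ) * Nj j θ) (volume : Measure (Space d)).toSphere :=
    (integrable_finsetSum _ fun j _ => (hNint j).const_mul _).const_mul _
  refine (norm_integral_le_of_norm_le hNsum (Filter.Eventually.of_forall hinner)).trans ?_
  rw [integral_const_mul, integral_finsetSum _ fun j _ => (hNint j).const_mul _]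
  simp_rw [integral_const_mul]
  have hN0 : 0 ≤ cz * (‖u‖ * ‖v‖) := by positivity
  have hfin := hm.sum_factorial_le hD'1 hN0 hNle k
  have hmk := hm.nonneg k
  have hmul := mul_pow_succ_le hc0.le (by linarith : 0 ≤ P) k
  calc _ ≤ Q ^ (k + 1) * (cz * (‖u‖ * ‖v‖) * ((4 * A ^ 2 * D' ^ 2) ^ (k + 1) * m k)) := by
        gcongr
    _ = (c₀ * P ^ (k + 1)) * m k * (z.re + 1) ^ ((n : ℤ) - 1) * (‖u‖ * ‖v‖) := by
        rw [hP, mul_pow Q (4 * A ^ 2 * D' ^ 2) (k + 1), hcz]; ring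
    _ ≤ _ := by gcongr

end High

end FreeResolvent

namespace FreeResolvent

open scoped FourierTransform RealInnerProductSpace
open Set Metric

variable {d : ℕ} {w : Space d → ℝ} {m : ℕ → ℝ} {A B : ℝ}

theorem IsRapid.norm_setIntegral_le (hw : IsRapid w m B) {K : Space d → ℂ} {S : Set (Space d)}
    {M : ℝ} (hM0 : 0 ≤ M) (hM : ∀ᵐ ξ ∂(volume.restrict S), ‖K ξ‖ ≤ M) (u v : L2 d) :
    ‖∫ ξ in S, K ξ * (𝓕 (weighted w u) ξ * starRingEnd ℂ (𝓕 (weighted w v) ξ))‖ ≤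
      M * ((B * m 0) ^ 2 * (‖u‖ * ‖v‖)) := by
  refine (norm_setIntegral_mul_mul_conj_le (hw.memLp_fourier_weighted u)
    (hw.memLp_fourier_weighted v) hM0 hM).trans (mul_le_mul_of_nonneg_left ?_ hM0)
  calc _ ≤ (B * m 0 * ‖u‖) * (B * m 0 * ‖v‖) :=
        mul_le_mul (hw.lpNorm_fourier_weighted_le u) (hw.lpNorm_fourier_weighted_le v)
          lpNorm_nonneg (lpNorm_nonneg.trans (hw.lpNorm_fourier_weighted_le u))
    _ = _ := by ring

theorem resolventForm_neg (γ : Fin d → ℕ) (k : ℕ) (z : ℂ) (u v : L2 d) :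
    resolventForm w γ k (-z) u v = (-1) ^ k * resolventForm w γ k z u v := by
  rw [resolventForm, resolventForm, ← integral_const_mul]
  congr 1
  ext ξ
  rw [symbol, symbol, resKer_neg]
  ring

/-! ### Bounds away from zero energy -/

section High

/-- The form splits into the Cauchy part on the annulus, the other partial fraction there, and the
complement. The last two have kernels bounded by C^(k+1) k! (Re z + 1)^(|γ|-1), so Plancherel and k!
≤ A^(k+1) m_k suffice. -/
theorem IsRapid.exists_norm_resolventForm_le_of_le_re (hd : 2 ≤ d) (hm : IsAdmissible m A)
    (hw : IsRapid w m B) {γ : Fin d → ℕ} (hγ : ∑ i, γ i ≤ 2) {δ : ℝ} (hδ : 0 < δ) :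
    ∃ C, 1 ≤ C ∧ ∀ (k : ℕ) (z : ℂ) (u v : L2 d), δ ≤ z.re → |z.im| ≤ 1 → z.im ≠ 0 →
      ‖resolventForm w γ k z u v‖ ≤
      C ^ (k + 1) * m k * (z.re + 1) ^ (((∑ i, γ i : ℕ) : ℤ) - 1) * (‖u‖ * ‖v‖) := by
  obtain ⟨C₁, hC₁, h₁⟩ := exists_pow_mul_norm_resKer_le_far hδ
  obtain ⟨C₂, hC₂, h₂⟩ := exists_pow_mul_norm_resKer_sub_le_near hδ
  obtain ⟨C₃, hC₃, h₃⟩ := exists_norm_setIntegral_singularSymbol_le hd hm hw hγ hδ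
  have hA := hm.one_le_const
  set N := (B * m 0) ^ 2 with hN
  have hN0 : 0 ≤ N := sq_nonneg _
  have hP1 : 0 ≤ (1 + N) * (C₁ * A) := by positivity
  have hP2 : 0 ≤ (1 + N) * (C₂ * A) := by positivity
  refine ⟨(1 + N) * (C₁ * A) + (1 + N) * (C₂ * A) + C₃, by linarith, fun k z u v hx hy hy0 => ?_⟩
  set S := {ξ : Space d | ‖ξ‖ ∈ Ioc (z.re - δ / 2) (z.re + δ / 2)} with hS
  have hSm : MeasurableSet S := measurableSet_annulus _ _
  set n := ∑ i, γ i with hn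
  set q := (z.re + 1) ^ ((n : ℤ) - 1) with hq
  have hq0 : 0 < q := zpow_pos (by linarith) _
  set I : Space d → ℂ := fun ξ => 𝓕 (weighted w u) ξ * starRingEnd ℂ (𝓕 (weighted w v) ξ) with hI
  have hint := hw.integrable_symbol hγ k hy0 u v
  have hnear : ∀ ξ ∈ S, ‖symbol γ k z ξ - singularSymbol γ k z ξ‖ ≤ C₂ ^ (k + 1) * k ! * q := by
    intro ξ hξ
    have hξ' : |‖ξ‖ - z.re| ≤ δ / 2 := by
      rw [abs_le]
      constructor <;> linarith [hξ.1, hξ.2]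
    refine le_trans ?_ (h₂ n hγ k ‖ξ‖ z hx hy0 hξ')
    rw [symbol, singularSymbol, mul_assoc, ← mul_sub, norm_mul]
    exact mul_le_mul_of_nonneg_right (norm_xiPow_le γ ξ) (norm_nonneg _)
  have hfar : ∀ ξ ∈ Sᶜ, ‖symbol γ k z ξ‖ ≤ C₁ ^ (k + 1) * k ! * q := by
    intro ξ hξ
    have hξ' : δ / 2 ≤ |‖ξ‖ - z.re| := by
      by_contra hlt
      obtain ⟨h4, h5⟩ := abs_lt.mp (not_le.mp hlt)
      exact hξ ⟨by linarith, by linarith⟩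
    exact (norm_symbol_le γ k z ξ).trans (h₁ n hγ k ‖ξ‖ z (norm_nonneg _) hx hy hy0 hξ')
  have hnear' : ∀ᵐ ξ ∂(volume.restrict S),
      ‖symbol γ k z ξ - singularSymbol γ k z ξ‖ ≤ C₂ ^ (k + 1) * k ! * q :=
    ae_restrict_of_forall_mem hSm hnear
  have hdiff : IntegrableOn (fun ξ => (symbol γ k z ξ - singularSymbol γ k z ξ) * I ξ) S :=
    integrableOn_mul_mul_conj (hw.memLp_fourier_weighted u) (hw.memLp_fourier_weighted v)
      ((continuous_symbol γ k hy0).aestronglyMeasurable.sub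
        (measurable_singularSymbol γ k z).aestronglyMeasurable) hnear'
  -- Integrability of the singular part is obtained as a difference of the full integrand and the
  -- bounded remainder.
  have hsing : IntegrableOn (fun ξ => singularSymbol γ k z ξ * I ξ) S := by
    refine (hint.integrableOn.sub hdiff).congr (Filter.Eventually.of_forall fun ξ => ?_)
    simp only [Pi.sub_apply, hI]
    ring
  have hsplit : resolventForm w γ k z u v = ((∫ ξ in S, singularSymbol γ k z ξ * I ξ) +
      ∫ ξ in S, (symbol γ k z ξ - singularSymbol γ k z ξ) * I ξ) +
      ∫ ξ in Sᶜ, symbol γ k z ξ * I ξ := by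
    rw [resolventForm, ← integral_add_compl hSm hint, ← integral_add hsing hdiff]
    congr 2
    ext ξ
    ring
  have hb₁ := hw.norm_setIntegral_le (by positivity) (ae_restrict_of_forall_mem hSm.compl hfar) u v
  have hb₂ := hw.norm_setIntegral_le (by positivity) hnear' u v
  have hb₃ := h₃ k z u v hx hy hy0 hsing
  have hk := hm.factorial_le k
  have hmk := hm.nonneg k
  have hX : 0 ≤ ‖u‖ * ‖v‖ := by positivity
  have haux : ∀ {D : ℝ}, 0 ≤ D → D ^ (k + 1) * k ! * q * (N * (‖u‖ * ‖v‖)) ≤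
      ((1 + N) * (D * A)) ^ (k + 1) * (m k * q * (‖u‖ * ‖v‖)) := by
    intro D hD
    calc _ ≤ D ^ (k + 1) * (A ^ (k + 1) * m k) * q * (N * (‖u‖ * ‖v‖)) := by gcongr
      _ = (N * (D * A) ^ (k + 1)) * (m k * q * (‖u‖ * ‖v‖)) := by rw [mul_pow]; ring
      _ ≤ _ := mul_le_mul_of_nonneg_right (mul_pow_succ_le hN0 (by positivity) k) (by positivity)
  have h5 := pow_succ_add_pow_succ_le hP1 hP2 k
  have h6 := pow_succ_add_pow_succ_le (add_nonneg hP1 hP2) (by linarith : 0 ≤ C₃) k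
  rw [hsplit]
  calc _ ≤ C₃ ^ (k + 1) * m k * q * (‖u‖ * ‖v‖) + C₂ ^ (k + 1) * k ! * q * (N * (‖u‖ * ‖v‖)) +
        C₁ ^ (k + 1) * k ! * q * (N * (‖u‖ * ‖v‖)) :=
        (norm_add_le _ _).trans (add_le_add ((norm_add_le _ _).trans (add_le_add hb₃ hb₂)) hb₁)
    _ ≤ C₃ ^ (k + 1) * m k * q * (‖u‖ * ‖v‖) +
        ((1 + N) * (C₂ * A)) ^ (k + 1) * (m k * q * (‖u‖ * ‖v‖)) +
        ((1 + N) * (C₁ * A)) ^ (k + 1) * (m k * q * (‖u‖ * ‖v‖)) := by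
        exact add_le_add (add_le_add le_rfl (haux (D := C₂) (by linarith)))
          (haux (D := C₁) (by linarith))
    _ = ((((1 + N) * (C₁ * A)) ^ (k + 1) + ((1 + N) * (C₂ * A)) ^ (k + 1)) + C₃ ^ (k + 1)) *
        (m k * q * (‖u‖ * ‖v‖)) := by ring
    _ ≤ ((1 + N) * (C₁ * A) + (1 + N) * (C₂ * A) + C₃) ^ (k + 1) * (m k * q * (‖u‖ * ‖v‖)) := by
        refine mul_le_mul_of_nonneg_right ?_ (by positivity)
        linarith
    _ = _ := by ring

/-- The weighted resolvent away from the energy zero. -/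
theorem IsRapid.exists_norm_resolventForm_le_high (hd : 2 ≤ d) (hm : IsAdmissible m A)
    (hw : IsRapid w m B) {γ : Fin d → ℕ} (hγ : ∑ i, γ i ≤ 2) {δ : ℝ} (hδ : 0 < δ) :
    ∃ C, 1 ≤ C ∧ ∀ (k : ℕ) (z : ℂ) (u v : L2 d), δ ≤ |z.re| → |z.im| ≤ 1 → z.im ≠ 0 →
      ‖resolventForm w γ k z u v‖ ≤
      C ^ (k + 1) * m k * (|z.re| + 1) ^ (((∑ i, γ i : ℕ) : ℤ) - 1) * (‖u‖ * ‖v‖) := by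
  obtain ⟨C, hC, h⟩ := hw.exists_norm_resolventForm_le_of_le_re hd hm hγ hδ
  refine ⟨C, hC, fun k z u v hx hy hy0 => ?_⟩
  rcases le_or_gt 0 z.re with h0 | h0
  · rw [abs_of_nonneg h0] at hx ⊢
    exact h k z u v hx hy hy0
  · rw [abs_of_neg h0] at hx ⊢
    -- The symbol depends on z through z², so negative energies reduce to positive ones. The
    -- reflection exchanges the half-planes, which is why the estimates cover both signs of Im z.
    have := h k (-z) u v (by simpa using hx) (by simpa using hy) (by simpa using hy0)
    rw [resolventForm_neg, norm_mul, norm_pow, norm_neg, norm_one, one_pow, one_mul] at this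
    simpa using this

end High

/-! ### Bounds near zero energy in odd dimension -/

section Low

/-- In polar coordinates |ξ|⁻¹ becomes s^(d-2). This is needed because the two partial fractions,
once separated, each carry a factor (2|ξ|)⁻¹ at the origin. -/
theorem integrableOn_inv_norm_mul (hd : 2 ≤ d) {H : Space d → ℂ} (hH : Continuous H) :
    IntegrableOn (fun ξ : Space d => (2 * (‖ξ‖ : ℂ))⁻¹ * H ξ) {ξ | ‖ξ‖ ∈ Ioc (0 : ℝ) 1} := by
  have : Nontrivial (Space d) := by
    have : Nonempty (Fin d) := ⟨⟨0, by omega⟩⟩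
    infer_instance
  obtain ⟨M, hM⟩ := (isCompact_closedBall (0 : Space d) 1).exists_bound_of_continuousOn
    hH.continuousOn
  have h1 : IntegrableOn (fun ξ : Space d => ‖ξ‖⁻¹) (ball 0 2) := by
    rw [integrableOn_fun_norm_addHaar volume (f := fun r : ℝ => r⁻¹)]
    have h2 : IntegrableOn (fun y : ℝ => y ^ (d - 2)) (Ioo 0 2) :=
      (continuous_pow _).integrableOn_Icc.mono_set Ioo_subset_Icc_self
    refine h2.congr_fun (fun y hy => ?_) measurableSet_Ioo
    rw [finrank_euclideanSpace_fin, smul_eq_mul, show d - 1 = d - 2 + 1 by omega, pow_succ,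
      mul_assoc, mul_inv_cancel₀ hy.1.ne', mul_one]
  have hsub : {ξ : Space d | ‖ξ‖ ∈ Ioc (0 : ℝ) 1} ⊆ ball 0 2 := fun ξ hξ => by
    rw [mem_ball_zero_iff]
    linarith [hξ.2]
  refine ((h1.mono_set hsub).const_mul (2⁻¹ * M)).mono' ?_ ?_
  · have h2 : Measurable fun ξ : Space d => (‖ξ‖ : ℂ) :=
      Complex.measurable_ofReal.comp measurable_norm
    have h3 := hH.measurable
    exact Measurable.aestronglyMeasurable (by fun_prop)
  · refine ae_restrict_of_forall_mem (measurableSet_annulus 0 1) fun ξ hξ => ?_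
    rw [norm_mul, norm_inv, norm_mul, Complex.norm_two, Complex.norm_real, norm_norm, mul_inv]
    have h4 := hM ξ (mem_closedBall_zero_iff.mpr hξ.2)
    have h5 : 0 ≤ ‖ξ‖⁻¹ := by positivity
    nlinarith

theorem setIntegral_annulus_comp_neg (h : Space d → ℂ) (a b : ℝ) :
    ∫ ξ in {ξ : Space d | ‖ξ‖ ∈ Ioc a b}, h (-ξ) = ∫ ξ in {ξ | ‖ξ‖ ∈ Ioc a b}, h ξ := by
  rw [← integral_indicator (measurableSet_annulus a b),
    ← integral_indicator (measurableSet_annulus a b),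
    ← integral_neg_eq_self ({ξ : Space d | ‖ξ‖ ∈ Ioc a b}.indicator h)]
  congr 1
  ext ξ
  simp only [indicator, mem_ofPred_eq, norm_neg]

/-- Odd dimension: the part of the weighted resolvent near the origin of the frequency space is a
Cauchy integral over a full neighbourhood of the energy zero. -/
theorem setIntegral_symbol_eq_cauchy (hd : 2 ≤ d) (hodd : Odd d) {γ : Fin d → ℕ} (k : ℕ) {z : ℂ}
    (hz : z.im ≠ 0) {f g : Space d → ℂ} (hf : Continuous (𝓕 f)) (hg : Continuous (𝓕 g))
    (hρ : ∀ θ : Space d, ‖θ‖ = 1 → Continuous (rayDensity (d - 2 + ∑ i, γ i) γ f g θ 0)) :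
    ∫ ξ in {ξ : Space d | ‖ξ‖ ∈ Ioc (0 : ℝ) 1}, symbol γ k z ξ *
        (𝓕 f ξ * starRingEnd ℂ (𝓕 g ξ)) =
      ∫ θ : sphere (0 : Space d) 1, ((k ! : ℂ) * ∫ s in (-1 : ℝ)..1,
        rayDensity (d - 2 + ∑ i, γ i) γ f g (θ : Space d) 0 s * ((s : ℂ) - z)⁻¹ ^ (k + 1))
        ∂(volume : Measure (Space d)).toSphere := by
  have : Nontrivial (Space d) := by
    have : Nonempty (Fin d) := ⟨⟨0, by omega⟩⟩
    infer_instance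
  set S := {ξ : Space d | ‖ξ‖ ∈ Ioc (0 : ℝ) 1} with hS
  have hSm : MeasurableSet S := measurableSet_annulus 0 1
  have hz' : (-z).im ≠ 0 := by simpa using hz
  set κ : ℝ → ℂ := fun s => (k ! : ℂ) * ((s : ℂ) - z)⁻¹ ^ (k + 1) with hκ
  have hκc : Continuous κ := by
    have h1 : Continuous fun s : ℝ => ((s : ℂ) - z)⁻¹ :=
      Continuous.inv₀ (by fun_prop) fun s => ofReal_sub_ne_zero hz s
    fun_prop
  set h₁ : Space d → ℂ := fun ξ => xiPow γ ξ * (2 * (‖ξ‖ : ℂ))⁻¹ * κ ‖ξ‖ *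
    (𝓕 f ξ * starRingEnd ℂ (𝓕 g ξ)) with hh₁
  set h₂ : Space d → ℂ := fun ξ => -(xiPow γ ξ * (2 * (‖ξ‖ : ℂ))⁻¹ * κ (-‖ξ‖) *
    (𝓕 f ξ * starRingEnd ℂ (𝓕 g ξ))) with hh₂
  have hx := continuous_xiPow γ
  have hi₁ : IntegrableOn h₁ S := by
    refine (integrableOn_inv_norm_mul hd (H := fun ξ => xiPow γ ξ * κ ‖ξ‖ *
      (𝓕 f ξ * starRingEnd ℂ (𝓕 g ξ))) (by fun_prop)).congr
      (Filter.Eventually.of_forall fun ξ => ?_)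
    simp only [hh₁]
    ring
  have hi₂ : IntegrableOn h₂ S := by
    refine (integrableOn_inv_norm_mul hd (H := fun ξ => -(xiPow γ ξ * κ (-‖ξ‖) *
      (𝓕 f ξ * starRingEnd ℂ (𝓕 g ξ)))) (by fun_prop)).congr
      (Filter.Eventually.of_forall fun ξ => ?_)
    simp only [hh₂]
    ring
  have hi₃ : IntegrableOn (fun ξ => h₂ (-ξ)) S := by
    refine (integrableOn_inv_norm_mul hd (H := fun ξ => -(xiPow γ (-ξ) * κ (-‖ξ‖) *
      (𝓕 f (-ξ) * starRingEnd ℂ (𝓕 g (-ξ))))) (by fun_prop)).congr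
      (Filter.Eventually.of_forall fun ξ => ?_)
    simp only [hh₂, norm_neg]
    ring
  -- The second partial fraction is reflected through the origin, so that on the ray of θ it will
  -- describe the segment from -1 to 0.
  have hsplit : ∫ ξ in S, symbol γ k z ξ * (𝓕 f ξ * starRingEnd ℂ (𝓕 g ξ)) =
      (∫ ξ in S, h₁ ξ) + ∫ ξ in S, h₂ (-ξ) := by
    rw [setIntegral_annulus_comp_neg h₂, ← integral_add hi₁ hi₂]
    refine setIntegral_congr_fun hSm fun ξ hξ => ?_
    have hn : (‖ξ‖ : ℂ) ≠ 0 := by exact_mod_cast hξ.1.ne'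
    have h := two_mul_resKer k ‖ξ‖ hz
    have h' : resKer k ‖ξ‖ z = (2 * (‖ξ‖ : ℂ))⁻¹ * (κ ‖ξ‖ - κ (-‖ξ‖)) := by
      rw [eq_inv_mul_iff_mul_eq₀ (by simpa using hn), h]
      simp [hκ]
    simp only [symbol, hh₁, hh₂, h']
    ring
  have hp₁ := setIntegral_annulus (volume : Measure (Space d)) le_rfl zero_le_one hi₁
  have hp₂ := setIntegral_annulus (volume : Measure (Space d)) le_rfl zero_le_one hi₃
  rw [hsplit, hp₁.2, hp₂.2, ← integral_add hp₁.1 hp₂.1]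
  refine integral_congr_ae (Filter.Eventually.of_forall fun θ => ?_)
  have hθ : ‖(θ : Space d)‖ = 1 := norm_eq_of_mem_sphere θ
  simp only [finrank_euclideanSpace_fin]
  set ρ := rayDensity (d - 2 + ∑ i, γ i) γ f g (θ : Space d) 0 with hρd
  have hρc : Continuous ρ := hρ θ hθ
  have e₁ : ∫ s in (0 : ℝ)..1, s ^ (d - 1) • h₁ (s • (θ : Space d)) =
      ∫ s in (0 : ℝ)..1, κ s * ρ s := by
    refine intervalIntegral.integral_congr_uIoo fun s hs => ?_
    rw [uIoo_of_le zero_le_one] at hs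
    have hn : ‖s • (θ : Space d)‖ = s := by
      rw [norm_smul, hθ, mul_one, Real.norm_of_nonneg hs.1.le]
    have h := polar_cauchy_integrand hd γ f g hθ hs.1 (κ s)
    simp only [hh₁]
    rw [hn] at h ⊢
    exact h
  -- Here oddness of d enters: the integrand becomes the same function κρ at -s.
  have e₂ : ∫ s in (0 : ℝ)..1, s ^ (d - 1) • h₂ (-(s • (θ : Space d))) =
      ∫ s in (-1 : ℝ)..0, κ s * ρ s := by
    have : ∫ s in (0 : ℝ)..1, s ^ (d - 1) • h₂ (-(s • (θ : Space d))) =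
        ∫ s in (0 : ℝ)..1, (fun t => κ t * ρ t) (-s) := by
      refine intervalIntegral.integral_congr_uIoo fun s hs => ?_
      rw [uIoo_of_le zero_le_one] at hs
      have hn : ‖s • (θ : Space d)‖ = s := by
        rw [norm_smul, hθ, mul_one, Real.norm_of_nonneg hs.1.le]
      have h := polar_cauchy_integrand_neg hd hodd γ f g hθ hs.1 (κ (-s))
      simp only [hh₂, norm_neg]
      rw [hn] at h ⊢
      exact h
    rw [this, intervalIntegral.integral_comp_neg fun t => κ t * ρ t, neg_zero]
  have hc : Continuous fun s => κ s * ρ s := hκc.mul hρc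
  rw [e₁, e₂, add_comm, intervalIntegral.integral_add_adjacent_intervals
    (hc.intervalIntegrable _ _) (hc.intervalIntegrable _ _), ← intervalIntegral.integral_const_mul]
  congr 1
  ext s
  simp only [hκ]
  ring

/-- The weighted resolvent at low energies, in odd dimension. -/
theorem IsRapid.exists_norm_resolventForm_le_low (hd : 2 ≤ d) (hodd : Odd d)
    (hm : IsAdmissible m A) (hw : IsRapid w m B) {γ : Fin d → ℕ} (hγ : ∑ i, γ i ≤ 2) :
    ∃ C, 1 ≤ C ∧ ∀ (k : ℕ) (z : ℂ) (u v : L2 d), |z.re| ≤ 1 / 2 → |z.im| ≤ 1 → z.im ≠ 0 →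
      ‖resolventForm w γ k z u v‖ ≤ C ^ (k + 1) * m k * (‖u‖ * ‖v‖) := by
  have hA := hm.one_le_const
  have hB := hw.one_le_const
  have hπ := Real.pi_gt_three
  set e := d - 2 + ∑ i, γ i with he
  set N := (B * m 0) ^ 2 with hN
  have hN0 : 0 ≤ N := sq_nonneg _
  set B₁ := 2 * Real.pi * B with hB₁
  have hB1 : 1 ≤ B₁ := one_le_mul_of_one_le_of_one_le (by linarith) hB
  set B₂ := 2 * A * B₁ ^ 2 + e with hB₂
  have he0 : (0 : ℝ) ≤ e := Nat.cast_nonneg e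
  have hB2 : 1 ≤ B₂ := by nlinarith [one_le_pow₀ (n := 2) hB1]
  set B₃ := 2 * A * B₂ ^ 2 with hB₃
  have hB3 : 1 ≤ B₃ := by nlinarith [one_le_pow₀ (n := 2) hB2]
  -- The interval (-1, 1) has length 2, and |Re z| ≤ 1/2 leaves a margin 1/2 at both ends.
  set Q := cauchyConst 2 (1 / 2) with hQ
  have hQ1 : 1 ≤ Q := one_le_cauchyConst (by norm_num) (by norm_num)
  set P := Q * (4 * A ^ 2 * B₃ ^ 2) with hP
  have hP1 : 1 ≤ P := one_le_mul_of_one_le_of_one_le hQ1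
    (by nlinarith [one_le_pow₀ (n := 2) hA, one_le_pow₀ (n := 2) hB3])
  set σ := (volume : Measure (Space d)).toSphere.real univ with hσ
  have hσ0 : 0 ≤ σ := measureReal_nonneg
  set L := σ * momentConst d ^ 2 with hL
  have hL0 : 0 ≤ L := by positivity
  refine ⟨(1 + N) * (16 * A) + (1 + L) * P, ?_, fun k z u v hx hy hy0 => ?_⟩
  · nlinarith [mul_nonneg hN0 (by linarith : 0 ≤ A), mul_nonneg hL0 (by linarith : 0 ≤ P)]
  set S := {ξ : Space d | ‖ξ‖ ∈ Ioc (0 : ℝ) 1} with hS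
  have hSm : MeasurableSet S := measurableSet_annulus 0 1
  set f := weighted w u with hf
  set g := weighted w v with hg
  have hint := hw.integrable_symbol hγ k hy0 u v
  have hmk := hm.nonneg k
  have hX : 0 ≤ ‖u‖ * ‖v‖ := by positivity
  have hfar : ∀ᵐ ξ ∂(volume.restrict Sᶜ), ‖symbol γ k z ξ‖ ≤ 16 ^ (k + 1) * k ! := by
    have : Nontrivial (Space d) := by
      have : Nonempty (Fin d) := ⟨⟨0, by omega⟩⟩
      infer_instance
    -- The origin lies outside the annulus without satisfying 1 < |ξ|; it is a null set.
    have h0 : ∀ᵐ ξ : Space d, ξ ≠ 0 := by simp [ae_iff]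
    rw [ae_restrict_iff' hSm.compl]
    filter_upwards [h0] with ξ hξ0 hξ
    have hlt : 1 < ‖ξ‖ := by
      by_contra hle
      exact hξ ⟨norm_pos_iff.mpr hξ0, not_lt.mp hle⟩
    exact (norm_symbol_le γ k z ξ).trans (pow_mul_norm_resKer_le_of_one_lt hγ k hlt hx)
  have hb₁ := hw.norm_setIntegral_le (by positivity) hfar u v
  have hderiv : ∀ (θ : Space d), ‖θ‖ ≤ 1 → ∀ j s,
      HasDerivAt (rayDensity e γ f g θ j) (rayDensity e γ f g θ (j + 1) s) s := fun θ hθ j s =>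
    hw.hasDerivAt_rayDensity e γ u v hθ j s
  have hM0 := momentConst_nonneg d
  set U : ℕ → ℝ := fun i => momentConst d * ‖u‖ * (B₁ ^ (i + 1) * m i) with hU
  set V : ℕ → ℝ := fun i => momentConst d * ‖v‖ * (B₁ ^ (i + 1) * m i) with hV
  have hU0 : ∀ i, 0 ≤ U i := fun i => by
    have := hm.nonneg i
    positivity
  have hV0 : ∀ i, 0 ≤ V i := fun i => by
    have := hm.nonneg i
    positivity
  have hUV := fun i => hm.leibnizSeq_le hB1 hU0 hV0 (fun _ => le_rfl) (fun _ => le_rfl)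
    (by positivity : 0 ≤ momentConst d * ‖u‖) (by positivity : 0 ≤ momentConst d * ‖v‖) i
  set N' : ℝ := momentConst d * ‖u‖ * (momentConst d * ‖v‖) with hN'
  have hN'0 : 0 ≤ N' := by positivity
  have hRUV : ∀ j, leibnizSeq (fun i => (e : ℝ) ^ i) (leibnizSeq U V) j ≤
      N' * (B₃ ^ (j + 1) * m j) := by
    intro j
    have h := hm.leibnizSeq_le hB2 (a := fun i => (e : ℝ) ^ i) (b := leibnizSeq U V) (N := 1)
      (N' := N') (fun i => by positivity) (fun i => leibnizSeq_nonneg hU0 hV0 i) (fun i => ?_)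
      (fun i => (hUV i).trans ?_) zero_le_one hN'0 j
    · rwa [one_mul] at h
    · rw [one_mul]
      have heB : (e : ℝ) ≤ B₂ := by
        have : 0 ≤ 2 * A * B₁ ^ 2 := by positivity
        linarith
      calc (e : ℝ) ^ i ≤ B₂ ^ i := pow_le_pow_left₀ he0 heB i
        _ ≤ B₂ ^ (i + 1) := pow_le_pow_right₀ hB2 (by omega)
        _ ≤ _ := le_mul_of_one_le_right (by positivity) (hm.one_le i)
    · have := hm.nonneg i
      have h4 : (2 * A * B₁ ^ 2) ^ (i + 1) ≤ B₂ ^ (i + 1) :=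
        pow_le_pow_left₀ (by positivity) (by linarith) _
      gcongr
  have hsup : ∀ θ : sphere (0 : Space d) 1, ∀ j, ∀ s ∈ Icc (-1 : ℝ) 1,
      ‖rayDensity e γ f g (θ : Space d) j s‖ ≤ N' * (B₃ ^ (j + 1) * m j) := by
    intro θ j s hs
    have hθ := (norm_eq_of_mem_sphere θ).le
    exact (norm_rayDensity_le hθ (fun i => abs_powSeq_le_of_abs_le_one e i (abs_le.mpr hs))
      (fun i => hw.norm_rayFourier_le u hθ i s) (fun i => hw.norm_rayFourier_le v hθ i s) j).trans
      (hRUV j)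
  have hsum := hm.sum_factorial_le hB3 hN'0 (fun j => le_refl (N' * (B₃ ^ (j + 1) * m j))) k
  have hinner : ∀ θ : sphere (0 : Space d) 1, ‖(k ! : ℂ) * ∫ s in (-1 : ℝ)..1,
      rayDensity e γ f g (θ : Space d) 0 s * ((s : ℂ) - z)⁻¹ ^ (k + 1)‖ ≤
      N' * (P ^ (k + 1) * m k) := by
    intro θ
    obtain ⟨hx1, hx2⟩ := abs_le.mp hx
    have h := norm_factorial_mul_integral_le hy0 hy (a := -1) (b := 1) (w := 1 / 2) (by norm_num)
      (by linarith) (by linarith) k (fun j => rayDensity e γ f g (θ : Space d) j)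
      (hderiv θ (norm_eq_of_mem_sphere θ).le) (fun j => N' * (B₃ ^ (j + 1) * m j)) (hsup θ)
    rw [show (1 : ℝ) - -1 = 2 by norm_num] at h
    refine h.trans ?_
    calc _ ≤ Q ^ (k + 1) * (N' * ((4 * A ^ 2 * B₃ ^ 2) ^ (k + 1) * m k)) := by gcongr
      _ = _ := by rw [hP, mul_pow Q (4 * A ^ 2 * B₃ ^ 2) (k + 1)]; ring
  have hb₂ : ‖∫ ξ in S, symbol γ k z ξ * (𝓕 f ξ * starRingEnd ℂ (𝓕 g ξ))‖ ≤
      N' * (P ^ (k + 1) * m k) * σ := by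
    rw [setIntegral_symbol_eq_cauchy hd hodd k hy0 (hw.continuous_fourier_weighted u)
      (hw.continuous_fourier_weighted v) fun θ hθ => ?_]
    · exact norm_integral_le_of_norm_le_const (Filter.Eventually.of_forall hinner)
    · exact continuous_iff_continuousAt.mpr fun s => (hderiv θ hθ.le 0 s).continuousAt
  have hk := hm.factorial_le k
  rw [resolventForm, ← integral_add_compl hSm hint]
  have h1 := mul_pow_succ_le hN0 (by positivity : 0 ≤ 16 * A) k
  have h2 := mul_pow_succ_le hL0 (by positivity : 0 ≤ P) k
  have h3 := pow_succ_add_pow_succ_le (by positivity : 0 ≤ (1 + N) * (16 * A))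
    (by positivity : 0 ≤ (1 + L) * P) k
  calc _ ≤ N' * (P ^ (k + 1) * m k) * σ + 16 ^ (k + 1) * k ! * (N * (‖u‖ * ‖v‖)) :=
        (norm_add_le _ _).trans (add_le_add hb₂ hb₁)
    _ ≤ N' * (P ^ (k + 1) * m k) * σ + 16 ^ (k + 1) * (A ^ (k + 1) * m k) * (N * (‖u‖ * ‖v‖)) := by
        gcongr
    _ = (N * (16 * A) ^ (k + 1) + L * P ^ (k + 1)) * (m k * (‖u‖ * ‖v‖)) := by
        rw [mul_pow 16 A, hN', hL]; ring
    _ ≤ ((1 + N) * (16 * A) + (1 + L) * P) ^ (k + 1) * (m k * (‖u‖ * ‖v‖)) := by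
        refine mul_le_mul_of_nonneg_right ?_ (by positivity)
        linarith
    _ = _ := by ring

end Low

end FreeResolvent

namespace FreeResolvent

open scoped FourierTransform RealInnerProductSpace
open Set Metric

/-! ### The weight √Θ(c⟨x⟩) has controlled moments -/

section Weight

variable {Θ : ℝ → ℝ} {m : ℕ → ℝ} {A : ℝ}

theorem IsAdmissible.exists_shift_le (hm : IsAdmissible m A) (n : ℕ) :
    ∃ D, 1 ≤ D ∧ ∀ j, m (j + n) ≤ D ^ (j + 1) * m j := by
  have hA := hm.one_le_const
  induction n with
  | zero => exact ⟨1, le_rfl, fun j => by simp⟩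
  | succ n ih =>
    obtain ⟨D, hD1, hD⟩ := ih
    refine ⟨A ^ (n + 1) * D, one_le_mul_of_one_le_of_one_le (one_le_pow₀ hA) hD1, fun j => ?_⟩
    have hmj := hm.nonneg j
    have h1 : A ^ (j + n + 1) ≤ (A ^ (n + 1)) ^ (j + 1) := by
      rw [← pow_mul]
      exact pow_le_pow_right₀ hA (by nlinarith)
    calc m (j + (n + 1)) ≤ A ^ (j + n + 1) * m (j + n) := hm.succ_le (j + n)
      _ ≤ (A ^ (n + 1)) ^ (j + 1) * (D ^ (j + 1) * m j) :=
        mul_le_mul h1 (hD j) (hm.nonneg _) (by positivity)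
      _ = _ := by rw [mul_pow]; ring

theorem IsWeightProfile.le_tildeM (hΘ : IsWeightProfile Θ) (k : ℕ) {r : ℝ} (hr : 0 ≤ r) :
    (r + 1) ^ k * √(Θ r) ≤ tildeM Θ k := by
  refine le_ciSup (f := fun r : Ici (0 : ℝ) => ((r : ℝ) + 1) ^ k * √(Θ r)) ?_ ⟨r, hr⟩
  obtain ⟨C, hC⟩ := hΘ.rapid_decay (2 * k)
  refine ⟨√C, ?_⟩
  rintro _ ⟨⟨s, hs⟩, rfl⟩
  have hs0 : (0 : ℝ) ≤ s := hs
  refine Real.le_sqrt_of_sq_le ?_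
  rw [mul_pow, Real.sq_sqrt (hΘ.pos s hs0).le, ← pow_mul, mul_comm k 2]
  exact hC s hs0

variable {d : ℕ} {c : ℝ}

theorem continuous_weight (hΘ : IsWeightProfile Θ) (hc : 0 < c) : Continuous (weight d Θ c) := by
  refine Real.continuous_sqrt.comp ?_
  refine hΘ.contDiffOn.continuousOn.comp_continuous (by fun_prop) fun y => ?_
  exact mul_nonneg hc.le (Real.sqrt_nonneg _)

theorem weight_pos (hΘ : IsWeightProfile Θ) (hc : 0 < c) (y : EuclideanSpace ℝ (Fin d)) :
    0 < weight d Θ c y :=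
  Real.sqrt_pos.mpr (hΘ.pos _ (mul_nonneg hc.le (Real.sqrt_nonneg _)))

/-- Since 1 + |y| is at most a constant times c⟨y⟩ + 1, moments of the weight are bounded by
`tildeM`. The reserve of d + 1 powers shifts the index, and `exists_shift_le` brings it back to m j
at geometric cost. -/
theorem exists_isRapid_weight (hΘ : IsWeightProfile Θ) (hc : 0 < c) (hm : IsAdmissible m A)
    (hA : ∀ k, tildeM Θ k ≤ A ^ (k + 1) * m k) : ∃ B, IsRapid (weight d Θ c) m B := by
  have hA1 := hm.one_le_const
  obtain ⟨D, hD1, hD⟩ := hm.exists_shift_le (d + 1)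
  set K := 1 + 2 / c with hK
  have hc2 : 0 < 2 / c := by positivity
  have hK1 : 1 ≤ K := by linarith
  refine ⟨K ^ (d + 2) * (A ^ (d + 2) * D), continuous_weight hΘ hc, fun y => Real.sqrt_nonneg _,
    one_le_mul_of_one_le_of_one_le (one_le_pow₀ hK1)
      (one_le_mul_of_one_le_of_one_le (one_le_pow₀ hA1) hD1), fun j y => ?_⟩
  set r := c * √(1 + ‖y‖ ^ 2) with hr
  have hr0 : 0 ≤ r := mul_nonneg hc.le (Real.sqrt_nonneg _)
  have hy : 1 + ‖y‖ ≤ K * (r + 1) := by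
    have h1 : (1 : ℝ) ≤ √(1 + ‖y‖ ^ 2) := Real.le_sqrt_of_sq_le (by nlinarith [sq_nonneg ‖y‖])
    have h2 : ‖y‖ ≤ √(1 + ‖y‖ ^ 2) := Real.le_sqrt_of_sq_le (by linarith)
    have h3 : 2 / c * r = 2 * √(1 + ‖y‖ ^ 2) := by
      rw [hr]
      field_simp
    calc 1 + ‖y‖ ≤ 2 / c * r := by rw [h3]; linarith
      _ ≤ K * (r + 1) := by nlinarith
  have hmj := hm.nonneg j
  have hw0 : 0 ≤ weight d Θ c y := Real.sqrt_nonneg _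
  have e1 : K ^ (j + (d + 1)) ≤ (K ^ (d + 2)) ^ (j + 1) := by
    rw [← pow_mul]
    exact pow_le_pow_right₀ hK1 (by nlinarith)
  have e2 : A ^ (j + (d + 1) + 1) ≤ (A ^ (d + 2)) ^ (j + 1) := by
    rw [← pow_mul]
    exact pow_le_pow_right₀ hA1 (by nlinarith)
  have h4 : (r + 1) ^ (j + (d + 1)) * weight d Θ c y ≤
      (A ^ (d + 2)) ^ (j + 1) * (D ^ (j + 1) * m j) :=
    (hΘ.le_tildeM (j + (d + 1)) hr0).trans ((hA _).trans
      (mul_le_mul e2 (hD j) (hm.nonneg _) (by positivity)))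
  calc (1 + ‖y‖) ^ (d + 1) * (‖y‖ ^ j * weight d Θ c y)
      ≤ (1 + ‖y‖) ^ (d + 1) * ((1 + ‖y‖) ^ j * weight d Θ c y) := by
        gcongr
        linarith
    _ = (1 + ‖y‖) ^ (j + (d + 1)) * weight d Θ c y := by ring
    _ ≤ (K * (r + 1)) ^ (j + (d + 1)) * weight d Θ c y := by gcongr
    _ = K ^ (j + (d + 1)) * ((r + 1) ^ (j + (d + 1)) * weight d Θ c y) := by rw [mul_pow]; ring
    _ ≤ (K ^ (d + 2)) ^ (j + 1) * ((A ^ (d + 2)) ^ (j + 1) * (D ^ (j + 1) * m j)) :=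
        mul_le_mul e1 h4 (by positivity) (by positivity)
    _ = _ := by rw [mul_pow, mul_pow]; ring

end Weight

/-! ### The weighted operators as bounded multipliers -/

section Operators

variable {d : ℕ} {w : Space d → ℝ} {m : ℕ → ℝ} {A B : ℝ}

/-- The essentially bounded functions. -/
abbrev LInf (d : ℕ) : Type := Lp ℂ ⊤ (volume : Measure (Space d))

/-- Multiplication by an essentially bounded function, as a bounded operator on `L²`. -/
noncomputable def mulCLM (d : ℕ) : LInf d →L[ℂ] L2 d →L[ℂ] L2 d :=
  (ContinuousLinearMap.mul ℂ ℂ).holderL volume ⊤ 2 2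

theorem coeFn_mulCLM (K : LInf d) (u : L2 d) :
    (mulCLM d K u : Space d → ℂ) =ᵐ[volume] fun x => K x * u x :=
  (ContinuousLinearMap.mul ℂ ℂ).coeFn_holder K u

theorem norm_LInf_le {K : LInf d} {M : ℝ} (hM0 : 0 ≤ M) (hM : ∀ᵐ x, ‖K x‖ ≤ M) : ‖K‖ ≤ M := by
  rw [Lp.norm_def, eLpNorm_exponent_top]
  exact ENNReal.toReal_le_of_le_ofReal hM0 (eLpNormEssSup_le_of_ae_bound hM)

theorem IsRapid.memLp_top (hw : IsRapid w m B) : MemLp (fun y => (w y : ℂ)) ⊤ volume :=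
  memLp_top_of_bound (Complex.continuous_ofReal.comp hw.continuous).aestronglyMeasurable
    (B ^ (0 + 1) * m 0) (Filter.Eventually.of_forall fun y => by
      rw [Complex.norm_real, Real.norm_of_nonneg (hw.nonneg y)]
      simpa using hw.le 0 y)

/-- Multiplication by the weight. -/
noncomputable def weightCLM (hw : IsRapid w m B) : L2 d →L[ℂ] L2 d :=
  mulCLM d hw.memLp_top.toLp

theorem coeFn_weightCLM (hw : IsRapid w m B) (u : L2 d) :
    (weightCLM hw u : Space d → ℂ) =ᵐ[volume] weighted w u := by
  filter_upwards [coeFn_mulCLM hw.memLp_top.toLp u, hw.memLp_top.coeFn_toLp] with x h1 h2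
  rw [weightCLM, h1, h2, weighted]

theorem weightCLM_eq_toLp (hw : IsRapid w m B) (u : L2 d) :
    weightCLM hw u = (hw.memLp_weighted u).toLp :=
  Lp.ext ((coeFn_weightCLM hw u).trans (hw.memLp_weighted u).coeFn_toLp.symm)

theorem coeFn_fourier_weightCLM (hw : IsRapid w m B) (u : L2 d) :
    (𝓕 (weightCLM hw u) : L2 d) =ᵐ[volume] 𝓕 (weighted w u) := by
  rw [weightCLM_eq_toLp]
  exact fourier_toLp_ae_eq (hw.integrable_weighted u) (hw.memLp_weighted u)

theorem inner_weightCLM (hw : IsRapid w m B) (u v : L2 d) :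
    inner ℂ v (weightCLM hw u) = inner ℂ (weightCLM hw v) u := by
  rw [L2.inner_def, L2.inner_def]
  refine integral_congr_ae ?_
  filter_upwards [coeFn_weightCLM hw u, coeFn_weightCLM hw v] with x h1 h2
  rw [h1, h2, weighted, weighted, RCLike.inner_apply, RCLike.inner_apply, map_mul,
    Complex.conj_ofReal]
  ring

theorem inner_fourierInv (f g : L2 d) : inner ℂ f (𝓕⁻ g : L2 d) = inner ℂ (𝓕 f : L2 d) g := by
  rw [← Lp.inner_fourier_eq, FourierTransform.fourier_fourierInv_eq]

/-- The operator `w F⁻¹ K F w` for an essentially bounded function `K`. -/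
noncomputable def sandwich (hw : IsRapid w m B) : LInf d →L[ℂ] L2 d →L[ℂ] L2 d :=
  (ContinuousLinearMap.compL ℂ (L2 d) (L2 d) (L2 d)
    (weightCLM hw ∘L FourierTransform.fourierInvCLM ℂ (L2 d))) ∘L
  (((ContinuousLinearMap.compL ℂ (L2 d) (L2 d) (L2 d)).flip
    (FourierTransform.fourierCLM ℂ (L2 d) ∘L weightCLM hw)) ∘L mulCLM d)

theorem sandwich_apply (hw : IsRapid w m B) (K : LInf d) (u : L2 d) :
    sandwich hw K u = weightCLM hw (𝓕⁻ (mulCLM d K (𝓕 (weightCLM hw u) : L2 d)) : L2 d) := rfl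

theorem memLp_top_symbol {γ : Fin d → ℕ} (hγ : ∑ i, γ i ≤ 2) (k : ℕ) {z : ℂ} (hz : z.im ≠ 0) :
    MemLp (symbol γ k z) ⊤ volume := by
  obtain ⟨M, hM⟩ := exists_norm_symbol_le hγ k (abs_pos.mpr hz) ‖z‖
  exact memLp_top_of_bound (continuous_symbol γ k hz).aestronglyMeasurable M
    (Filter.Eventually.of_forall (hM z le_rfl le_rfl))

open Classical in
/-- The symbol as an essentially bounded function. -/
noncomputable def symbolLp (γ : Fin d → ℕ) (k : ℕ) (z : ℂ) : LInf d :=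
  if h : MemLp (symbol γ k z) ⊤ volume then h.toLp else 0

theorem coeFn_symbolLp {γ : Fin d → ℕ} (hγ : ∑ i, γ i ≤ 2) (k : ℕ) {z : ℂ} (hz : z.im ≠ 0) :
    (symbolLp γ k z : Space d → ℂ) =ᵐ[volume] symbol γ k z := by
  rw [symbolLp, dif_pos (memLp_top_symbol hγ k hz)]
  exact MemLp.coeFn_toLp _

theorem hasDerivAt_symbol (γ : Fin d → ℕ) (k : ℕ) (ξ : Space d) {z : ℂ} (hz : z.im ≠ 0) :
    HasDerivAt (fun t => symbol γ k t ξ) (symbol γ (k + 1) z ξ) z :=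
  (hasDerivAt_resKer k ‖ξ‖ hz).const_mul _

/-- The mean value inequality is used twice, on a disc where |Im| stays at least |Im z|/2. The bound
on the derivative of order k + 2 is uniform in ξ, so the quadratic remainder is a remainder in L^∞.
-/
theorem exists_symbol_taylor {γ : Fin d → ℕ} (hγ : ∑ i, γ i ≤ 2) (k : ℕ) {z : ℂ}
    (hz : z.im ≠ 0) : ∃ M, 0 ≤ M ∧ ∀ z' ∈ ball z (|z.im| / 2), z'.im ≠ 0 ∧ ∀ ξ : Space d,
      ‖symbol γ k z' ξ - symbol γ k z ξ - (z' - z) * symbol γ (k + 1) z ξ‖ ≤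
        M * ‖z' - z‖ ^ 2 := by
  have hz2 : 0 < |z.im| := abs_pos.mpr hz
  obtain ⟨M, hM⟩ := exists_norm_symbol_le (d := d) hγ (k + 2) (half_pos hz2) (‖z‖ + |z.im| / 2)
  have hball : ∀ t ∈ ball z (|z.im| / 2), |z.im| / 2 ≤ |t.im| ∧ ‖t‖ ≤ ‖z‖ + |z.im| / 2 := by
    intro t ht
    rw [mem_ball, dist_eq_norm] at ht
    have h1 : |t.im - z.im| ≤ ‖t - z‖ := by simpa using Complex.abs_im_le_norm (t - z)
    have h2 : |z.im| ≤ |t.im| + |t.im - z.im| := by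
      have := abs_sub_abs_le_abs_sub z.im t.im
      rw [abs_sub_comm z.im] at this
      linarith
    have h3 : ‖t‖ ≤ ‖z‖ + ‖t - z‖ := by simpa using norm_add_le z (t - z)
    constructor <;> linarith
  have him : ∀ t ∈ ball z (|z.im| / 2), t.im ≠ 0 := fun t ht => by
    have := (hball t ht).1
    exact abs_pos.mp (by linarith)
  have hbd : ∀ t ∈ ball z (|z.im| / 2), ∀ ξ : Space d, ‖symbol γ (k + 2) t ξ‖ ≤ M := fun t ht ξ =>
    hM t (hball t ht).1 (hball t ht).2 ξ
  have hM0 : 0 ≤ M := (norm_nonneg _).trans (hbd z (mem_ball_self (half_pos hz2)) 0)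
  refine ⟨M, hM0, fun z' hz' => ⟨him z' hz', fun ξ => ?_⟩⟩
  have hsub : closedBall z ‖z' - z‖ ⊆ ball z (|z.im| / 2) :=
    closedBall_subset_ball (by simpa [dist_eq_norm] using hz')
  have hzc : z ∈ closedBall z ‖z' - z‖ := mem_closedBall_self (norm_nonneg _)
  have hzc' : z' ∈ closedBall z ‖z' - z‖ := by simp [dist_eq_norm]
  have h1 : ∀ t ∈ closedBall z ‖z' - z‖, ‖symbol γ (k + 1) t ξ - symbol γ (k + 1) z ξ‖ ≤
      M * ‖z' - z‖ := fun t ht => by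
    have h := (convex_closedBall z ‖z' - z‖).norm_image_sub_le_of_norm_hasDerivWithin_le
      (f := fun t => symbol γ (k + 1) t ξ) (f' := fun t => symbol γ (k + 2) t ξ) (C := M)
      (fun t ht => (hasDerivAt_symbol γ (k + 1) ξ (him t (hsub ht))).hasDerivWithinAt)
      (fun t ht => hbd t (hsub ht) ξ) hzc ht
    refine h.trans (mul_le_mul_of_nonneg_left ?_ hM0)
    simpa [dist_eq_norm] using ht
  have h := (convex_closedBall z ‖z' - z‖).norm_image_sub_le_of_norm_hasDerivWithin_le
    (f := fun t => symbol γ k t ξ - t * symbol γ (k + 1) z ξ)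
    (f' := fun t => symbol γ (k + 1) t ξ - 1 * symbol γ (k + 1) z ξ) (C := M * ‖z' - z‖)
    (fun t ht => ((hasDerivAt_symbol γ k ξ (him t (hsub ht))).sub
      ((hasDerivAt_id t).mul_const _)).hasDerivWithinAt)
    (fun t ht => by rw [one_mul]; exact h1 t ht) hzc hzc'
  calc _ = ‖symbol γ k z' ξ - z' * symbol γ (k + 1) z ξ -
        (symbol γ k z ξ - z * symbol γ (k + 1) z ξ)‖ := by congr 1; ring
    _ ≤ M * ‖z' - z‖ * ‖z' - z‖ := h
    _ = _ := by ring

theorem hasDerivAt_symbolLp {γ : Fin d → ℕ} (hγ : ∑ i, γ i ≤ 2) (k : ℕ) {z : ℂ}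
    (hz : z.im ≠ 0) : HasDerivAt (symbolLp γ k) (symbolLp γ (k + 1) z : LInf d) z := by
  obtain ⟨M, hM0, hM⟩ := exists_symbol_taylor hγ k hz
  have hz2 : 0 < |z.im| / 2 := half_pos (abs_pos.mpr hz)
  set L : LInf d := symbolLp γ (k + 1) z with hL
  have hO : (fun z' => symbolLp γ k z' - symbolLp γ k z - (z' - z) • L) =O[nhds z]
      fun z' => ‖z' - z‖ ^ 2 := by
    refine Asymptotics.IsBigO.of_bound M ?_
    filter_upwards [ball_mem_nhds z hz2] with z' hz'
    obtain ⟨h0, hT⟩ := hM z' hz'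
    rw [norm_pow, norm_norm]
    refine norm_LInf_le (by positivity) ?_
    filter_upwards [coeFn_symbolLp hγ k h0, coeFn_symbolLp hγ k hz, coeFn_symbolLp hγ (k + 1) hz,
      Lp.coeFn_sub (symbolLp γ k z' - symbolLp γ k z) ((z' - z) • L),
      Lp.coeFn_sub (symbolLp γ k z') (symbolLp γ k z), Lp.coeFn_smul (z' - z) L]
      with ξ h1 h2 h3 h4 h5 h6
    rw [h4, Pi.sub_apply, h5, Pi.sub_apply, h6, Pi.smul_apply, h1, h2, hL, h3, smul_eq_mul]
    exact hT ξ
  have h1 : HasDerivAt (fun z' => symbolLp γ k z' - symbolLp γ k z - (z' - z) • L) 0 z := by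
    have := (hO.hasFDerivAt (𝕜 := ℂ) (by norm_num)).hasDerivAt
    simpa using this
  have h2 : HasDerivAt (fun z' => (z' - z) • L) L z := by
    simpa using ((hasDerivAt_id z).sub_const z).smul_const L
  have h3 := (h1.add h2).add_const (symbolLp γ k z)
  rw [zero_add] at h3
  refine h3.congr_of_eventuallyEq (Filter.Eventually.of_forall fun z' => ?_)
  simp

/-- The `k`-th derivative of the weighted resolvent, up to normalizing factors. -/
noncomputable def resolventOp (hw : IsRapid w m B) (γ : Fin d → ℕ) (k : ℕ) (z : ℂ) :
    L2 d →L[ℂ] L2 d :=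
  sandwich hw (symbolLp γ k z)

theorem hasDerivAt_resolventOp (hw : IsRapid w m B) {γ : Fin d → ℕ} (hγ : ∑ i, γ i ≤ 2) (k : ℕ)
    {z : ℂ} (hz : z.im ≠ 0) :
    HasDerivAt (resolventOp hw γ k) (resolventOp hw γ (k + 1) z) z :=
  (sandwich hw).hasFDerivAt.comp_hasDerivAt z (hasDerivAt_symbolLp hγ k hz)

theorem inner_resolventOp (hw : IsRapid w m B) {γ : Fin d → ℕ} (hγ : ∑ i, γ i ≤ 2) (k : ℕ)
    {z : ℂ} (hz : z.im ≠ 0) (u v : L2 d) :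
    inner ℂ v (resolventOp hw γ k z u) = resolventForm w γ k z u v := by
  rw [resolventOp, sandwich_apply, inner_weightCLM, inner_fourierInv, L2.inner_def, resolventForm]
  refine integral_congr_ae ?_
  filter_upwards [coeFn_fourier_weightCLM hw u, coeFn_fourier_weightCLM hw v,
    coeFn_symbolLp hγ k hz, coeFn_mulCLM (symbolLp γ k z) (𝓕 (weightCLM hw u) : L2 d)]
    with ξ h1 h2 h3 h4
  rw [h4, h3, h1, h2, RCLike.inner_apply]
  ring

/-- Testing the form against v = x, the image of u, yields ‖x‖² on the left. -/
theorem norm_resolventOp_le (hw : IsRapid w m B) {γ : Fin d → ℕ} (hγ : ∑ i, γ i ≤ 2) (k : ℕ)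
    {z : ℂ} (hz : z.im ≠ 0) {M : ℝ} (hM0 : 0 ≤ M)
    (hM : ∀ u v : L2 d, ‖resolventForm w γ k z u v‖ ≤ M * (‖u‖ * ‖v‖)) :
    ‖resolventOp hw γ k z‖ ≤ M := by
  refine ContinuousLinearMap.opNorm_le_bound _ hM0 fun u => ?_
  set x := resolventOp hw γ k z u with hx
  have h := hM u x
  rw [← inner_resolventOp hw hγ k hz, ← hx, inner_self_eq_norm_sq_to_K] at h
  simp only [norm_pow, RCLike.norm_ofReal, abs_norm] at h
  rcases (norm_nonneg x).eq_or_lt with h0 | h0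
  · rw [← h0]
    positivity
  · refine le_of_mul_le_mul_right ?_ h0
    calc ‖x‖ * ‖x‖ = ‖x‖ ^ 2 := (sq _).symm
      _ ≤ _ := h
      _ = _ := by ring

end Operators

end FreeResolvent

namespace FreeResolvent

open Set Metric Filter Topology

/-! ### Boundary values of holomorphic towers -/

section BoundaryValues

variable {E : Type*} [NormedAddCommGroup E] [NormedSpace ℂ E]

/-- The open lower half-plane. -/
def lowerHalf : Set ℂ := {z | z.im < 0}

theorem convex_lowerHalf : Convex ℝ lowerHalf := convex_halfSpace_im_lt 0

theorem closure_lowerHalf : closure lowerHalf = {z | z.im ≤ 0} := Complex.closure_setOfPred_im_lt 0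

theorem nhdsWithin_lowerHalf_neBot {z : ℂ} (hz : z.im ≤ 0) : (𝓝[lowerHalf] z).NeBot :=
  mem_closure_iff_nhdsWithin_neBot.mp (closure_lowerHalf ▸ hz)

/-- Sequences of functions on the lower half-plane, each the derivative of the preceding one, which
are all bounded near every point of a subset `U` of the real line. -/
structure IsBoundedTower (T : ℕ → ℂ → E) (U : Set ℝ) : Prop where
  hasDerivAt : ∀ k z, z ∈ lowerHalf → HasDerivAt (T k) (T (k + 1) z) z
  bounded : ∀ k, ∀ t ∈ U, ∃ r > 0, ∃ M, ∀ z ∈ ball (t : ℂ) r, z ∈ lowerHalf → ‖T k z‖ ≤ M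

/-- The continuous extension to the real line of a function on the lower half-plane. -/
noncomputable def boundaryExtension (f : ℂ → E) : ℂ → E := extendFrom lowerHalf f

variable {T : ℕ → ℂ → E} {U : Set ℝ}

/-- The intersection of a disc with the half-plane is convex, so the bound at level k + 1 gives a
Lipschitz constant at level k. Completeness then provides the limit on the real axis. -/
theorem IsBoundedTower.lipschitz (hT : IsBoundedTower T U) (k : ℕ) {t : ℝ} (ht : t ∈ U) :
    ∃ r > 0, ∃ M, 0 ≤ M ∧ ∀ z ∈ ball (t : ℂ) r, ∀ z' ∈ ball (t : ℂ) r, z ∈ lowerHalf →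
      z' ∈ lowerHalf → ‖T k z' - T k z‖ ≤ M * ‖z' - z‖ := by
  obtain ⟨r, hr, M, hM⟩ := hT.bounded (k + 1) t ht
  refine ⟨r, hr, max M 0, le_max_right _ _, fun z hz z' hz' h h' => ?_⟩
  exact ((convex_ball (t : ℂ) r).inter convex_lowerHalf).norm_image_sub_le_of_norm_hasDerivWithin_le
    (f := T k) (f' := T (k + 1)) (fun x hx => (hT.hasDerivAt k x hx.2).hasDerivWithinAt)
    (fun x hx => (hM x hx.1 hx.2).trans (le_max_left _ _)) ⟨hz, h⟩ ⟨hz', h'⟩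

theorem IsBoundedTower.boundaryExtension_eq (hT : IsBoundedTower T U) (k : ℕ) {z : ℂ}
    (hz : z ∈ lowerHalf) : boundaryExtension (T k) z = T k z :=
  extendFrom_eq (subset_closure hz) (hT.hasDerivAt k z hz).continuousAt.continuousWithinAt

variable [CompleteSpace E]

theorem IsBoundedTower.exists_tendsto_ofReal (hT : IsBoundedTower T U) (k : ℕ) {t : ℝ}
    (ht : t ∈ U) : ∃ y, Tendsto (T k) (𝓝[lowerHalf] (t : ℂ)) (𝓝 y) := by
  have := nhdsWithin_lowerHalf_neBot (z := (t : ℂ)) (by simp)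
  obtain ⟨r, hr, M, hM0, hM⟩ := hT.lipschitz k ht
  refine cauchy_map_iff_exists_tendsto.mp (Metric.cauchy_iff.mpr ⟨inferInstance, fun ε hε => ?_⟩)
  set ρ := min r (ε / (2 * (M + 1))) with hρ
  have hρ0 : 0 < ρ := lt_min hr (by positivity)
  refine ⟨T k '' (ball (t : ℂ) ρ ∩ lowerHalf), image_mem_map (inter_mem
    (mem_nhdsWithin_of_mem_nhds (ball_mem_nhds _ hρ0)) self_mem_nhdsWithin), ?_⟩
  rintro _ ⟨z, ⟨hz, hzl⟩, rfl⟩ _ ⟨z', ⟨hz', hzl'⟩, rfl⟩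
  have hsub : ball (t : ℂ) ρ ⊆ ball (t : ℂ) r := ball_subset_ball (min_le_left _ _)
  have h := hM z' (hsub hz') z (hsub hz) hzl' hzl
  have hd : ‖z - z'‖ < 2 * ρ := by
    rw [← dist_eq_norm]
    have := dist_triangle_right z z' (t : ℂ)
    rw [mem_ball] at hz hz'
    linarith
  have h1 : ρ * (2 * (M + 1)) ≤ ε := by
    rw [← le_div_iff₀ (by positivity)]
    exact min_le_right _ _
  rw [dist_eq_norm]
  nlinarith [norm_nonneg (z - z')]

theorem IsBoundedTower.exists_tendsto (hT : IsBoundedTower T U) (k : ℕ) {z : ℂ} (hz : z.im ≤ 0)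
    (hU : z.im = 0 → z.re ∈ U) : ∃ y, Tendsto (T k) (𝓝[lowerHalf] z) (𝓝 y) := by
  rcases hz.eq_or_lt with h | h
  · have : z = (z.re : ℂ) := Complex.ext rfl (by simpa using h)
    rw [this]
    exact hT.exists_tendsto_ofReal k (hU h)
  · exact ⟨_, (hT.hasDerivAt k z h).continuousAt.continuousWithinAt⟩

theorem IsBoundedTower.continuousOn (hT : IsBoundedTower T U) (k : ℕ) {S : Set ℂ}
    (hS : ∀ z ∈ S, z.im ≤ 0 ∧ (z.im = 0 → z.re ∈ U)) :
    ContinuousOn (boundaryExtension (T k)) S :=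
  continuousOn_extendFrom (fun z hz => closure_lowerHalf ▸ (hS z hz).1)
    fun z hz => hT.exists_tendsto k (hS z hz).1 (hS z hz).2

theorem IsBoundedTower.tendsto_boundaryExtension (hT : IsBoundedTower T U) (k : ℕ) {t : ℝ}
    (ht : t ∈ U) :
    Tendsto (T k) (𝓝[lowerHalf] (t : ℂ)) (𝓝 (boundaryExtension (T k) t)) :=
  tendsto_extendFrom (hT.exists_tendsto_ofReal k ht)

theorem IsBoundedTower.norm_boundaryExtension_le (hT : IsBoundedTower T U) (k : ℕ) {t : ℝ}
    (ht : t ∈ U) {b : ℂ → ℝ} (hb : ContinuousAt b t)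
    (h : ∀ᶠ z in 𝓝[lowerHalf] (t : ℂ), ‖T k z‖ ≤ b z) :
    ‖boundaryExtension (T k) t‖ ≤ b t := by
  have := nhdsWithin_lowerHalf_neBot (z := (t : ℂ)) (by simp)
  exact le_of_tendsto_of_tendsto (hT.tendsto_boundaryExtension k ht).norm
    (hb.tendsto.mono_left nhdsWithin_le_nhds) h

/-- The functions s ↦ T k (s - iε) converge pointwise as ε → 0 and their derivatives converge
uniformly near t, so the limit may be differentiated. -/
theorem IsBoundedTower.hasDerivAt_boundaryExtension (hT : IsBoundedTower T U) (hU : IsOpen U)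
    (k : ℕ) {t : ℝ} (ht : t ∈ U) :
    HasDerivAt (fun s : ℝ => boundaryExtension (T k) s) (boundaryExtension (T (k + 1)) t) t := by
  obtain ⟨r₀, hr₀, hrU⟩ := Metric.isOpen_iff.mp hU t ht
  obtain ⟨r₁, hr₁, M, hM0, hM⟩ := hT.lipschitz (k + 1) ht
  set r := min r₀ (r₁ / 2) with hr
  have hr0 : 0 < r := lt_min hr₀ (half_pos hr₁)
  have hsU : ∀ s ∈ ball t r, s ∈ U := fun s hs => hrU (ball_subset_ball (min_le_left _ _) hs)
  have hdist : ∀ s ∈ ball t r, dist (s : ℂ) t < r₁ / 2 := fun s hs => by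
    rw [Complex.dist_of_im_eq (by simp)]
    exact (mem_ball.mp hs).trans_le (min_le_right _ _)
  have hI : ∀ (s ε : ℝ), (s - ε * Complex.I : ℂ) ∈ lowerHalf ↔ 0 < ε := fun s ε => by
    simp [lowerHalf]
  have hcurve : ∀ s : ℝ, Tendsto (fun ε : ℝ => (s - ε * Complex.I : ℂ)) (𝓝[>] 0)
      (𝓝[lowerHalf] (s : ℂ)) := fun s => by
    refine tendsto_nhdsWithin_iff.mpr ⟨?_, ?_⟩
    · have : Continuous fun ε : ℝ => (s - ε * Complex.I : ℂ) := by fun_prop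
      simpa using (this.tendsto 0).mono_left nhdsWithin_le_nhds
    · filter_upwards [self_mem_nhdsWithin] with ε hε
      exact (hI s ε).mpr hε
  refine hasDerivAt_of_tendstoUniformlyOn (𝕜 := ℝ) (l := 𝓝[>] (0 : ℝ)) (s := ball t r)
    (f := fun (ε s : ℝ) => T k (s - ε * Complex.I)) (f' := fun (ε s : ℝ) => T (k + 1) (s - ε * Complex.I))
    (g' := fun s : ℝ => boundaryExtension (T (k + 1)) s) isOpen_ball ?_ ?_ ?_ (mem_ball_self hr0)
  · rw [Metric.tendstoUniformlyOn_iff]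
    intro η hη
    have h1 : ∀ᶠ ε : ℝ in 𝓝[>] 0, ε < min (r₁ / 2) (η / (M + 1)) :=
      mem_nhdsWithin_of_mem_nhds (Iio_mem_nhds (lt_min (half_pos hr₁) (by positivity)))
    filter_upwards [h1, self_mem_nhdsWithin] with ε hε hε0 s hs
    have hε0' : 0 < ε := hε0
    obtain ⟨hε1, hε2⟩ := lt_min_iff.mp hε
    set z : ℂ := s - ε * Complex.I with hz
    have hzs : dist z s = ε := by
      rw [dist_eq_norm, hz]
      simp [abs_of_pos hε0']
    have hzb : z ∈ ball (t : ℂ) r₁ := by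
      rw [mem_ball]
      have := dist_triangle z s t
      have := hdist s hs
      linarith
    -- The Lipschitz estimate with one point tending to the real axis; as |s - z| = ε it gives the
    -- uniform rate Mε.
    have hle : ‖boundaryExtension (T (k + 1)) s - T (k + 1) z‖ ≤ M * ‖(s : ℂ) - z‖ := by
      have := nhdsWithin_lowerHalf_neBot (z := (s : ℂ)) (by simp)
      have hc : Tendsto (fun z' => M * ‖z' - z‖) (𝓝[lowerHalf] (s : ℂ)) (𝓝 (M * ‖(s : ℂ) - z‖)) := by
        have : Continuous fun z' : ℂ => M * ‖z' - z‖ := by fun_prop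
        exact (this.tendsto _).mono_left nhdsWithin_le_nhds
      refine le_of_tendsto_of_tendsto
        (((hT.tendsto_boundaryExtension (k + 1) (hsU s hs)).sub_const _).norm) hc ?_
      have hsb : (s : ℂ) ∈ ball (t : ℂ) r₁ := by
        rw [mem_ball]
        linarith [hdist s hs]
      filter_upwards [mem_nhdsWithin_of_mem_nhds (isOpen_ball.mem_nhds hsb), self_mem_nhdsWithin]
        with z' hz' hz'l
      exact hM z hzb z' hz' ((hI s ε).mpr hε0') hz'l
    rw [dist_eq_norm]
    rw [← dist_eq_norm, ← dist_eq_norm, dist_comm (s : ℂ), hzs] at hle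
    rw [lt_div_iff₀ (by positivity)] at hε2
    rw [← dist_eq_norm]
    nlinarith
  · filter_upwards [self_mem_nhdsWithin] with ε hε s hs
    have h := hT.hasDerivAt k (s - ε * Complex.I) ((hI s ε).mpr hε)
    have h2 : HasDerivAt (fun s : ℝ => (s - ε * Complex.I : ℂ)) 1 s :=
      (Complex.ofRealCLM.hasDerivAt (x := s)).sub_const _
    simpa [Function.comp_def] using HasDerivAt.scomp (𝕜 := ℝ) s h h2
  · intro s hs
    exact (hT.tendsto_boundaryExtension k (hsU s hs)).comp (hcurve s)

theorem IsBoundedTower.iteratedDeriv_eq (hT : IsBoundedTower T U) (hU : IsOpen U) (k : ℕ) :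
    ∀ t ∈ U, iteratedDeriv k (fun s : ℝ => boundaryExtension (T 0) s) t =
      boundaryExtension (T k) t := by
  induction k with
  | zero => intro t _; rw [iteratedDeriv_zero]
  | succ k ih =>
    intro t ht
    rw [iteratedDeriv_succ, ← (hT.hasDerivAt_boundaryExtension hU k ht).deriv]
    exact EventuallyEq.deriv_eq (mem_of_superset (hU.mem_nhds ht) ih)

theorem IsBoundedTower.contDiffOn (hT : IsBoundedTower T U) (hU : IsOpen U) :
    ContDiffOn ℝ (⊤ : ℕ∞) (fun s : ℝ => boundaryExtension (T 0) s) U := by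
  refine contDiffOn_of_differentiableOn_deriv fun k _ => ?_
  refine DifferentiableOn.congr (f := fun s : ℝ => boundaryExtension (T k) s) (fun t ht => ?_)
    fun t ht => ?_
  · exact (hT.hasDerivAt_boundaryExtension hU k ht).differentiableAt.differentiableWithinAt
  · rw [iteratedDerivWithin_of_isOpen hU ht, hT.iteratedDeriv_eq hU k t ht]

end BoundaryValues

end FreeResolvent

namespace FreeResolvent

open scoped FourierTransform RealInnerProductSpace
open Set Metric

variable {d : ℕ}

/-! ### Differential operators as Fourier multipliers -/

section FourierSymbol

/-- The product p f need not be in L², but it is locally integrable. An identity of distributions,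
tested on smooth functions of compact support, is therefore an identity almost everywhere. -/
theorem smulLeftCLM_incl_eq_iff {p : Space d → ℂ} (hp : p.HasTemperateGrowth) (f g : L2 d) :
    TemperedDistribution.smulLeftCLM ℂ p (incl d f) = incl d g ↔
      (g : Space d → ℂ) =ᵐ[volume] fun ξ => p ξ * f ξ := by
  have happly : ∀ ψ : 𝓢(Space d, ℂ), TemperedDistribution.smulLeftCLM ℂ p (incl d f) ψ =
      ∫ ξ, ψ ξ * (p ξ * f ξ) := fun ψ => by
    rw [TemperedDistribution.smulLeftCLM_apply_apply, incl_apply, Lp.toTemperedDistribution_apply]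
    refine integral_congr_ae (Filter.Eventually.of_forall fun ξ => ?_)
    simp only [SchwartzMap.smulLeftCLM_apply_apply hp, smul_eq_mul]
    ring
  have hloc : ∀ h : L2 d, LocallyIntegrable (h : Space d → ℂ) := fun h =>
    (Lp.memLp h).locallyIntegrable one_le_two
  constructor
  · intro h
    have hpf : LocallyIntegrable fun ξ => p ξ * f ξ := by
      have := (hloc f).locallyIntegrableOn univ
      rw [← locallyIntegrableOn_univ]
      exact this.continuousOn_mul hp.1.continuous.continuousOn isOpen_univ.isLocallyClosed
    refine ae_eq_of_integral_contDiff_smul_eq (hloc g) hpf fun v hv hc => ?_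
    have hg₁ : HasCompactSupport (Complex.ofRealCLM ∘ v) := hc.comp_left rfl
    have hg₂ : ContDiff ℝ (⊤ : ℕ∞) (Complex.ofRealCLM ∘ v) := by fun_prop
    set ψ : 𝓢(Space d, ℂ) := hg₁.toSchwartzMap hg₂ with hψ
    have hψv : ∀ x, ψ x = (v x : ℂ) := fun x => rfl
    have h1 := happly ψ
    rw [h, incl_apply, Lp.toTemperedDistribution_apply] at h1
    simpa [hψv] using h1
  · intro h
    ext ψ
    rw [happly, incl_apply, Lp.toTemperedDistribution_apply]
    refine integral_congr_ae ?_
    filter_upwards [h] with ξ hξ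
    rw [hξ, smul_eq_mul]

theorem fourier_incl (f : L2 d) : 𝓕 (incl d f) = incl d (𝓕 f : L2 d) :=
  Lp.fourier_toTemperedDistribution_eq f

/-- The operator `E` on tempered distributions is the Fourier multiplier with symbol `p`. -/
structure HasFourierSymbol (E : Distr d →ₗ[ℂ] Distr d) (p : Space d → ℂ) : Prop where
  hasTemperateGrowth : p.HasTemperateGrowth
  fourier_eq : ∀ f, 𝓕 (E f) = TemperedDistribution.smulLeftCLM ℂ p (𝓕 f)

variable {E E' : Distr d →ₗ[ℂ] Distr d} {p q : Space d → ℂ}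

theorem HasFourierSymbol.congr (h : HasFourierSymbol E p) (hpq : ∀ ξ, p ξ = q ξ) :
    HasFourierSymbol E q := by
  rwa [← funext hpq]

theorem hasFourierSymbol_one : HasFourierSymbol (1 : Module.End ℂ (Distr d)) fun _ => 1 where
  hasTemperateGrowth := Function.HasTemperateGrowth.const 1
  fourier_eq f := by simp

theorem HasFourierSymbol.mul (h : HasFourierSymbol E p) (h' : HasFourierSymbol E' q) :
    HasFourierSymbol ((E : Module.End ℂ (Distr d)) * E') fun ξ => p ξ * q ξ where
  hasTemperateGrowth := h.hasTemperateGrowth.mul h'.hasTemperateGrowth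
  fourier_eq f := by
    rw [Module.End.mul_apply, h.fourier_eq, h'.fourier_eq,
      TemperedDistribution.smulLeftCLM_smulLeftCLM_apply h'.hasTemperateGrowth
        h.hasTemperateGrowth, mul_comm q p]
    rfl

theorem HasFourierSymbol.pow (h : HasFourierSymbol E p) (k : ℕ) :
    HasFourierSymbol ((E : Module.End ℂ (Distr d)) ^ k) fun ξ => p ξ ^ k := by
  induction k with
  | zero => simpa using hasFourierSymbol_one
  | succ k ih => simpa only [pow_succ] using ih.mul h

theorem HasFourierSymbol.list_prod {ι : Type*} {F : ι → Module.End ℂ (Distr d)}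
    {p : ι → Space d → ℂ} (h : ∀ i, HasFourierSymbol (F i) (p i)) (l : List ι) :
    HasFourierSymbol (l.map F).prod fun ξ => (l.map fun i => p i ξ).prod := by
  induction l with
  | nil => simpa using hasFourierSymbol_one
  | cons i l ih => simpa only [List.map_cons, List.prod_cons] using (h i).mul ih

theorem hasFourierSymbol_lineDeriv (i : Fin d) : HasFourierSymbol
    (LineDeriv.lineDerivOpCLM ℂ (Distr d) (EuclideanSpace.single i (1 : ℝ))).toLinearMap
    fun ξ => 2 * Real.pi * Complex.I * (ξ i : ℂ) := by
  have h1 : (fun ξ : Space d => ((inner ℝ ξ (EuclideanSpace.single i (1 : ℝ)) : ℝ) : ℂ)) =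
      fun ξ => (ξ i : ℂ) := by
    ext ξ
    simp [EuclideanSpace.inner_single_right]
  have h2 : (fun ξ : Space d => (ξ i : ℂ)).HasTemperateGrowth := by
    rw [← h1]
    fun_prop
  have h3 : (fun ξ : Space d => 2 * Real.pi * Complex.I * (ξ i : ℂ)) =
      (2 * Real.pi * Complex.I : ℂ) • fun ξ : Space d => (ξ i : ℂ) := rfl
  refine ⟨(Function.HasTemperateGrowth.const _).mul h2, fun f => ?_⟩
  have h := TemperedDistribution.fourier_lineDerivOp_eq f (EuclideanSpace.single i (1 : ℝ))
  rw [h1] at h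
  rw [h3, TemperedDistribution.smulLeftCLM_smul h2]
  exact h

/-- The symbol of `∂^α`. -/
noncomputable def derivSymbol (α : Fin d → ℕ) (ξ : Space d) : ℂ :=
  (2 * Real.pi * Complex.I) ^ (∑ i, α i) * xiPow α ξ

theorem hasFourierSymbol_distrDeriv (α : Fin d → ℕ) :
    HasFourierSymbol (distrDeriv α) (derivSymbol α) := by
  refine (HasFourierSymbol.list_prod (fun i => (hasFourierSymbol_lineDeriv i).pow (α i))
    (List.finRange d)).congr fun ξ => ?_
  rw [← List.ofFn_eq_map, List.prod_ofFn, derivSymbol, xiPow, ← Finset.prod_pow_eq_pow_sum,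
    ← Finset.prod_mul_distrib]
  simp_rw [mul_pow]

theorem hasFourierSymbol_neg_laplacian : HasFourierSymbol
    (-(LineDeriv.laplacianCLM ℂ (EuclideanSpace ℝ (Fin d)) (Distr d)).toLinearMap)
    fun ξ => ((4 * Real.pi ^ 2 * ‖ξ‖ ^ 2 : ℝ) : ℂ) := by
  have hsq := fun i : Fin d => (hasFourierSymbol_lineDeriv i).mul (hasFourierSymbol_lineDeriv i)
  have hsum : (fun ξ : Space d => ((4 * Real.pi ^ 2 * ‖ξ‖ ^ 2 : ℝ) : ℂ)) = -fun ξ : Space d =>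
      ∑ i, (2 * Real.pi * Complex.I * (ξ i : ℂ)) * (2 * Real.pi * Complex.I * (ξ i : ℂ)) := by
    ext ξ
    rw [Pi.neg_apply, EuclideanSpace.real_norm_sq_eq, ← Finset.sum_neg_distrib]
    push_cast
    rw [Finset.mul_sum]
    refine Finset.sum_congr rfl fun i _ => ?_
    linear_combination (4 * (Real.pi : ℂ) ^ 2 * (ξ i : ℂ) ^ 2) * Complex.I_sq
  have hg : (fun ξ : Space d => ∑ i, (2 * Real.pi * Complex.I * (ξ i : ℂ)) *
      (2 * Real.pi * Complex.I * (ξ i : ℂ))).HasTemperateGrowth :=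
    Function.HasTemperateGrowth.sum fun i _ => (hsq i).hasTemperateGrowth
  refine ⟨hsum ▸ hg.neg, fun f => ?_⟩
  have h1 : (-(LineDeriv.laplacianCLM ℂ (EuclideanSpace ℝ (Fin d)) (Distr d)).toLinearMap) f =
      -∑ i : Fin d, ∂_{EuclideanSpace.single i (1 : ℝ)} (∂_{EuclideanSpace.single i (1 : ℝ)} f) := by
    have := TemperedDistribution.laplacian_eq_sum (EuclideanSpace.basisFun (Fin d) ℝ) f
    simp only [EuclideanSpace.basisFun_apply] at this
    rw [← this, ← TemperedDistribution.laplacianCLM_apply]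
    rfl
  rw [h1, hsum, TemperedDistribution.smulLeftCLM_neg hg,
    TemperedDistribution.smulLeftCLM_sum fun i _ => (hsq i).hasTemperateGrowth]
  have h2 : ∀ i : Fin d, 𝓕 (∂_{EuclideanSpace.single i (1 : ℝ)}
      (∂_{EuclideanSpace.single i (1 : ℝ)} f)) = _ := fun i => (hsq i).fourier_eq f
  rw [← FourierTransform.fourierCLM_apply (R := ℂ), map_neg, map_sum]
  simp only [FourierTransform.fourierCLM_apply, h2]
  simp

variable {A : Distr d →ₗ[ℂ] Distr d}

theorem HasFourierSymbol.apply_incl_eq_iff (h : HasFourierSymbol A p) (u f : L2 d) :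
    A (incl d u) = incl d f ↔
      ((𝓕 f : L2 d) : Space d → ℂ) =ᵐ[volume] fun ξ => p ξ * (𝓕 u : L2 d) ξ := by
  rw [← smulLeftCLM_incl_eq_iff h.hasTemperateGrowth, ← fourier_incl, ← fourier_incl,
    ← h.fourier_eq]
  constructor
  · intro e
    rw [e]
  · intro e
    have := congrArg (𝓕⁻) e
    simpa using this

theorem HasFourierSymbol.fourier_l2Realization (h : HasFourierSymbol A p)
    (u : (l2Realization A).domain) :
    ((𝓕 (l2Realization A u) : L2 d) : Space d → ℂ) =ᵐ[volume]
      fun ξ => p ξ * (𝓕 (u : L2 d) : L2 d) ξ :=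
  (h.apply_incl_eq_iff u _).mp (incl_l2Realization A u).symm

/-- The inverse transform of p û is the required L² representative of A u. Maximal domains thus
become integrability conditions on the Fourier side. -/
theorem HasFourierSymbol.mem_domain (h : HasFourierSymbol A p) {u : L2 d}
    (hu : MemLp (fun ξ => p ξ * (𝓕 u : L2 d) ξ) 2 volume) : u ∈ (l2Realization A).domain := by
  rw [mem_l2Realization_domain]
  refine ⟨(𝓕⁻ hu.toLp : L2 d), ((h.apply_incl_eq_iff u _).mpr ?_).symm⟩
  rw [FourierTransform.fourier_fourierInv_eq]
  exact hu.coeFn_toLp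

end FourierSymbol

end FreeResolvent

namespace FreeResolvent

open scoped FourierTransform RealInnerProductSpace
open Set Metric

variable {d : ℕ}

/-! ### The resolvent on the Fourier side -/

section Resolvent

theorem eq_of_fourier_ae_eq {f g : L2 d}
    (h : ((𝓕 f : L2 d) : Space d → ℂ) =ᵐ[volume] (𝓕 g : L2 d)) : f = g :=
  (Lp.fourierTransformₗᵢ (Space d) ℂ).injective (Lp.ext h)

theorem div_two_pi_im (z : ℂ) : (z / (2 * Real.pi)).im = z.im / (2 * Real.pi) := by
  have : (2 * Real.pi : ℂ) = ((2 * Real.pi : ℝ) : ℂ) := by push_cast; rfl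
  rw [this, Complex.div_ofReal_im]

theorem div_two_pi_re (z : ℂ) : (z / (2 * Real.pi)).re = z.re / (2 * Real.pi) := by
  have : (2 * Real.pi : ℂ) = ((2 * Real.pi : ℝ) : ℂ) := by push_cast; rfl
  rw [this, Complex.div_ofReal_re]

theorem div_two_pi_im_ne_zero {z : ℂ} (hz : z.im ≠ 0) : (z / (2 * Real.pi)).im ≠ 0 := by
  rw [div_two_pi_im]
  exact div_ne_zero hz Real.two_pi_pos.ne'

theorem four_pi_sq_mul_sub_ne_zero {z : ℂ} (hz : z.im ≠ 0) (s : ℝ) :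
    ((4 * Real.pi ^ 2 * s ^ 2 : ℝ) : ℂ) - z ^ 2 ≠ 0 := by
  have h : ((4 * Real.pi ^ 2 * s ^ 2 : ℝ) : ℂ) - z ^ 2 =
      (((2 * Real.pi * s : ℝ) : ℂ) - z) * (((2 * Real.pi * s : ℝ) : ℂ) + z) := by
    push_cast
    ring
  rw [h]
  exact mul_ne_zero (ofReal_sub_ne_zero hz _) (ofReal_add_ne_zero hz _)

theorem inv_four_pi_sq_mul_sub (s : ℝ) (z : ℂ) :
    (((4 * Real.pi ^ 2 * s ^ 2 : ℝ) : ℂ) - z ^ 2)⁻¹ =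
      (4 * Real.pi ^ 2 : ℂ)⁻¹ * resKer 0 s (z / (2 * Real.pi)) := by
  have hπ : (Real.pi : ℂ) ≠ 0 := by exact_mod_cast Real.pi_ne_zero
  rw [resKer_zero, ← mul_inv]
  congr 1
  push_cast
  field_simp
  ring

theorem xiPow_add (α β : Fin d → ℕ) (ξ : Space d) : xiPow (α + β) ξ = xiPow α ξ * xiPow β ξ := by
  rw [xiPow, xiPow, xiPow, ← Finset.prod_mul_distrib]
  exact Finset.prod_congr rfl fun i _ => pow_add _ _ _

theorem sum_add_apply (α β : Fin d → ℕ) : ∑ i, (α + β) i = ∑ i, α i + ∑ i, β i :=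
  Finset.sum_add_distrib

/-- The normalizing factor relating the operators `∂^γ (P₀ - z²)⁻¹` to the symbols
`ξ^γ / (|ξ|² - (z / 2π)²)`. -/
noncomputable def resolventFactor (γ : Fin d → ℕ) : ℂ :=
  (2 * Real.pi * Complex.I) ^ (∑ i, γ i) * (4 * Real.pi ^ 2 : ℂ)⁻¹

theorem derivSymbol_mul_inv (γ : Fin d → ℕ) (z : ℂ) (ξ : Space d) :
    derivSymbol γ ξ * (((4 * Real.pi ^ 2 * ‖ξ‖ ^ 2 : ℝ) : ℂ) - z ^ 2)⁻¹ =
      resolventFactor γ * symbol γ 0 (z / (2 * Real.pi)) ξ := by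
  rw [inv_four_pi_sq_mul_sub, derivSymbol, resolventFactor, symbol]
  ring

theorem derivSymbol_add (α β : Fin d → ℕ) (ξ : Space d) :
    derivSymbol (α + β) ξ = derivSymbol α ξ * derivSymbol β ξ := by
  rw [derivSymbol, derivSymbol, derivSymbol, xiPow_add, sum_add_apply, pow_add]
  ring

/-- The operator `P₀ - ζ`. -/
noncomputable def shiftedLaplacian (d : ℕ) (ζ : ℂ) : L2 d →ₗ.[ℂ] L2 d :=
  freeLaplacian d - (ζ • (LinearMap.id : L2 d →ₗ[ℂ] L2 d)).toPMap ⊤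

theorem fourier_shiftedLaplacian (ζ : ℂ) (x : (shiftedLaplacian d ζ).domain) :
    ((𝓕 (shiftedLaplacian d ζ x) : L2 d) : Space d → ℂ) =ᵐ[volume]
      fun ξ => (((4 * Real.pi ^ 2 * ‖ξ‖ ^ 2 : ℝ) : ℂ) - ζ) * (𝓕 (x : L2 d) : L2 d) ξ := by
  have h1 : shiftedLaplacian d ζ x = freeLaplacian d ⟨x, x.2.1⟩ - ζ • (x : L2 d) := rfl
  have h2 : (𝓕 (shiftedLaplacian d ζ x) : L2 d) =
      𝓕 (freeLaplacian d ⟨x, x.2.1⟩) - ζ • 𝓕 (x : L2 d) := by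
    rw [h1]
    exact (map_sub (Lp.fourierTransformₗᵢ (Space d) ℂ) _ _).trans
      (congrArg _ (map_smul (Lp.fourierTransformₗᵢ (Space d) ℂ) ζ (x : L2 d)))
  rw [h2]
  filter_upwards [Lp.coeFn_sub (𝓕 (freeLaplacian d ⟨x, x.2.1⟩) : L2 d) (ζ • 𝓕 (x : L2 d)),
    Lp.coeFn_smul ζ (𝓕 (x : L2 d)),
    hasFourierSymbol_neg_laplacian.fourier_l2Realization ⟨(x : L2 d), x.2.1⟩] with ξ h3 h4 h5
  rw [h3, Pi.sub_apply, h4, Pi.smul_apply, smul_eq_mul, sub_mul]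
  congr 1

/-- The multiplier 4π²|ξ|² - z² vanishes nowhere. Injectivity is what allows values of the partially
defined inverse to be computed from preimages. -/
theorem ker_shiftedLaplacian {z : ℂ} (hz : z.im ≠ 0) :
    LinearMap.ker (shiftedLaplacian d (z ^ 2)).toFun = ⊥ := by
  rw [LinearMap.ker_eq_bot']
  intro x hx
  have hx' : shiftedLaplacian d (z ^ 2) x = 0 := hx
  have h := fourier_shiftedLaplacian (z ^ 2) x
  have h0 : (𝓕 (0 : L2 d) : L2 d) = 0 := map_zero (Lp.fourierTransformₗᵢ (Space d) ℂ)
  rw [hx', h0] at h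
  refine Subtype.ext (eq_of_fourier_ae_eq ?_)
  change ((𝓕 (x : L2 d) : L2 d) : Space d → ℂ) =ᵐ[volume] (𝓕 (0 : L2 d) : L2 d)
  rw [h0]
  filter_upwards [h, Lp.coeFn_zero ℂ 2 (volume : Measure (Space d))] with ξ h1 h2
  rw [h2, Pi.zero_apply] at h1 ⊢
  exact (mul_eq_zero.mp h1.symm).resolve_left (four_pi_sq_mul_sub_ne_zero hz ‖ξ‖)

theorem memLp_symbol_mul {γ : Fin d → ℕ} (hγ : ∑ i, γ i ≤ 2) (k : ℕ) {z : ℂ} (hz : z.im ≠ 0)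
    (f : L2 d) : MemLp (fun ξ => symbol γ k z ξ * f ξ) 2 volume := by
  refine (memLp_congr_ae ?_).mp (Lp.memLp (mulCLM d (symbolLp γ k z) f))
  filter_upwards [coeFn_mulCLM (symbolLp γ k z) f, coeFn_symbolLp hγ k hz] with ξ h1 h2
  rw [h1, h2]

theorem memLp_derivSymbol_mul_inv_mul {γ : Fin d → ℕ} (hγ : ∑ i, γ i ≤ 2) {z : ℂ}
    (hz : z.im ≠ 0) (f : L2 d) : MemLp (fun ξ => derivSymbol γ ξ *
      (((4 * Real.pi ^ 2 * ‖ξ‖ ^ 2 : ℝ) : ℂ) - z ^ 2)⁻¹ * f ξ) 2 volume := by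
  refine (memLp_congr_ae (Filter.Eventually.of_forall fun ξ => ?_)).mpr
    ((memLp_symbol_mul hγ 0 (div_two_pi_im_ne_zero hz) f).const_mul (resolventFactor γ))
  exact (congrArg (· * f ξ) (derivSymbol_mul_inv γ z ξ)).trans (mul_assoc _ _ _)

theorem derivSymbol_zero (ξ : Space d) : derivSymbol 0 ξ = 1 := by
  simp [derivSymbol, xiPow]

/-- The preimage r is found by division on the Fourier side. It lies in the domain of P₀ because
4π²|ξ|² r̂ = ĝ + z² r̂. -/
theorem mem_resolvent_domain {z : ℂ} (hz : z.im ≠ 0) (g : L2 d) :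
    g ∈ (resolvent d (z ^ 2)).domain := by
  have hmem : MemLp (fun ξ => (((4 * Real.pi ^ 2 * ‖ξ‖ ^ 2 : ℝ) : ℂ) - z ^ 2)⁻¹ *
      (𝓕 g : L2 d) ξ) 2 volume := by
    simpa [derivSymbol_zero] using
      memLp_derivSymbol_mul_inv_mul (d := d) (γ := 0) (by simp) hz (𝓕 g : L2 d)
  set r : L2 d := 𝓕⁻ hmem.toLp with hr
  have hFr : ((𝓕 r : L2 d) : Space d → ℂ) =ᵐ[volume]
      fun ξ => (((4 * Real.pi ^ 2 * ‖ξ‖ ^ 2 : ℝ) : ℂ) - z ^ 2)⁻¹ * (𝓕 g : L2 d) ξ := by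
    rw [hr, FourierTransform.fourier_fourierInv_eq]
    exact hmem.coeFn_toLp
  have hdom : r ∈ (freeLaplacian d).domain := by
    refine hasFourierSymbol_neg_laplacian.mem_domain ?_
    refine (memLp_congr_ae ?_).mpr
      ((Lp.memLp (𝓕 g : L2 d)).add ((Lp.memLp (𝓕 r : L2 d)).const_mul (z ^ 2)))
    filter_upwards [hFr] with ξ hξ
    have h0 := four_pi_sq_mul_sub_ne_zero hz ‖ξ‖
    rw [Pi.add_apply, hξ]
    field_simp
    ring
  rw [resolvent, LinearPMap.inverse_domain]
  refine ⟨(⟨r, hdom, trivial⟩ : (shiftedLaplacian d (z ^ 2)).domain), eq_of_fourier_ae_eq ?_⟩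
  refine (fourier_shiftedLaplacian (z ^ 2) ⟨r, hdom, trivial⟩).trans ?_
  filter_upwards [hFr] with ξ hξ
  rw [hξ, mul_inv_cancel_left₀ (four_pi_sq_mul_sub_ne_zero hz ‖ξ‖)]

theorem fourier_resolvent {z : ℂ} (hz : z.im ≠ 0) (g : (resolvent d (z ^ 2)).domain) :
    ((𝓕 (resolvent d (z ^ 2) g) : L2 d) : Space d → ℂ) =ᵐ[volume]
      fun ξ => (((4 * Real.pi ^ 2 * ‖ξ‖ ^ 2 : ℝ) : ℂ) - z ^ 2)⁻¹ * (𝓕 (g : L2 d) : L2 d) ξ := by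
  obtain ⟨x, hx⟩ := (SetLike.ext_iff.mp
    (LinearPMap.inverse_domain (f := shiftedLaplacian d (z ^ 2))) (g : L2 d)).mp g.2
  have h1 : resolvent d (z ^ 2) g = x :=
    LinearPMap.inverse_apply_eq (f := shiftedLaplacian d (z ^ 2)) (ker_shiftedLaplacian hz) hx
  have hx' : shiftedLaplacian d (z ^ 2) x = g := hx
  have h2 := fourier_shiftedLaplacian (z ^ 2) x
  rw [hx'] at h2
  rw [h1]
  filter_upwards [h2] with ξ hξ
  rw [hξ, inv_mul_cancel_left₀ (four_pi_sq_mul_sub_ne_zero hz ‖ξ‖)]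

end Resolvent

/-! ### The natural domain and the bounded extension -/

section BoundedExtension

variable {w : Space d → ℝ} {m : ℕ → ℝ} {B : ℝ}

theorem mulOp_eq_weightCLM (hw : IsRapid w m B) (u : (mulOp w).domain) :
    mulOp w u = weightCLM hw u :=
  (weightCLM_eq_toLp hw u).symm

theorem mem_mulOp_domain (hw : IsRapid w m B) (u : L2 d) : u ∈ (mulOp w).domain :=
  hw.memLp_weighted u

theorem fourier_comp_partialDeriv_resolvent (hw : IsRapid w m B) (α β : Fin d → ℕ) {z : ℂ}
    (hz : z.im ≠ 0) (u : (comp (partialDeriv α) (comp (resolvent d (z ^ 2))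
      (comp (partialDeriv β) (mulOp w)))).domain) :
    ((𝓕 (comp (partialDeriv α) (comp (resolvent d (z ^ 2))
      (comp (partialDeriv β) (mulOp w))) u) : L2 d) : Space d → ℂ) =ᵐ[volume]
      fun ξ => resolventFactor (α + β) * (symbol (α + β) 0 (z / (2 * Real.pi)) ξ *
        (𝓕 (weightCLM hw u) : L2 d) ξ) := by
  obtain ⟨h₁, h₂⟩ := (mem_comp_domain _ _ _).mp u.2
  obtain ⟨h₃, h₄⟩ := (mem_comp_domain _ _ _).mp h₁
  obtain ⟨h₅, h₆⟩ := (mem_comp_domain _ _ _).mp h₃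
  filter_upwards [(hasFourierSymbol_distrDeriv α).fourier_l2Realization ⟨_, h₂⟩,
    fourier_resolvent hz ⟨_, h₄⟩,
    (hasFourierSymbol_distrDeriv β).fourier_l2Realization ⟨_, h₆⟩] with ξ e₁ e₂ e₃
  have e₄ := e₃.trans (congrArg (fun x : L2 d => derivSymbol β ξ * (𝓕 x : L2 d) ξ)
    (mulOp_eq_weightCLM hw ⟨_, h₅⟩))
  refine (e₁.trans (congrArg (derivSymbol α ξ * ·) (e₂.trans (congrArg _ e₄)))).trans ?_
  rw [← mul_assoc (resolventFactor _), ← derivSymbol_mul_inv, derivSymbol_add]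
  ring

/-- The only real restriction on u is imposed by ∂^β: the weight is bounded, the resolvent is
everywhere defined, and ∂^α after the resolvent has a bounded symbol since |α| ≤ 2. -/
theorem mem_weightedResolvent_domain (hw : IsRapid w m B) {α β : Fin d → ℕ}
    (hα : ∑ i, α i ≤ 2) {z : ℂ} (hz : z.im ≠ 0) {u : L2 d}
    (hu : weightCLM hw u ∈ (partialDeriv β).domain) :
    u ∈ (weightedResolvent w α β z).domain := by
  have h₁ : u ∈ (comp (partialDeriv β) (mulOp w)).domain :=
    (mem_comp_domain _ _ _).mpr ⟨mem_mulOp_domain hw u, by rwa [mulOp_eq_weightCLM hw]⟩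
  have h₂ : u ∈ (comp (resolvent d (z ^ 2)) (comp (partialDeriv β) (mulOp w))).domain :=
    (mem_comp_domain _ _ _).mpr ⟨h₁, mem_resolvent_domain hz _⟩
  refine (mem_comp_domain _ _ _).mpr ⟨(mem_comp_domain _ _ _).mpr ⟨h₂, ?_⟩, mem_mulOp_domain hw _⟩
  refine (hasFourierSymbol_distrDeriv α).mem_domain ?_
  refine (memLp_congr_ae ?_).mpr (memLp_derivSymbol_mul_inv_mul hα hz
    (𝓕 (comp (partialDeriv β) (mulOp w) ⟨u, h₁⟩) : L2 d))
  filter_upwards [fourier_resolvent hz ⟨comp (partialDeriv β) (mulOp w) ⟨u, h₁⟩,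
    mem_resolvent_domain hz _⟩] with ξ e
  exact (congrArg (derivSymbol α ξ * ·) e).trans (mul_assoc _ _ _).symm

theorem toLp_mem_partialDeriv_domain (β : Fin d → ℕ) (ψ : 𝓢(Space d, ℂ)) :
    (ψ.toLp 2 volume : L2 d) ∈ (partialDeriv β).domain := by
  have hβ := hasFourierSymbol_distrDeriv β
  refine hβ.mem_domain ?_
  refine (memLp_congr_ae ?_).mpr
    ((SchwartzMap.smulLeftCLM ℂ (derivSymbol β) (𝓕 ψ)).memLp 2 volume)
  rw [SchwartzMap.toLp_fourier_eq]
  filter_upwards [(𝓕 ψ).coeFn_toLp 2 volume] with ξ h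
  rw [h, SchwartzMap.smulLeftCLM_apply_apply hβ.hasTemperateGrowth, smul_eq_mul]

/-- For a real test function g the quotient g/w is in the domain, because w · (g/w) = g is a
Schwartz function. A vector v orthogonal to all of these has v/w = 0 as a distribution, hence v = 0.
-/
theorem dense_weightedResolvent_domain (hw : IsRapid w m B) (hpos : ∀ y, 0 < w y)
    {α : Fin d → ℕ} (β : Fin d → ℕ) (hα : ∑ i, α i ≤ 2) {z : ℂ} (hz : z.im ≠ 0) :
    Dense ((weightedResolvent w α β z).domain : Set (L2 d)) := by
  rw [Submodule.dense_iff_topologicalClosure_eq_top, Submodule.topologicalClosure_eq_top_iff,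
    Submodule.eq_bot_iff]
  intro v hv
  have hwc : Continuous fun y => ((w y : ℂ))⁻¹ :=
    (Complex.continuous_ofReal.comp hw.continuous).inv₀ fun y => by
      simpa using (hpos y).ne'
  have hloc : LocallyIntegrable fun y => ((w y : ℂ))⁻¹ * v y := by
    have := ((Lp.memLp v).locallyIntegrable one_le_two).locallyIntegrableOn univ
    rw [← locallyIntegrableOn_univ]
    exact this.continuousOn_mul hwc.continuousOn isOpen_univ.isLocallyClosed
  have hzero : ∀ᵐ y, ((w y : ℂ))⁻¹ * v y = 0 := by
    refine ae_eq_zero_of_integral_contDiff_smul_eq_zero hloc fun g hg hc => ?_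
    have hg₁ : HasCompactSupport (Complex.ofRealCLM ∘ g) := hc.comp_left rfl
    have hg₂ : ContDiff ℝ (⊤ : ℕ∞) (Complex.ofRealCLM ∘ g) := by fun_prop
    set ψ : 𝓢(Space d, ℂ) := hg₁.toSchwartzMap hg₂ with hψ
    have hψg : ∀ y, ψ y = (g y : ℂ) := fun y => rfl
    have hu : MemLp (fun y => ((w y : ℂ))⁻¹ * (g y : ℂ)) 2 volume :=
      (hwc.mul (Complex.continuous_ofReal.comp hg.continuous)).memLp_of_hasCompactSupport
        (HasCompactSupport.mul_left hg₁)
    have hwu : weightCLM hw hu.toLp = ψ.toLp 2 := by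
      refine Lp.ext ?_
      filter_upwards [coeFn_weightCLM hw hu.toLp, hu.coeFn_toLp, ψ.coeFn_toLp 2 volume]
        with y h1 h2 h3
      have : (w y : ℂ) ≠ 0 := by exact_mod_cast (hpos y).ne'
      rw [h1, h3, weighted, h2, hψg, mul_inv_cancel_left₀ this]
    have hdom : hu.toLp ∈ (weightedResolvent w α β z).domain :=
      mem_weightedResolvent_domain hw hα hz (hwu ▸ toLp_mem_partialDeriv_domain β ψ)
    have h0 := (Submodule.mem_orthogonal _ v).mp hv _ hdom
    rw [L2.inner_def] at h0
    rw [← h0]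
    refine integral_congr_ae ?_
    filter_upwards [hu.coeFn_toLp] with y h
    rw [h, RCLike.inner_apply, map_mul, map_inv₀, Complex.conj_ofReal, Complex.conj_ofReal,
      Complex.real_smul]
    ring
  refine Lp.ext ?_
  filter_upwards [hzero, Lp.coeFn_zero ℂ 2 (volume : Measure (Space d))] with y h1 h2
  rw [h2, Pi.zero_apply]
  exact (mul_eq_zero.mp h1).resolve_left (inv_ne_zero (by exact_mod_cast (hpos y).ne'))

theorem isBoundedExtension_resolventOp (hw : IsRapid w m B) (hpos : ∀ y, 0 < w y)
    {α β : Fin d → ℕ} (hαβ : ∑ i, α i + ∑ i, β i ≤ 2) {z : ℂ} (hz : z.im ≠ 0) :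
    IsBoundedExtension (weightedResolvent w α β z)
      (resolventFactor (α + β) • resolventOp hw (α + β) 0 (z / (2 * Real.pi))) := by
  refine ⟨dense_weightedResolvent_domain hw hpos β (by omega) hz, fun u => ?_⟩
  obtain ⟨h₁, h₂⟩ := (mem_comp_domain _ _ _).mp u.2
  have hγ : ∑ i, (α + β) i ≤ 2 := by rwa [sum_add_apply]
  have e : weightedResolvent w α β z u = weightCLM hw (comp (partialDeriv α)
      (comp (resolvent d (z ^ 2)) (comp (partialDeriv β) (mulOp w))) ⟨u, h₁⟩) :=
    mulOp_eq_weightCLM hw ⟨_, h₂⟩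
  rw [e, smul_apply, resolventOp, sandwich_apply, ← map_smul]
  congr 1
  refine eq_of_fourier_ae_eq ?_
  set K : L2 d := mulCLM d (symbolLp (α + β) 0 (z / (2 * Real.pi)))
    (𝓕 (weightCLM hw (u : L2 d)) : L2 d) with hK
  have h3 : (𝓕 (resolventFactor (α + β) • (𝓕⁻ K : L2 d)) : L2 d) = resolventFactor (α + β) • K :=
    (map_smul (Lp.fourierTransformₗᵢ (Space d) ℂ) _ _).trans
      (congrArg (resolventFactor (α + β) • ·)
        ((Lp.fourierTransformₗᵢ (Space d) ℂ).apply_symm_apply K))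
  rw [h3]
  filter_upwards [Lp.coeFn_smul (resolventFactor (α + β)) K,
    coeFn_mulCLM (symbolLp (α + β) 0 (z / (2 * Real.pi))) (𝓕 (weightCLM hw (u : L2 d)) : L2 d),
    coeFn_symbolLp hγ 0 (div_two_pi_im_ne_zero hz),
    fourier_comp_partialDeriv_resolvent hw α β hz ⟨u, h₁⟩] with ξ h4 h5 h6 h7
  rw [h4, h7, Pi.smul_apply, smul_eq_mul, hK, h5, h6]

end BoundedExtension

end FreeResolvent

namespace FreeResolvent

open Set Metric Filter Topology

/-! ### The tower of derivatives in the spectral parameter -/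

section Tower

theorem IsBoundedTower.of_eventually_le {E : Type*} [NormedAddCommGroup E] [NormedSpace ℂ E]
    {T : ℕ → ℂ → E} {U : Set ℝ}
    (hT : ∀ k z, z ∈ lowerHalf → HasDerivAt (T k) (T (k + 1) z) z)
    (h : ∀ k, ∀ t ∈ U, ∃ b : ℂ → ℝ, ContinuousAt b t ∧
      ∀ᶠ z in 𝓝[lowerHalf] (t : ℂ), ‖T k z‖ ≤ b z) : IsBoundedTower T U := by
  refine ⟨hT, fun k t ht => ?_⟩
  obtain ⟨b, hb, hle⟩ := h k t ht
  have h1 : ∀ᶠ z in 𝓝 (t : ℂ), b z < b t + 1 := hb.eventually_lt continuousAt_const (by simp)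
  obtain ⟨r, hr, hball⟩ := Metric.eventually_nhds_iff_ball.mp
    (h1.and (eventually_nhdsWithin_iff.mp hle))
  exact ⟨r, hr, b t + 1, fun z hz hzl => ((hball z hz).2 hzl).trans (hball z hz).1.le⟩

theorem eventually_le_abs_re {δ t : ℝ} (hδ : 0 < δ) (ht : δ ≤ |t|) :
    ∀ᶠ z : ℂ in 𝓝[lowerHalf] (t : ℂ), δ / 2 ≤ |z.re| := by
  have hc : ContinuousAt (fun z : ℂ => |z.re|) (t : ℂ) := Complex.continuous_re.abs.continuousAt
  refine nhdsWithin_le_nhds ((hc.eventually_const_lt (u := δ / 2) ?_).mono fun z hz => hz.le)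
  simp only [Complex.ofReal_re]
  linarith

theorem eventually_abs_im_le (t : ℝ) :
    ∀ᶠ z : ℂ in 𝓝[lowerHalf] (t : ℂ), |z.im| ≤ 1 ∧ z.im ≠ 0 := by
  have hc : ContinuousAt (fun z : ℂ => |z.im|) (t : ℂ) := Complex.continuous_im.abs.continuousAt
  have h1 : ∀ᶠ z : ℂ in 𝓝[lowerHalf] (t : ℂ), |z.im| < 1 :=
    nhdsWithin_le_nhds (hc.eventually_lt_const (by simp))
  filter_upwards [h1, self_mem_nhdsWithin] with z hz hzl
  exact ⟨hz.le, (show z.im < 0 from hzl).ne⟩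

theorem continuousAt_bound (a : ℝ) (e : ℤ) (z : ℂ) :
    ContinuousAt (fun z : ℂ => a * (|z.re| + 1) ^ e) z := by
  have h : ContinuousAt (fun z : ℂ => |z.re| + 1) z :=
    (Complex.continuous_re.abs.add continuous_const).continuousAt
  exact continuousAt_const.mul (h.zpow₀ e (Or.inl (by positivity)))

/-- Undoes the rescaling by 2π in the energy factor; the exponent n - 1 may be -1, which is where
the factor 2π is lost. -/
theorem div_two_pi_add_one_zpow_le {n : ℕ} (hn : n ≤ 2) {x : ℝ} (hx : 0 ≤ x) :
    (x / (2 * Real.pi) + 1) ^ ((n : ℤ) - 1) ≤ 2 * Real.pi * (x + 1) ^ ((n : ℤ) - 1) := by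
  have hπ := Real.pi_gt_three
  have h2π : 0 < 2 * Real.pi := by linarith
  have hdiv : x / (2 * Real.pi) ≤ x := div_le_self hx (by linarith)
  have hdiv0 : 0 ≤ x / (2 * Real.pi) := by positivity
  interval_cases n
  · have e (y : ℝ) : y ^ (((0 : ℕ) : ℤ) - 1) = y⁻¹ := by simp
    have hx' : 2 * Real.pi * (x / (2 * Real.pi)) = x := mul_div_cancel₀ x h2π.ne'
    rw [e, e, ← div_eq_mul_inv, inv_le_iff_one_le_mul₀ (by linarith), div_mul_eq_mul_div,
      le_div_iff₀ (by linarith)]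
    nlinarith
  · have e (y : ℝ) : y ^ (((1 : ℕ) : ℤ) - 1) = 1 := by simp
    rw [e, e]
    linarith
  · have e (y : ℝ) : y ^ (((2 : ℕ) : ℤ) - 1) = y := by
      rw [show (((2 : ℕ) : ℤ) - 1) = 1 by norm_num, zpow_one]
    rw [e, e]
    nlinarith

theorem one_le_two_mul_zpow {n : ℕ} (hn : n ≤ 2) {x : ℝ} (hx : 0 ≤ x) (hx1 : x ≤ 1) :
    1 ≤ 2 * (x + 1) ^ ((n : ℤ) - 1) := by
  have h : (x + 1)⁻¹ ≤ (x + 1) ^ ((n : ℤ) - 1) := by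
    rw [← zpow_neg_one]
    exact zpow_le_zpow_right₀ (by linarith) (by omega)
  have h2 : (2 : ℝ)⁻¹ ≤ (x + 1)⁻¹ := inv_anti₀ (by linarith) (by linarith)
  linarith

variable {d : ℕ} {w : Space d → ℝ} {m : ℕ → ℝ} {A B : ℝ}

/-- The derivatives of the weighted resolvent `w ∂^γ (P₀ - z²)⁻¹ w`. -/
noncomputable def weightedTower (hw : IsRapid w m B) (γ : Fin d → ℕ) (k : ℕ) (z : ℂ) :
    L2 d →L[ℂ] L2 d :=
  (resolventFactor γ * (2 * Real.pi : ℂ)⁻¹ ^ k) • resolventOp hw γ k (z / (2 * Real.pi))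

theorem hasDerivAt_weightedTower (hw : IsRapid w m B) {γ : Fin d → ℕ} (hγ : ∑ i, γ i ≤ 2) (k : ℕ)
    {z : ℂ} (hz : z.im ≠ 0) :
    HasDerivAt (weightedTower hw γ k) (weightedTower hw γ (k + 1) z) z := by
  have h1 : HasDerivAt (fun z : ℂ => z / (2 * Real.pi)) (1 / (2 * Real.pi)) z :=
    (hasDerivAt_id z).div_const _
  have h2 := (HasDerivAt.scomp z (hasDerivAt_resolventOp hw hγ k (div_two_pi_im_ne_zero hz))
    h1).const_smul (resolventFactor γ * (2 * Real.pi : ℂ)⁻¹ ^ k)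
  refine h2.congr_deriv ?_
  rw [weightedTower, smul_smul, pow_succ, one_div, mul_assoc]

theorem norm_weightedTower_le (hw : IsRapid w m B) (γ : Fin d → ℕ) (k : ℕ) (z : ℂ) :
    ‖weightedTower hw γ k z‖ ≤
      ‖resolventFactor γ‖ * ‖resolventOp hw γ k (z / (2 * Real.pi))‖ := by
  rw [weightedTower, norm_smul, norm_mul, norm_pow]
  refine mul_le_mul_of_nonneg_right (mul_le_of_le_one_right (norm_nonneg _) ?_) (norm_nonneg _)
  have h : ‖(2 * Real.pi : ℂ)‖ = 2 * Real.pi := by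
    rw [norm_mul, Complex.norm_two, Complex.norm_real, Real.norm_of_nonneg Real.pi_pos.le]
  rw [norm_inv, h]
  exact pow_le_one₀ (by positivity) (inv_le_one_of_one_le₀ (by linarith [Real.pi_gt_three]))

theorem exists_norm_weightedTower_le_high (hd : 2 ≤ d) (hm : IsAdmissible m A)
    (hw : IsRapid w m B) {γ : Fin d → ℕ} (hγ : ∑ i, γ i ≤ 2) {δ : ℝ} (hδ : 0 < δ) :
    ∃ C, 1 ≤ C ∧ ∀ (k : ℕ) (z : ℂ), δ ≤ |z.re| → |z.im| ≤ 1 ∧ z.im ≠ 0 →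
      ‖weightedTower hw γ k z‖ ≤
        C ^ (k + 1) * m k * (|z.re| + 1) ^ (((∑ i, γ i : ℕ) : ℤ) - 1) := by
  have hπ := Real.pi_gt_three
  have h2π : 0 < 2 * Real.pi := by linarith
  obtain ⟨C, hC, h⟩ := hw.exists_norm_resolventForm_le_high hd hm hγ
    (show 0 < δ / (2 * Real.pi) by positivity)
  set a := ‖resolventFactor γ‖ * (2 * Real.pi) with ha
  have ha0 : 0 ≤ a := by positivity
  refine ⟨(1 + a) * C, one_le_mul_of_one_le_of_one_le (by linarith) hC, fun k z hx hy => ?_⟩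
  have hmk := hm.nonneg k
  have hre : |(z / (2 * Real.pi)).re| = |z.re| / (2 * Real.pi) := by
    rw [div_two_pi_re, abs_div, abs_of_pos h2π]
  have him : |(z / (2 * Real.pi)).im| ≤ 1 := by
    rw [div_two_pi_im, abs_div, abs_of_pos h2π]
    exact (div_le_self (abs_nonneg _) (by linarith)).trans hy.1
  have hz := div_two_pi_im_ne_zero hy.2
  have hop := norm_resolventOp_le hw hγ k hz (by positivity) fun u v =>
    h k (z / (2 * Real.pi)) u v (by rw [hre]; gcongr) him hz
  rw [hre] at hop
  have hp := div_two_pi_add_one_zpow_le hγ (abs_nonneg z.re)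
  refine (norm_weightedTower_le hw γ k z).trans ?_
  calc _ ≤ ‖resolventFactor γ‖ * (C ^ (k + 1) * m k *
        (2 * Real.pi * (|z.re| + 1) ^ (((∑ i, γ i : ℕ) : ℤ) - 1))) := by
        gcongr
        exact hop.trans (by gcongr)
    _ = (a * C ^ (k + 1)) * m k * (|z.re| + 1) ^ (((∑ i, γ i : ℕ) : ℤ) - 1) := by rw [ha]; ring
    _ ≤ _ := by
      have := mul_pow_succ_le ha0 (by linarith : 0 ≤ C) k
      gcongr

theorem exists_norm_weightedTower_le_of_odd (hd : 2 ≤ d) (hodd : Odd d) (hm : IsAdmissible m A)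
    (hw : IsRapid w m B) {γ : Fin d → ℕ} (hγ : ∑ i, γ i ≤ 2) :
    ∃ C, 1 ≤ C ∧ ∀ (k : ℕ) (z : ℂ), |z.im| ≤ 1 ∧ z.im ≠ 0 →
      ‖weightedTower hw γ k z‖ ≤
        C ^ (k + 1) * m k * (|z.re| + 1) ^ (((∑ i, γ i : ℕ) : ℤ) - 1) := by
  have hπ := Real.pi_gt_three
  have h2π : 0 < 2 * Real.pi := by linarith
  obtain ⟨C₁, hC₁, h₁⟩ := exists_norm_weightedTower_le_high hd hm hw hγ one_pos
  obtain ⟨C₂, hC₂, h₂⟩ := hw.exists_norm_resolventForm_le_low hd hodd hm hγ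
  set a := ‖resolventFactor γ‖ * 2 with ha
  have ha0 : 0 ≤ a := by positivity
  refine ⟨max C₁ ((1 + a) * C₂), hC₁.trans (le_max_left _ _), fun k z hy => ?_⟩
  have hmk := hm.nonneg k
  rcases le_total 1 |z.re| with hx | hx
  · refine (h₁ k z hx hy).trans ?_
    gcongr
    exact le_max_left _ _
  -- The division by 2π > 2 maps |Re z| ≤ 1 into the low-energy range, so the high- and low-energy
  -- estimates together cover all energies.
  · have hre : |(z / (2 * Real.pi)).re| ≤ 1 / 2 := by
      rw [div_two_pi_re, abs_div, abs_of_pos h2π, div_le_iff₀ h2π]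
      linarith
    have him : |(z / (2 * Real.pi)).im| ≤ 1 := by
      rw [div_two_pi_im, abs_div, abs_of_pos h2π]
      exact (div_le_self (abs_nonneg _) (by linarith)).trans hy.1
    have hz := div_two_pi_im_ne_zero hy.2
    have hop := norm_resolventOp_le hw hγ k hz (by positivity) fun u v =>
      h₂ k (z / (2 * Real.pi)) u v hre him hz
    have hp := one_le_two_mul_zpow hγ (abs_nonneg z.re) hx
    refine (norm_weightedTower_le hw γ k z).trans ?_
    calc _ ≤ ‖resolventFactor γ‖ * (C₂ ^ (k + 1) * m k) := by gcongr
      _ ≤ ‖resolventFactor γ‖ * (C₂ ^ (k + 1) * m k) *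
          (2 * (|z.re| + 1) ^ (((∑ i, γ i : ℕ) : ℤ) - 1)) :=
        le_mul_of_one_le_right (by positivity) hp
      _ = (a * C₂ ^ (k + 1)) * m k * (|z.re| + 1) ^ (((∑ i, γ i : ℕ) : ℤ) - 1) := by
        rw [ha]; ring
      _ ≤ ((1 + a) * C₂) ^ (k + 1) * m k * (|z.re| + 1) ^ (((∑ i, γ i : ℕ) : ℤ) - 1) := by
        have := mul_pow_succ_le ha0 (by linarith : 0 ≤ C₂) k
        gcongr
      _ ≤ _ := by
        gcongr
        exact le_max_right _ _

theorem isBoundedTower_weightedTower (hd : 2 ≤ d) (hm : IsAdmissible m A) (hw : IsRapid w m B)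
    {γ : Fin d → ℕ} (hγ : ∑ i, γ i ≤ 2) : IsBoundedTower (weightedTower hw γ) {0}ᶜ := by
  refine IsBoundedTower.of_eventually_le (fun k z hz => hasDerivAt_weightedTower hw hγ k
    (show z.im < 0 from hz).ne) fun k t ht => ?_
  have ht0 : 0 < |t| := abs_pos.mpr ht
  obtain ⟨C, -, hC⟩ := exists_norm_weightedTower_le_high hd hm hw hγ (half_pos ht0)
  refine ⟨_, continuousAt_bound (C ^ (k + 1) * m k) (((∑ i, γ i : ℕ) : ℤ) - 1) t, ?_⟩
  filter_upwards [eventually_le_abs_re ht0 le_rfl, eventually_abs_im_le t] with z h1 h2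
  exact hC k z h1 h2

theorem isBoundedTower_weightedTower_of_odd (hd : 2 ≤ d) (hodd : Odd d) (hm : IsAdmissible m A)
    (hw : IsRapid w m B) {γ : Fin d → ℕ} (hγ : ∑ i, γ i ≤ 2) :
    IsBoundedTower (weightedTower hw γ) univ := by
  refine IsBoundedTower.of_eventually_le (fun k z hz => hasDerivAt_weightedTower hw hγ k
    (show z.im < 0 from hz).ne) fun k t _ => ?_
  obtain ⟨C, -, hC⟩ := exists_norm_weightedTower_le_of_odd hd hodd hm hw hγ
  refine ⟨_, continuousAt_bound (C ^ (k + 1) * m k) (((∑ i, γ i : ℕ) : ℤ) - 1) t, ?_⟩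
  filter_upwards [eventually_abs_im_le t] with z h
  exact hC k z h

end Tower

end FreeResolvent

/-! ### Assembly -/

theorem proposition2p1 (d : ℕ) (hd : 2 ≤ d) (Θ : ℝ → ℝ) (hΘ : FreeResolvent.IsWeightProfile Θ)
    (m : ℕ → ℝ) (hm : FreeResolvent.IsWeightSequence Θ m) (c : ℝ) (hc : 0 < c)
    (α β : Fin d → ℕ) (hαβ : ∑ i, α i + ∑ i, β i ≤ 2) :
    ∃ T : ℂ → (FreeResolvent.L2 d →L[ℂ] FreeResolvent.L2 d),
      (∀ z : ℂ, z.im < 0 → FreeResolvent.IsBoundedExtension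
        (FreeResolvent.weightedResolvent (FreeResolvent.weight d Θ c) α β z) (T z)) ∧
      ContinuousOn T {z : ℂ | z.im ≤ 0 ∧ z ≠ 0} ∧
      ContDiffOn ℝ (⊤ : ℕ∞) (fun t : ℝ => T (t : ℂ)) {0}ᶜ ∧
      (∀ δ : ℝ, 0 < δ → ∃ C : ℝ, 0 < C ∧ ∀ (k : ℕ) (t : ℝ), δ ≤ |t| →
        ‖iteratedDeriv k (fun s : ℝ => T (s : ℂ)) t‖ ≤
          C ^ (k + 1) * m k * (|t| + 1) ^ (((∑ i, α i + ∑ i, β i : ℕ) : ℤ) - 1)) ∧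
      (Odd d →
        ContinuousOn T {z : ℂ | z.im ≤ 0} ∧
        ContDiff ℝ (⊤ : ℕ∞) (fun t : ℝ => T (t : ℂ)) ∧
        ∃ C : ℝ, 0 < C ∧ ∀ (k : ℕ) (t : ℝ),
          ‖iteratedDeriv k (fun s : ℝ => T (s : ℂ)) t‖ ≤
            C ^ (k + 1) * m k * (|t| + 1) ^ (((∑ i, α i + ∑ i, β i : ℕ) : ℤ) - 1)) := by
  obtain ⟨A, hA, hAm⟩ := hm.exists_isAdmissible
  obtain ⟨B, hw⟩ := FreeResolvent.exists_isRapid_weight (d := d) hΘ hc hA hAm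
  have hγ : ∑ i, (α + β) i ≤ 2 := by rwa [FreeResolvent.sum_add_apply]
  rw [← FreeResolvent.sum_add_apply]
  have hT := FreeResolvent.isBoundedTower_weightedTower hd hA hw hγ
  -- One and the same extension serves all dimensions; for odd d its tower is also bounded near 0.
  refine ⟨FreeResolvent.boundaryExtension (FreeResolvent.weightedTower hw (α + β) 0),
    fun z hz => ?_, hT.continuousOn 0 fun z hz => ⟨hz.1, fun h0 h => ?_⟩,
    hT.contDiffOn isOpen_compl_singleton, fun δ hδ => ?_, fun hodd => ?_⟩
  · rw [hT.boundaryExtension_eq 0 hz, FreeResolvent.weightedTower, pow_zero, mul_one]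
    exact FreeResolvent.isBoundedExtension_resolventOp hw (FreeResolvent.weight_pos hΘ hc) hαβ hz.ne
  · exact hz.2 (Complex.ext h h0)
  -- The threshold is δ/2 because a real t with |t| ≥ δ is approached by points z at which only |Re
  -- z| ≥ δ/2 is guaranteed.
  · obtain ⟨C, hC1, hC⟩ :=
      FreeResolvent.exists_norm_weightedTower_le_high hd hA hw hγ (half_pos hδ)
    refine ⟨C, by linarith, fun k t ht => ?_⟩
    have ht0 : t ∈ ({0}ᶜ : Set ℝ) := abs_pos.mp (hδ.trans_le ht)
    refine (congrArg norm (hT.iteratedDeriv_eq isOpen_compl_singleton k t ht0)).trans_le ?_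
    refine (hT.norm_boundaryExtension_le k ht0 (FreeResolvent.continuousAt_bound
      (C ^ (k + 1) * m k) (((∑ i, (α + β) i : ℕ) : ℤ) - 1) t) ?_).trans
      (by rw [Complex.ofReal_re])
    filter_upwards [FreeResolvent.eventually_le_abs_re hδ ht,
      FreeResolvent.eventually_abs_im_le t] with z h1 h2
    exact hC k z h1 h2
  · have hT' := FreeResolvent.isBoundedTower_weightedTower_of_odd hd hodd hA hw hγ
    refine ⟨hT'.continuousOn 0 fun z hz => ⟨hz, fun _ => Set.mem_univ _⟩,
      contDiffOn_univ.mp (hT'.contDiffOn isOpen_univ), ?_⟩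
    obtain ⟨C, hC1, hC⟩ := FreeResolvent.exists_norm_weightedTower_le_of_odd hd hodd hA hw hγ
    refine ⟨C, by linarith, fun k t => ?_⟩
    refine (congrArg norm (hT'.iteratedDeriv_eq isOpen_univ k t (Set.mem_univ t))).trans_le ?_
    refine (hT'.norm_boundaryExtension_le k (Set.mem_univ t) (FreeResolvent.continuousAt_bound
      (C ^ (k + 1) * m k) (((∑ i, (α + β) i : ℕ) : ℤ) - 1) t) ?_).trans
      (by rw [Complex.ofReal_re])
    filter_upwards [FreeResolvent.eventually_abs_im_le t] with z h
    exact hC k z h
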